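/- **Setting.** Let $X\subseteq\mathbb R^n$ be closed and convex, $\xi:\Omega\to\Xi$ a random variable on a probability space $(\Omega,\mathcal F,\mathbb P)$ with values in a measurable space $\Xi$, $T:\Xi\times\mathbb R^n\to\mathbb R^n$ measurable, $H(x):=\mathbb E[T(\xi,x)]$, and let $\mathrm{SOL}(X,H)$ be the set of $x^*\in X$ with $\langle H(x^*),x-x^*\rangle\ge 0$ for all $x\in X$. Norms are Euclidean, $P_X$ is the Euclidean projection onto $X$, and $r_t(x):=\|P_X(x-tH(x))-x\|$. Assume that $\mathrm{SOL}(X,H)\neq\emptyset$ and: 1. $H$ is pseudomonotone on $X$: for $x,y\in X$, $\langle H(x),y-x\rangle\ge0$ implies $\langle H(y),y-x\rangle\ge0$. 2. There are a measurable $L:\Xi\to\mathbb R$, $p,q\ge2$ and $\check x\in\mathbb R^n$ such that almost surely $L(\xi)\ge1$ and $\|T(\xi,x)-T(\xi,y)\|\le L(\xi)\|x-y\|$ for all $x,y\in\mathbb R^n$, and such that $\mathbb E[L(\xi)^{2p}]\le\Lambda<\infty$ and $\mathbb E[\|T(\xi,\check x)\|^{2q}]\le\sigma<\infty$. **Algorithm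 (Anderson(1)-SEG).** Let $\nu\ge0$, $\gamma\in(0,1]$, $\rho\in(0,1)$, $\mu\in(0,\frac{\sqrt3}{3})$, $\tau>\frac12$, $M>0$, $x_0\in X$, $\theta_0=1$, and $$S_k:=\mathcal N\left\lceil (k+\lambda)^2(\ln(k+\lambda))^{2+2b}\right\rceil,\qquad \mathcal N\in\{1,2,\dots\},\ \mathcal N\le c\,n^2,\ b>0,\ \lambda>2 .$$ Let $\xi^k_j,\eta^k_j$ ($k\ge0$, $1\le j\le S_k$) be mutually independent and distributed as $\xi$, and put $H_{\xi^k}(x)=\frac1{S_k}\sum_jT(\xi^k_j,x)$, $H_{\eta^k}(x)=\frac1{S_k}\sum_jT(\eta^k_j,x)$. For $k=0,1,2,\dots$: if $P_X(x_k-\gamma H_{\xi^k}(x_k))=x_k$, set $x_{k+1}=x_k$, $\theta_{k+1}=\theta_k$ (and $m_k=0$). Otherwise let $m_k$ be the least integer $m\ge0$ such that, with $t=\gamma\rho^m$ and $y=P_X(x_k-tH_{\xi^k}(x_k))$, one has $t\|H_{\xi^k}(x_k)-H_{\xi^k}(y)\|\le\mu\|x_k-y\|$; let $t_k=\gamma\rho^{m_k}$,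 $y_{k+0.5}=P_X(x_k-t_kH_{\xi^k}(x_k))$, $F_k=y_{k+0.5}-x_k$, $y_{k+1}=P_X(x_k-t_kH_{\eta^k}(y_{k+0.5}))$, $\tilde F_k=y_{k+1}-x_k$. If $\|\tilde F_k\|<\min\{\|F_k\|,\nu\theta_k^{-\tau}\}$, let $\alpha_k=\langle\tilde F_k,\tilde F_k-F_k\rangle/\|\tilde F_k-F_k\|^2$, otherwise $\alpha_k=M+1$. If $|\alpha_k|\le M$, set $x_{k+1}=\alpha_kx_k+(1-\alpha_k)y_{k+1}$, $\theta_{k+1}=\theta_k+1$; otherwise set $x_{k+1}=y_{k+1}$, $\theta_{k+1}=\theta_k$. Let $x^*\in\mathrm{SOL}(X,H)$ with $\|x_0-x^*\|\le R$ and $\|\check x-x^*\|\le R$, let $b\le b_{\max}$, and put $\tilde L_k:=\frac1{S_k}\sum_jL(\xi^k_j)$ and $V:=\sup_{k\ge0}\mathbb E[\|x_k-x^*\|^2]$. **Theorem.** There are constants $C_1,C_2>0$ and a function $W:\mathbb R\to\mathbb R$, depending only on $\nu,\gamma,\rho,\mu,\tau,M,p,q,\Lambda,\sigma,R,c,b_{\max},\lambda$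 (in particular $C_1,C_2$ do not depend on $b$, and $C_1,C_2,W$ depend neither on $n$ nor on $\mathcal N$), such that the following holds. (i) $V\le W(b)<\infty$, and $\mathbb E[r_\gamma(x_k)^2]<\infty$ for all $k$. (ii) For every $\varsigma>0$, with $N=N(\varsigma):=\left\lceil C_1(1+V)\,b^{-1}\varsigma^{-1}\right\rceil$, $$\min_{0\le k\le N}\mathbb E\left[r_\gamma(x_k)^2\right]\le\varsigma .$$ (iii) With probability $1$, for every $\varsigma>0$ with $b\varsigma\le\frac12$, the oracle complexity of these iterations satisfies $$\sum_{k=0}^{N}(1+m_k)S_k\ \le\ C_2(1+V)^4\; b^{-3}\left(1+\max_{0\le k\le N}\log_{\frac1\rho}\left(\frac{\gamma\tilde L_k}{\min\{\rho\mu,\gamma\}}\right)\right)\left(\ln(b^{-1}\varsigma^{-1})\right)^{2+2b}\,n^2\varsigma^{-3}.$$ -/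

import Mathlib

open MeasureTheory ProbabilityTheory
open scoped BigOperators

noncomputable section

namespace AndersonSEG

/-- `ℝⁿ` with the Euclidean norm. -/
abbrev Vec (n : ℕ) := EuclideanSpace ℝ (Fin n)

/-- `y` is a point of `X` nearest to `x`. -/
def IsNearest {n : ℕ} (X : Set (Vec n)) (x y : Vec n) : Prop :=
  y ∈ X ∧ ∀ z ∈ X, ‖y - x‖ ≤ ‖z - x‖

open Classical in
/-- The Euclidean projection `P_X(x)`. For a nonempty closed convex `X` the nearest point exists
and is unique, so the default value is never used. -/
def proj {n : ℕ} (X : Set (Vec n)) (x : Vec n) : Vec n :=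
  if h : ∃ y, IsNearest X x y then h.choose else x

/-- The solution set `SOL(X, H)` of the variational inequality. -/
def SOL {n : ℕ} (X : Set (Vec n)) (H : Vec n → Vec n) : Set (Vec n) :=
  {xs | xs ∈ X ∧ ∀ x ∈ X, 0 ≤ inner ℝ (H xs) (x - xs)}

/-- `H` is pseudomonotone on `X`. -/
def Pseudomonotone {n : ℕ} (X : Set (Vec n)) (H : Vec n → Vec n) : Prop :=
  ∀ x ∈ X, ∀ y ∈ X, 0 ≤ inner ℝ (H x) (y - x) → 0 ≤ inner ℝ (H y) (y - x)

/-- The residual `r_t(x) = ‖P_X(x - t H(x)) - x‖`. -/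
def residual {n : ℕ} (X : Set (Vec n)) (H : Vec n → Vec n) (t : ℝ) (x : Vec n) : ℝ :=
  ‖proj X (x - t • H x) - x‖

/-- The mean operator `H(x) = 𝔼[T(ξ, x)]`. -/
def meanOp {n : ℕ} {Ω Ξ : Type*} [MeasurableSpace Ω] (P : Measure Ω)
    (T : Ξ → Vec n → Vec n) (ξ : Ω → Ξ) (x : Vec n) : Vec n :=
  ∫ ω, T (ξ ω) x ∂P

/-- The empirical operator `x ↦ (1/N) ∑ⱼ T(sⱼ, x)`. -/
def empOp {n : ℕ} {Ξ : Type*} (T : Ξ → Vec n → Vec n) {N : ℕ} (s : Fin N → Ξ) (x : Vec n) :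
    Vec n :=
  (N : ℝ)⁻¹ • ∑ j, T (s j) x

/-- The empirical mean `(1/N) ∑ⱼ L(sⱼ)`. -/
def empMean {Ξ : Type*} (L : Ξ → ℝ) {N : ℕ} (s : Fin N → Ξ) : ℝ :=
  (N : ℝ)⁻¹ * ∑ j, L (s j)

/-- The parameters of the Anderson(1)-SEG algorithm (besides the sample rate). -/
structure Params where
  ν : ℝ
  γ : ℝ
  ρ : ℝ
  μ : ℝ
  τ : ℝ
  M : ℝ

/-- The ranges in which the parameters are chosen. -/
structure Params.Admissible (a : Params) : Prop where
  ν_nonneg : 0 ≤ a.ν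
  γ_pos : 0 < a.γ
  γ_le_one : a.γ ≤ 1
  ρ_pos : 0 < a.ρ
  ρ_lt_one : a.ρ < 1
  μ_pos : 0 < a.μ
  μ_lt : a.μ < Real.sqrt 3 / 3
  τ_gt : 1 / 2 < a.τ
  M_pos : 0 < a.M

/-- The line search test at the trial step size `γ ρ^m`, with `A` the empirical operator `H_ξᵏ`. -/
def LineSearchTest {n : ℕ} (a : Params) (X : Set (Vec n)) (A : Vec n → Vec n) (x : Vec n)
    (m : ℕ) : Prop :=
  a.γ * a.ρ ^ m * ‖A x - A (proj X (x - (a.γ * a.ρ ^ m) • A x))‖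
    ≤ a.μ * ‖x - proj X (x - (a.γ * a.ρ ^ m) • A x)‖

/-- The number `m` of step size reductions made by the line search: the least `m` whose trial step
size passes the test. It is `0` when `P_X(x - γ A x) = x`, where no line search is made. -/
def lineSearchCount {n : ℕ} (a : Params) (X : Set (Vec n)) (A : Vec n → Vec n) (x : Vec n) : ℕ :=
  sInf {m | LineSearchTest a X A x m}

open Classical in
/-- One iteration. The state is `(x_k, θ_k)`; `A` and `B` are the empirical operators `H_ξᵏ` and
`H_ηᵏ`; `t` is the step size, `y` is `y_{k+1/2}`, `z` is `y_{k+1}`, `F = F_{t_k,ξᵏ}`,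
`G = F̃_{t_k,ηᵏ}`, and `α` is the Anderson coefficient. -/
def step {n : ℕ} (a : Params) (X : Set (Vec n)) (A B : Vec n → Vec n) (s : Vec n × ℕ) :
    Vec n × ℕ :=
  let x := s.1
  let θ := s.2
  if proj X (x - a.γ • A x) - x = 0 then (x, θ)
  else
    let t := a.γ * a.ρ ^ lineSearchCount a X A x
    let y := proj X (x - t • A x)
    let F := y - x
    let z := proj X (x - t • B y)
    let G := z - x
    let α : ℝ :=
      if ‖G‖ < min ‖F‖ (a.ν * (θ : ℝ) ^ (-a.τ)) then inner ℝ G (G - F) / ‖G - F‖ ^ 2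
      else a.M + 1
    if |α| ≤ a.M then (α • x + (1 - α) • z, θ + 1) else (z, θ)

/-- The states `(x_k, θ_k)` of the algorithm for the sample rate `S`, the starting point `x₀`
and the samples `ξs k j`, `ηs k j`, `j < S k`. -/
def run {n : ℕ} {Ω Ξ : Type*} (a : Params) (X : Set (Vec n)) (T : Ξ → Vec n → Vec n)
    {S : ℕ → ℕ} (ξs ηs : (k : ℕ) → Fin (S k) → Ω → Ξ) (x₀ : Vec n) (ω : Ω) : ℕ → Vec n × ℕ
  | 0 => (x₀, 1)
  | k + 1 => step a X (empOp T fun j => ξs k j ω) (empOp T fun j => ηs k j ω)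
      (run a X T ξs ηs x₀ ω k)

/-- The iterate `x_k`. -/
def iterate {n : ℕ} {Ω Ξ : Type*} (a : Params) (X : Set (Vec n)) (T : Ξ → Vec n → Vec n)
    {S : ℕ → ℕ} (ξs ηs : (k : ℕ) → Fin (S k) → Ω → Ξ) (x₀ : Vec n) (k : ℕ) (ω : Ω) : Vec n :=
  (run a X T ξs ηs x₀ ω k).1

/-- The number `m_k` of line search reductions in iteration `k`. -/
def searchCount {n : ℕ} {Ω Ξ : Type*} (a : Params) (X : Set (Vec n)) (T : Ξ → Vec n → Vec n)
    {S : ℕ → ℕ} (ξs ηs : (k : ℕ) → Fin (S k) → Ω → Ξ) (x₀ : Vec n) (k : ℕ) (ω : Ω) : ℕ :=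
  lineSearchCount a X (empOp T fun j => ξs k j ω) (iterate a X T ξs ηs x₀ k ω)

/-- The sample rate `S_k = 𝒩 ⌈(k + lam)² (ln (k + lam))^(2 + 2b)⌉`. -/
def sampleRate (𝒩 : ℕ) (lam b : ℝ) (k : ℕ) : ℕ :=
  𝒩 * ⌈((k : ℝ) + lam) ^ 2 * Real.log ((k : ℝ) + lam) ^ (2 + 2 * b)⌉₊

/-- Random Lipschitz continuity of `T` with modulus `L`, and the moment conditions, with bounds
`Λ` and `σ` for the moments. -/
structure LipschitzMoments {n : ℕ} {Ω Ξ : Type*} [MeasurableSpace Ω] [MeasurableSpace Ξ]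
    (P : Measure Ω) (T : Ξ → Vec n → Vec n) (ξ : Ω → Ξ) (L : Ξ → ℝ) (xc : Vec n)
    (p q Λ σ : ℝ) : Prop where
  measurable_L : Measurable L
  one_le_L : ∀ᵐ s ∂(P.map ξ), 1 ≤ L s
  lipschitz : ∀ᵐ s ∂(P.map ξ), ∀ x y, ‖T s x - T s y‖ ≤ L s * ‖x - y‖
  integrable_L : Integrable (fun ω => L (ξ ω) ^ (2 * p)) P
  moment_L : ∫ ω, L (ξ ω) ^ (2 * p) ∂P ≤ Λ
  integrable_T : Integrable (fun ω => ‖T (ξ ω) xc‖ ^ (2 * q)) P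
  moment_T : ∫ ω, ‖T (ξ ω) xc‖ ^ (2 * q) ∂P ≤ σ

/-- All the samples `ξs k j`, `ηs k j` are distributed as `ξ` and are mutually independent. -/
structure IsSampling {Ω Ξ : Type*} [MeasurableSpace Ω] [MeasurableSpace Ξ] (P : Measure Ω)
    (ξ : Ω → Ξ) {S : ℕ → ℕ} (ξs ηs : (k : ℕ) → Fin (S k) → Ω → Ξ) : Prop where
  measurable_ξs : ∀ k j, Measurable (ξs k j)
  measurable_ηs : ∀ k j, Measurable (ηs k j)
  law_ξs : ∀ k j, IdentDistrib (ξs k j) ξ P P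
  law_ηs : ∀ k j, IdentDistrib (ηs k j) ξ P P
  indep : iIndepFun
    (Sum.elim (fun i : (k : ℕ) × Fin (S k) => ξs i.1 i.2)
      (fun i : (k : ℕ) × Fin (S k) => ηs i.1 i.2)) P

end AndersonSEG

end

/-! The proof is a Lyapunov estimate in expectation. Pseudomonotonicity enters only through ⟨H(y), y
- x*⟩ ≥ 0 at the half-step point y. With it, the extragradient step lowers ‖x_k - x*‖² by (1 -
3μ²)‖F_k‖², up to sampling errors at y (`extragradient_ineq`). An accepted Anderson step is an
affine combination with α < 1/2, which keeps at least half of this decrease. If α < 0 it adds at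
most M(1 + M)‖F̃_k‖² ≤ M(1 + M)ν²θ^(-2τ), which is summable over Anderson steps because 2τ > 1. The
squared distance plus the remaining tail of that series therefore decreases up to sampling error
(`lyapunov_step_le`).

The difficulty is that y depends on the sample ξ^k, so H_ξ(y) - H(y) is not an average of centred
variables, and a bound uniform in y would bring in the dimension. Instead y is compared with v_m =
P_X(x - γρ^m H(x)), which is deterministic for each m. Nonexpansiveness gives ‖y - v_m‖ ≤ ‖H_ξ(x) -
H(x)‖ for the realized m, both operators are Lipschitz, and t_k² ≤ ρ^m makes the sum over all
possible m geometric. Fourth moments, available since p, q ≥ 2, decouple the random Lipschitz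
constant from the error at x. The sample η^k is independent of y, so fixed-point bounds apply to it.
The expected error is O((1 + ‖x - x*‖²) / √S_k), free of the dimension (`lintegral_stepError_le`).

The residual is bounded by a multiple of ‖F_k‖ plus the error at x as long as the empirical
Lipschitz constant is at most 2K. A Markov argument makes the complementary event cost only half of
the squared residual, which is absorbed (`residual_sq_le`).

Finally Σ S_k^(-1/2) = O(1/b) by comparison with the telescoping sequence ln(k + λ)^(-b). A Gronwall
argument bounds the second moments, and summing the decrease gives Σ E[r_γ(x_k)²] = O((1 + V)/b),
hence N(ς) (`IsSampling.iterate_bounds`). For the complexity, N + 1 sample sizes of order n² N² (ln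
N)^(2+2b) are added. This yields (1 + V)³, and the powers of ln(1 + V) cost one more factor. -/

noncomputable section

namespace AndersonSEG

/-! ### Euclidean projection onto a closed convex set -/

section Projection

variable {n : ℕ} {X : Set (Vec n)}

theorem proj_isNearest (hne : X.Nonempty) (hc : IsClosed X) (hX : Convex ℝ X) (x : Vec n) :
    IsNearest X x (proj X x) := by
  have h : ∃ y, IsNearest X x y := by
    obtain ⟨v, hv, hmin⟩ := exists_norm_eq_iInf_of_complete_convex hne hc.isComplete hX x
    refine ⟨v, hv, fun z hz => ?_⟩
    rw [norm_sub_rev v x, norm_sub_rev z x, hmin]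
    exact ciInf_le (f := fun w : X => ‖x - w‖) ⟨0, by rintro _ ⟨w, rfl⟩; exact norm_nonneg _⟩ ⟨z, hz⟩
  rw [proj, dif_pos h]
  exact h.choose_spec

theorem proj_mem (hne : X.Nonempty) (hc : IsClosed X) (hX : Convex ℝ X) (x : Vec n) :
    proj X x ∈ X :=
  (proj_isNearest hne hc hX x).1

theorem inner_sub_proj_le (hne : X.Nonempty) (hc : IsClosed X) (hX : Convex ℝ X) (x : Vec n)
    {w : Vec n} (hw : w ∈ X) : inner ℝ (x - proj X x) (w - proj X x) ≤ 0 := by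
  have hp := proj_isNearest hne hc hX x
  refine (norm_eq_iInf_iff_real_inner_le_zero hX hp.1).1 ?_ w hw
  have : Nonempty X := hne.to_subtype
  refine le_antisymm (le_ciInf fun z => ?_)
    (ciInf_le (f := fun w : X => ‖x - w‖) ⟨0, by rintro _ ⟨w, rfl⟩; exact norm_nonneg _⟩
      ⟨proj X x, hp.1⟩)
  rw [norm_sub_rev x, norm_sub_rev x]
  exact hp.2 z z.2

/-- Adding the two obtuse-angle inequalities gives firm nonexpansiveness, and Cauchy–Schwarz
finishes. -/
theorem norm_proj_sub_proj_le (hne : X.Nonempty) (hc : IsClosed X) (hX : Convex ℝ X)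
    (x y : Vec n) : ‖proj X x - proj X y‖ ≤ ‖x - y‖ := by
  have h1 := inner_sub_proj_le hne hc hX x (proj_mem hne hc hX y)
  have h2 := inner_sub_proj_le hne hc hX y (proj_mem hne hc hX x)
  have h3 : ‖proj X x - proj X y‖ ^ 2 ≤ inner ℝ (x - y) (proj X x - proj X y) := by
    rw [← real_inner_self_eq_norm_sq]
    simp only [inner_sub_left, inner_sub_right] at *
    linarith
  have h4 := real_inner_le_norm (x - y) (proj X x - proj X y)
  by_contra! h
  have h0 := norm_nonneg (x - y)
  nlinarith

theorem continuous_proj (hne : X.Nonempty) (hc : IsClosed X) (hX : Convex ℝ X) :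
    Continuous (proj X) := by
  refine (LipschitzWith.of_dist_le_mul (K := 1) fun x y => ?_).continuous
  simpa [dist_eq_norm] using norm_proj_sub_proj_le hne hc hX x y

theorem proj_of_mem (hc : IsClosed X) (hX : Convex ℝ X) {x : Vec n} (hx : x ∈ X) :
    proj X x = x := by
  have h := inner_sub_proj_le ⟨x, hx⟩ hc hX x hx
  have h' : x - proj X x = 0 := by
    rw [← inner_self_eq_zero (𝕜 := ℝ)]
    exact le_antisymm h real_inner_self_nonneg
  exact (sub_eq_zero.1 h').symm

/-- The residual at the step size `t` is at most `t / s` times the one at `s ≤ t`. -/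
theorem mul_norm_proj_sub_le (hne : X.Nonempty) (hc : IsClosed X) (hX : Convex ℝ X)
    (x v : Vec n) {s t : ℝ} (hs : 0 < s) (hst : s ≤ t) :
    s * ‖proj X (x - t • v) - x‖ ≤ t * ‖proj X (x - s • v) - x‖ := by
  have h1 := inner_sub_proj_le hne hc hX (x - t • v) (proj_mem hne hc hX (x - s • v))
  have h2 := inner_sub_proj_le hne hc hX (x - s • v) (proj_mem hne hc hX (x - t • v))
  set p := proj X (x - t • v)
  set q := proj X (x - s • v)
  obtain ⟨e, he⟩ : ∃ e, e = p - x := ⟨_, rfl⟩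
  obtain ⟨f, hf⟩ : ∃ f, f = q - x := ⟨_, rfl⟩
  have e1 : x - t • v - p = -(e + t • v) := by rw [he]; abel
  have e2 : q - p = f - e := by rw [he, hf]; abel
  have e3 : x - s • v - q = -(f + s • v) := by rw [hf]; abel
  have e4 : p - q = e - f := by rw [he, hf]; abel
  rw [e1, e2] at h1
  rw [e3, e4] at h2
  rw [← he, ← hf]
  simp only [inner_neg_left, inner_sub_right, inner_add_left, real_inner_smul_left,
    real_inner_self_eq_norm_sq] at h1 h2
  rw [real_inner_comm e f] at h2
  have hcs := real_inner_le_norm e f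
  -- This says (s‖e‖ - t‖f‖)(‖e‖ - ‖f‖) ≤ 0. If s‖e‖ > t‖f‖ then, since s ≤ t, both factors would be
  -- positive.
  have key : s * ‖e‖ ^ 2 + t * ‖f‖ ^ 2 ≤ (s + t) * (‖e‖ * ‖f‖) := by
    have : s * ‖e‖ ^ 2 + t * ‖f‖ ^ 2 ≤ (s + t) * inner ℝ e f := by
      have a1 := mul_le_mul_of_nonneg_left h1 hs.le
      have a2 := mul_le_mul_of_nonneg_left h2 (hs.le.trans hst)
      linarith
    exact this.trans (mul_le_mul_of_nonneg_left hcs (by linarith))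
  by_contra! hlt
  have hf0 := norm_nonneg f
  have he0 := norm_nonneg e
  have hef : ‖f‖ < ‖e‖ := by
    by_contra! hle
    nlinarith
  nlinarith [mul_pos (sub_pos.2 hlt) (sub_pos.2 hef)]

end Projection

/-! ### Deterministic inequalities for the extragradient and Anderson steps -/

/-- The basic inequality of the extragradient step `y = P(x - t a)`, `z = P(x - t b)`, where `h`
stands for the exact operator at `y`, and `a'` for the operator of the first half step at `y`. -/
theorem extragradient_ineq {n : ℕ} {X : Set (Vec n)} (hc : IsClosed X) (hX : Convex ℝ X)
    {x xs a a' b h : Vec n} {t μ : ℝ} (hxs : xs ∈ X) (ht : 0 ≤ t)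
    (hls : t * ‖a - a'‖ ≤ μ * ‖x - proj X (x - t • a)‖)
    (hh : 0 ≤ inner ℝ h (proj X (x - t • a) - xs)) :
    ‖proj X (x - t • b) - xs‖ ^ 2 ≤ ‖x - xs‖ ^ 2
      - (1 - 3 * μ ^ 2) * ‖proj X (x - t • a) - x‖ ^ 2
      + (3 * t ^ 2 * (‖a' - h‖ ^ 2 + ‖b - h‖ ^ 2)
        + 2 * t * (‖b - h‖ * ‖proj X (x - t • a) - xs‖)) := by
  have hne : X.Nonempty := ⟨xs, hxs⟩
  have h1 := inner_sub_proj_le hne hc hX (x - t • b) hxs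
  have h2 := inner_sub_proj_le hne hc hX (x - t • a) (proj_mem hne hc hX (x - t • b))
  rw [norm_sub_rev _ x]
  set y := proj X (x - t • a)
  set z := proj X (x - t • b)
  obtain ⟨p, hp⟩ : ∃ p, p = x - y := ⟨_, rfl⟩
  obtain ⟨v, hv⟩ : ∃ v, v = z - y := ⟨_, rfl⟩
  obtain ⟨w, hw⟩ : ∃ w, w = y - xs := ⟨_, rfl⟩
  have e1 : x - t • b - z = p - v - t • b := by rw [hp, hv]; abel
  have e2 : xs - z = -(v + w) := by rw [hw, hv]; abel
  have e3 : x - t • a - y = p - t • a := by rw [hp]; abel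
  have e4 : z - xs = v + w := by rw [hw, hv]; abel
  have e5 : x - xs = p + w := by rw [hw, hp]; abel
  rw [e1, e2] at h1
  rw [e3, ← hv] at h2
  rw [← hw] at hh
  rw [← hp] at hls
  rw [e4, e5, ← hp, ← hw]
  have hc1 := real_inner_le_norm (-(b - h)) w
  rw [norm_neg] at hc1
  -- The term ‖v‖² produced here cancels against the -‖z - y‖² of the classical extragradient
  -- estimate.
  have hyoung : 2 * t * inner ℝ (a - b) v ≤ t ^ 2 * ‖a - b‖ ^ 2 + ‖v‖ ^ 2 := by
    have := real_inner_le_norm (a - b) v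
    have h' := mul_le_mul_of_nonneg_left this (by positivity : 0 ≤ 2 * t)
    nlinarith [sq_nonneg (t * ‖a - b‖ - ‖v‖)]
  -- Of the three parts of a - b, the line search controls the first. The factor 3 from squaring is
  -- the origin of the condition 3μ² < 1.
  have htri : t ^ 2 * ‖a - b‖ ^ 2
      ≤ 3 * (μ ^ 2 * ‖p‖ ^ 2) + 3 * t ^ 2 * (‖a' - h‖ ^ 2 + ‖b - h‖ ^ 2) := by
    have ha : ‖a - b‖ ≤ ‖a - a'‖ + ‖a' - h‖ + ‖b - h‖ := by
      have : a - b = (a - a') + (a' - h) - (b - h) := by abel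
      rw [this]
      exact (norm_sub_le _ _).trans (by gcongr; exact norm_add_le _ _)
    have hsq : t ^ 2 * ‖a - a'‖ ^ 2 ≤ μ ^ 2 * ‖p‖ ^ 2 := by
      rw [← mul_pow, ← mul_pow]
      exact pow_le_pow_left₀ (by positivity) hls 2
    have h3 : ‖a - b‖ ^ 2 ≤ 3 * (‖a - a'‖ ^ 2 + ‖a' - h‖ ^ 2 + ‖b - h‖ ^ 2) := by
      refine (pow_le_pow_left₀ (norm_nonneg _) ha 2).trans ?_
      nlinarith [sq_nonneg (‖a - a'‖ - ‖a' - h‖), sq_nonneg (‖a - a'‖ - ‖b - h‖),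
        sq_nonneg (‖a' - h‖ - ‖b - h‖)]
    nlinarith [mul_le_mul_of_nonneg_left h3 (sq_nonneg t)]
  have hth := mul_nonneg ht hh
  have hc2 := mul_le_mul_of_nonneg_left hc1 ht
  have x1 := norm_add_sq_real v w
  have x2 := norm_add_sq_real p w
  simp only [inner_neg_left, inner_neg_right, inner_sub_left, inner_add_right,
    real_inner_smul_left, real_inner_self_eq_norm_sq] at h1 h2 hyoung hc2
  linarith

/-- The Anderson coefficient of `G`, `F` with `‖G‖ < ‖F‖` is less than `1 / 2`. -/
theorem anderson_coeff_lt_half {n : ℕ} {F G : Vec n} (h : ‖G‖ < ‖F‖) :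
    inner ℝ G (G - F) / ‖G - F‖ ^ 2 < 1 / 2 := by
  have hne : G - F ≠ 0 := by
    intro h0
    rw [sub_eq_zero] at h0
    simp [h0] at h
  have hpos : 0 < ‖G - F‖ ^ 2 := by positivity
  -- After expansion the claim 2⟨G, G - F⟩ < ‖G - F‖² is just ‖G‖² < ‖F‖².
  rw [div_lt_iff₀ hpos, norm_sub_sq_real, inner_sub_right, real_inner_self_eq_norm_sq]
  nlinarith [norm_nonneg G, norm_nonneg F]

/-- An identity for every real α is needed, since the Anderson coefficient may be negative. In that
case the last term is a genuine perturbation. -/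
theorem norm_affine_comb_sub_sq {n : ℕ} (α : ℝ) (x z w : Vec n) :
    ‖α • x + (1 - α) • z - w‖ ^ 2
      = α * ‖x - w‖ ^ 2 + (1 - α) * ‖z - w‖ ^ 2 - α * (1 - α) * ‖z - x‖ ^ 2 := by
  have e1 : α • x + (1 - α) • z - w = α • (x - w) + (1 - α) • (z - w) := by
    module
  have e2 : z - x = (z - w) - (x - w) := by abel
  rw [e1, e2, norm_add_sq_real, norm_sub_sq_real (z - w) (x - w), norm_smul, norm_smul, real_inner_smul_left,
    real_inner_smul_right, real_inner_comm (x - w) (z - w), mul_pow, mul_pow, Real.norm_eq_abs,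
    Real.norm_eq_abs, sq_abs, sq_abs]
  ring

/-! ### Line search: termination, number of reductions, control of the residual -/

/-- The step size accepted by the line search. -/
def stepSize {n : ℕ} (a : Params) (X : Set (Vec n)) (A : Vec n → Vec n) (x : Vec n) : ℝ :=
  a.γ * a.ρ ^ lineSearchCount a X A x

/-- The point `y_{k+1/2}` of an iteration. -/
def midPoint {n : ℕ} (a : Params) (X : Set (Vec n)) (A : Vec n → Vec n) (x : Vec n) : Vec n :=
  proj X (x - stepSize a X A x • A x)

section LineSearch

variable {n : ℕ} {a : Params} {X : Set (Vec n)} {A : Vec n → Vec n} {x : Vec n}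

theorem stepSize_pos (ha : a.Admissible) : 0 < stepSize a X A x :=
  mul_pos ha.γ_pos (pow_pos ha.ρ_pos _)

theorem stepSize_le (ha : a.Admissible) : stepSize a X A x ≤ a.γ :=
  mul_le_of_le_one_right ha.γ_pos.le (pow_le_one₀ ha.ρ_pos.le ha.ρ_lt_one.le)

theorem stepSize_le_one (ha : a.Admissible) : stepSize a X A x ≤ 1 :=
  (stepSize_le ha).trans ha.γ_le_one

theorem lineSearchTest_of_lipschitz {l : ℝ} (hA : ∀ x y, ‖A x - A y‖ ≤ l * ‖x - y‖)
    (ha : a.Admissible) {m : ℕ} (hm : a.γ * a.ρ ^ m * l ≤ a.μ) : LineSearchTest a X A x m := by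
  have ht : 0 ≤ a.γ * a.ρ ^ m := mul_nonneg ha.γ_pos.le (pow_nonneg ha.ρ_pos.le _)
  unfold LineSearchTest
  calc _ ≤ a.γ * a.ρ ^ m * (l * ‖x - proj X (x - (a.γ * a.ρ ^ m) • A x)‖) :=
        mul_le_mul_of_nonneg_left (hA _ _) ht
    _ ≤ _ := by
        rw [← mul_assoc]
        exact mul_le_mul_of_nonneg_right hm (norm_nonneg _)

theorem exists_lineSearchTest {l : ℝ} (hl : 0 < l) (hA : ∀ x y, ‖A x - A y‖ ≤ l * ‖x - y‖)
    (ha : a.Admissible) : ∃ m, LineSearchTest a X A x m := by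
  obtain ⟨m, hm⟩ := exists_pow_lt_of_lt_one (div_pos ha.μ_pos (mul_pos ha.γ_pos hl)) ha.ρ_lt_one
  refine ⟨m, lineSearchTest_of_lipschitz hA ha ?_⟩
  rw [lt_div_iff₀ (mul_pos ha.γ_pos hl)] at hm
  linarith

theorem lineSearchTest_count {l : ℝ} (hl : 0 < l) (hA : ∀ x y, ‖A x - A y‖ ≤ l * ‖x - y‖)
    (ha : a.Admissible) : LineSearchTest a X A x (lineSearchCount a X A x) :=
  Nat.sInf_mem (exists_lineSearchTest hl hA ha)

/-- Either no reduction is made, or the step size is bounded below. -/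
theorem lineSearchCount_eq_zero_or {l : ℝ} (hA : ∀ x y, ‖A x - A y‖ ≤ l * ‖x - y‖)
    (ha : a.Admissible) :
    lineSearchCount a X A x = 0 ∨ a.ρ * a.μ < stepSize a X A x * l := by
  rcases Nat.eq_zero_or_eq_succ_pred (lineSearchCount a X A x) with h | h
  · exact Or.inl h
  · right
    by_contra! hle
    -- The trial step just before the accepted one failed the test, although steps with t * l ≤ μ
    -- always pass.
    have hlt : (lineSearchCount a X A x).pred < lineSearchCount a X A x := by omega
    refine Nat.notMem_of_lt_sInf hlt (lineSearchTest_of_lipschitz hA ha ?_)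
    unfold stepSize at hle
    rw [h, pow_succ] at hle
    nlinarith [ha.ρ_pos]

/-- If a reduction was made, ρμ < γ ρ^m l bounds ρ^(-m). If none was made, the γ inside the minimum
and l ≥ 1 keep the logarithm nonnegative. -/
theorem lineSearchCount_le_logb {l : ℝ} (hl : 1 ≤ l) (hA : ∀ x y, ‖A x - A y‖ ≤ l * ‖x - y‖)
    (ha : a.Admissible) :
    (lineSearchCount a X A x : ℝ)
      ≤ Real.logb (1 / a.ρ) (a.γ * l / min (a.ρ * a.μ) a.γ) := by
  have hρμ := mul_pos ha.ρ_pos ha.μ_pos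
  have hmin : 0 < min (a.ρ * a.μ) a.γ := lt_min hρμ ha.γ_pos
  have hρ : 1 < 1 / a.ρ := by rw [one_div]; exact (one_lt_inv₀ ha.ρ_pos).2 ha.ρ_lt_one
  have hγl : 0 < a.γ * l := mul_pos ha.γ_pos (by linarith)
  rw [Real.le_logb_iff_rpow_le hρ (by positivity), Real.rpow_natCast, le_div_iff₀ hmin]
  rcases lineSearchCount_eq_zero_or (X := X) (x := x) hA ha with h | h
  · rw [h, pow_zero, one_mul]
    exact (min_le_right _ _).trans (le_mul_of_one_le_right ha.γ_pos.le hl)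
  · unfold stepSize at h
    have hp : 0 < a.ρ ^ lineSearchCount a X A x := pow_pos ha.ρ_pos _
    rw [one_div, inv_pow]
    rw [inv_mul_le_iff₀ hp]
    have := min_le_left (a.ρ * a.μ) a.γ
    nlinarith

/-- The exact residual is controlled by the length of the first half step. -/
theorem norm_proj_sub_le_of_lineSearch {l C : ℝ} (hX : X.Nonempty) (hc : IsClosed X)
    (hconv : Convex ℝ X) (hA : ∀ x y, ‖A x - A y‖ ≤ l * ‖x - y‖) (ha : a.Admissible)
    (hC : 1 ≤ C) (hlC : l ≤ C * (a.ρ * a.μ)) (h : Vec n) :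
    ‖proj X (x - a.γ • h) - x‖ ≤ C * ‖midPoint a X A x - x‖ + ‖A x - h‖ := by
  have hρμ := mul_pos ha.ρ_pos ha.μ_pos
  have ht := stepSize_pos (X := X) (A := A) (x := x) ha
  have h1 := mul_norm_proj_sub_le hX hc hconv x (A x) ht (stepSize_le ha)
  -- Without reductions the step is γ itself. Otherwise t * l > ρμ and l ≤ Cρμ force C * t ≥ 1 ≥ γ.
  have h2 : a.γ ≤ C * stepSize a X A x := by
    rcases lineSearchCount_eq_zero_or (X := X) (x := x) hA ha with h | h
    · rw [stepSize, h, pow_zero, mul_one]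
      exact le_mul_of_one_le_left ha.γ_pos.le hC
    · have h3 : a.ρ * a.μ * 1 ≤ a.ρ * a.μ * (C * stepSize a X A x) := by
        nlinarith [mul_le_mul_of_nonneg_left hlC ht.le]
      exact ha.γ_le_one.trans (le_of_mul_le_mul_left h3 hρμ)
  have h3 : ‖proj X (x - a.γ • A x) - x‖ ≤ C * ‖midPoint a X A x - x‖ := by
    have : stepSize a X A x * ‖proj X (x - a.γ • A x) - x‖
        ≤ stepSize a X A x * (C * ‖midPoint a X A x - x‖) := by
      refine h1.trans ?_
      rw [midPoint, ← mul_assoc, mul_comm (stepSize a X A x) C]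
      exact mul_le_mul_of_nonneg_right h2 (norm_nonneg _)
    exact le_of_mul_le_mul_left this ht
  have h4 : ‖proj X (x - a.γ • h) - proj X (x - a.γ • A x)‖ ≤ ‖A x - h‖ := by
    refine (norm_proj_sub_proj_le hX hc hconv _ _).trans ?_
    rw [show x - a.γ • h - (x - a.γ • A x) = a.γ • (A x - h) by module, norm_smul,
      Real.norm_of_nonneg ha.γ_pos.le]
    exact mul_le_of_le_one_left (norm_nonneg _) ha.γ_le_one
  calc _ = ‖(proj X (x - a.γ • A x) - x)
          + (proj X (x - a.γ • h) - proj X (x - a.γ • A x))‖ := by congr 1; abel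
    _ ≤ _ := (norm_add_le _ _).trans (add_le_add h3 h4)

end LineSearch

/-! ### Lyapunov function and its decrease in one iteration -/

theorem Params.Admissible.one_sub_pos {a : Params} (ha : a.Admissible) : 0 < 1 - 3 * a.μ ^ 2 := by
  have h2 : a.μ ^ 2 < (Real.sqrt 3 / 3) ^ 2 :=
    pow_lt_pow_left₀ ha.μ_lt ha.μ_pos.le (by norm_num)
  rw [div_pow, Real.sq_sqrt (by norm_num)] at h2
  linarith

/-- The part of the Lyapunov function that depends on the number of Anderson steps: the sum of the
perturbations still to come. -/
def andersonTail (τ : ℝ) (θ : ℕ) : ℝ :=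
  (∑' j : ℕ, (j : ℝ) ^ (-(2 * τ))) - ∑ j ∈ Finset.range θ, (j : ℝ) ^ (-(2 * τ))

/-- This is where τ > 1/2 is used: the exponent 2τ exceeds 1, so the series converges. The term j =
0 cancels in the difference once θ ≥ 1. -/
theorem andersonTail_nonneg {τ : ℝ} (hτ : 1 / 2 < τ) (θ : ℕ) : 0 ≤ andersonTail τ θ :=
  sub_nonneg.2 (Summable.sum_le_tsum _ (fun _ _ => by positivity)
    (Real.summable_nat_rpow.2 (by linarith)))

theorem andersonTail_succ (τ : ℝ) (θ : ℕ) :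
    andersonTail τ θ = andersonTail τ (θ + 1) + (θ : ℝ) ^ (-(2 * τ)) := by
  simp only [andersonTail, Finset.sum_range_succ]
  ring

/-- The Lyapunov function of the iteration. -/
def lyapunov {n : ℕ} (a : Params) (xs : Vec n) (s : Vec n × ℕ) : ℝ :=
  ‖s.1 - xs‖ ^ 2 + a.M * (1 + a.M) * a.ν ^ 2 * andersonTail a.τ s.2

/-- The error of an iteration, in terms of the errors `u` of the first and `v` of the second
empirical operator at the mid point, and the distance `d` of the mid point to the solution. -/
def stepError (t u v d : ℝ) : ℝ :=
  3 * t ^ 2 * (u ^ 2 + v ^ 2) + 2 * t * (v * d)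

/-- One iteration decreases the Lyapunov function up to the error. -/
theorem lyapunov_step_le {n : ℕ} {a : Params} (ha : a.Admissible) {X : Set (Vec n)}
    (hc : IsClosed X) (hX : Convex ℝ X) {H A B : Vec n → Vec n} (hH : Pseudomonotone X H)
    {xs : Vec n} (hxs : xs ∈ SOL X H) (s : Vec n × ℕ)
    (hls : LineSearchTest a X A s.1 (lineSearchCount a X A s.1)) :
    lyapunov a xs (step a X A B s)
        + (1 - 3 * a.μ ^ 2) / 2 * ‖midPoint a X A s.1 - s.1‖ ^ 2
      ≤ lyapunov a xs s + (1 + a.M) * stepError (stepSize a X A s.1)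
        ‖A (midPoint a X A s.1) - H (midPoint a X A s.1)‖
        ‖B (midPoint a X A s.1) - H (midPoint a X A s.1)‖ ‖midPoint a X A s.1 - xs‖ := by
  obtain ⟨x, θ⟩ := s
  have hne : X.Nonempty := ⟨xs, hxs.1⟩
  have hM := ha.M_pos
  have hμ := ha.one_sub_pos
  have ht := stepSize_pos (X := X) (A := A) (x := x) ha
  set E := stepError (stepSize a X A x) ‖A (midPoint a X A x) - H (midPoint a X A x)‖
    ‖B (midPoint a X A x) - H (midPoint a X A x)‖ ‖midPoint a X A x - xs‖ with hE
  have hE0 : 0 ≤ E := by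
    rw [hE]; unfold stepError; positivity
  unfold step
  dsimp only
  split_ifs with h0 hG hα hα
  -- At a fixed point of the trial projection the test holds trivially for m = 0. The mid point is
  -- then x itself and the state does not change.
  · have hcount : lineSearchCount a X A x = 0 := by
      refine Nat.sInf_eq_zero.2 (Or.inl ?_)
      change LineSearchTest a X A x 0
      rw [LineSearchTest, pow_zero, mul_one, sub_eq_zero.1 h0]
      simp
    have hm : midPoint a X A x - x = 0 := by
      rw [midPoint, stepSize, hcount, pow_zero, mul_one, h0]
    rw [hm, norm_zero]
    nlinarith [mul_nonneg (by linarith : 0 ≤ 1 + a.M) hE0]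
  all_goals
    have hy : midPoint a X A x ∈ X := proj_mem hne hc hX _
    have key := extragradient_ineq (t := stepSize a X A x) (b := B (midPoint a X A x))
      (h := H (midPoint a X A x)) hc hX hxs.1 ht.le hls (hH _ hxs.1 _ hy (hxs.2 _ hy))
    change _ ≤ _ - (1 - 3 * a.μ ^ 2) * ‖midPoint a X A x - x‖ ^ 2 + E at key
    simp only [← stepSize.eq_def] at *
    simp only [← midPoint.eq_def] at *
    set z := proj X (x - stepSize a X A x • B (midPoint a X A x))
    set F := midPoint a X A x - x
    have hF := sq_nonneg ‖F‖
  · set α := inner ℝ (z - x) (z - x - F) / ‖z - x - F‖ ^ 2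
    have hlt := anderson_coeff_lt_half (hG.trans_le (min_le_left _ _))
    change α < 1 / 2 at hlt
    rw [abs_le] at hα
    have hGν : ‖z - x‖ ^ 2 ≤ a.ν ^ 2 * (θ : ℝ) ^ (-(2 * a.τ)) := by
      have h1 := (hG.trans_le (min_le_right _ _)).le
      refine (pow_le_pow_left₀ (norm_nonneg _) h1 2).trans_eq ?_
      rw [mul_pow, ← Real.rpow_natCast ((θ : ℝ) ^ (-a.τ)) 2, ← Real.rpow_mul (by positivity)]
      congr 2
      push_cast; ring
    simp only [lyapunov]
    rw [andersonTail_succ a.τ θ, norm_affine_comb_sub_sq]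
    -- The safeguard ‖G‖ < ν θ^(-τ) makes the perturbation at most the term by which the tail drops
    -- when θ increases by one.
    have hαG : -(α * (1 - α) * ‖z - x‖ ^ 2)
        ≤ a.M * (1 + a.M) * (a.ν ^ 2 * (θ : ℝ) ^ (-(2 * a.τ))) := by
      have : -(α * (1 - α)) ≤ a.M * (1 + a.M) := by nlinarith
      calc _ = -(α * (1 - α)) * ‖z - x‖ ^ 2 := by ring
        _ ≤ a.M * (1 + a.M) * ‖z - x‖ ^ 2 := mul_le_mul_of_nonneg_right this (sq_nonneg _)
        _ ≤ _ := mul_le_mul_of_nonneg_left hGν (by positivity)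
    -- Here 1/2 < 1 - α ≤ 1 + M: the lower bound preserves half of the decrease, the upper bound
    -- gives the factor in front of the error.
    have k1 := mul_le_mul_of_nonneg_left key (by linarith : 0 ≤ 1 - α)
    have k2 : 1 / 2 * ((1 - 3 * a.μ ^ 2) * ‖F‖ ^ 2) ≤ (1 - α) * ((1 - 3 * a.μ ^ 2) * ‖F‖ ^ 2) :=
      mul_le_mul_of_nonneg_right (by linarith) (mul_nonneg hμ.le hF)
    have k3 : (1 - α) * E ≤ (1 + a.M) * E := mul_le_mul_of_nonneg_right (by linarith) hE0
    linarith
  · simp only [lyapunov]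
    have k2 := mul_nonneg hμ.le hF
    have k3 := mul_nonneg hM.le hE0
    linarith
  -- Impossible case: the default coefficient M + 1 can never be accepted.
  · rw [abs_of_pos (by linarith)] at hα
    linarith
  · simp only [lyapunov]
    have k2 := mul_nonneg hμ.le hF
    have k3 := mul_nonneg hM.le hE0
    linarith

/-! ### Dimension-free fourth moments of sums of independent centred vectors -/

section FourthMoment

variable {Ω : Type*} [MeasurableSpace Ω] {P : Measure Ω} [IsProbabilityMeasure P]

theorem pow_le_one_add_pow_four {r : ℝ} (hr : 0 ≤ r) {k : ℕ} (hk : k ≤ 4) : r ^ k ≤ 1 + r ^ 4 := by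
  rcases le_total r 1 with h | h
  · exact (pow_le_one₀ hr h).trans (by have := pow_nonneg hr 4; linarith)
  · exact (pow_le_pow_right₀ h hk).trans (by linarith)

theorem integrable_norm_pow_of_le_four {E : Type*} [NormedAddCommGroup E] {X : Ω → E}
    (hX : AEStronglyMeasurable X P) (h4 : Integrable (fun ω => ‖X ω‖ ^ 4) P) {k : ℕ}
    (hk : k ≤ 4) : Integrable (fun ω => ‖X ω‖ ^ k) P := by
  refine ((integrable_const (1 : ℝ)).add h4).mono' (hX.norm.pow k) (.of_forall fun ω => ?_)
  rw [Real.norm_of_nonneg (by positivity)]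
  exact pow_le_one_add_pow_four (norm_nonneg _) hk

theorem integrable_of_norm_pow_four {E : Type*} [NormedAddCommGroup E] {X : Ω → E}
    (hX : AEStronglyMeasurable X P) (h4 : Integrable (fun ω => ‖X ω‖ ^ 4) P) :
    Integrable X P := by
  rw [← integrable_norm_iff hX]
  simpa using integrable_norm_pow_of_le_four hX h4 (k := 1) (by norm_num)

theorem sq_integral_le {f : Ω → ℝ} (hf : Integrable f P) (hf2 : Integrable (fun ω => f ω ^ 2) P) :
    (∫ ω, f ω ∂P) ^ 2 ≤ ∫ ω, f ω ^ 2 ∂P := by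
  set c := ∫ ω, f ω ∂P
  have h : 0 ≤ ∫ ω, (f ω ^ 2 - 2 * c * f ω + c ^ 2) ∂P :=
    integral_nonneg fun ω => by
      have := sq_nonneg (f ω - c)
      simp only [Pi.zero_apply]
      linarith
  have hs : Integrable (fun ω => f ω ^ 2 - 2 * c * f ω) P := hf2.sub (hf.const_mul _)
  rw [integral_add hs (integrable_const _), integral_sub hf2 (hf.const_mul _), integral_const_mul] at h
  simp only [integral_const, probReal_univ, one_smul] at h
  change 0 ≤ _ - 2 * c * c + c ^ 2 at h
  linarith

/-- Second and fourth moments of the norm, under addition of an independent centered variable. -/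
theorem moments_add_le {n : ℕ} {X Y : Ω → Vec n} (hXm : Measurable X) (hYm : Measurable Y)
    (hind : IndepFun X Y P) (hX : Integrable (fun ω => ‖X ω‖ ^ 4) P)
    (hY : Integrable (fun ω => ‖Y ω‖ ^ 4) P) (hY0 : ∫ ω, Y ω ∂P = 0) :
    Integrable (fun ω => ‖X ω + Y ω‖ ^ 4) P
      ∧ ∫ ω, ‖X ω + Y ω‖ ^ 2 ∂P = ∫ ω, ‖X ω‖ ^ 2 ∂P + ∫ ω, ‖Y ω‖ ^ 2 ∂P
      ∧ ∫ ω, ‖X ω + Y ω‖ ^ 4 ∂P ≤ ∫ ω, ‖X ω‖ ^ 4 ∂P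
        + 8 * ((∫ ω, ‖X ω‖ ^ 2 ∂P) * ∫ ω, ‖Y ω‖ ^ 2 ∂P) + 3 * ∫ ω, ‖Y ω‖ ^ 4 ∂P := by
  have hX1 := integrable_of_norm_pow_four hXm.aestronglyMeasurable hX
  have hY1 := integrable_of_norm_pow_four hYm.aestronglyMeasurable hY
  have hX2 := integrable_norm_pow_of_le_four hXm.aestronglyMeasurable hX (k := 2) (by norm_num)
  have hY2 := integrable_norm_pow_of_le_four hYm.aestronglyMeasurable hY (k := 2) (by norm_num)
  have hX3 := integrable_norm_pow_of_le_four hXm.aestronglyMeasurable hX (k := 3) (by norm_num)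
  have hC : Integrable (fun ω => ‖X ω‖ ^ 2 • X ω) P := by
    refine hX3.mono' ?_ (.of_forall fun ω => ?_)
    · exact ((hXm.norm.pow_const 2).smul hXm).aestronglyMeasurable
    · rw [norm_smul, Real.norm_of_nonneg (by positivity)]
      exact le_of_eq (by ring)
  have hindC : IndepFun (fun ω => ‖X ω‖ ^ 2 • X ω) Y P :=
    hind.comp (φ := fun x => ‖x‖ ^ 2 • x) (ψ := id) (by fun_prop) measurable_id
  have hind2 : IndepFun (fun ω => ‖X ω‖ ^ 2) (fun ω => ‖Y ω‖ ^ 2) P :=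
    hind.comp (φ := fun x => ‖x‖ ^ 2) (ψ := fun x => ‖x‖ ^ 2) (by fun_prop) (by fun_prop)
  have i1 : Integrable (fun ω => inner ℝ (X ω) (Y ω)) P :=
    hind.integrable_bilin hX1 hY1 (innerSL ℝ)
  have i2 : Integrable (fun ω => inner ℝ (‖X ω‖ ^ 2 • X ω) (Y ω)) P :=
    hindC.integrable_bilin hC hY1 (innerSL ℝ)
  -- Both terms linear in Y vanish, because Y is centred and independent of X, hence also of ‖X‖² X.
  have e1 : ∫ ω, inner ℝ (X ω) (Y ω) ∂P = 0 := by
    refine (hind.integral_bilin hX1 hY1 (innerSL ℝ)).trans ?_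
    rw [hY0, map_zero]
  have e2 : ∫ ω, inner ℝ (‖X ω‖ ^ 2 • X ω) (Y ω) ∂P = 0 := by
    refine (hindC.integral_bilin hC hY1 (innerSL ℝ)).trans ?_
    rw [hY0, map_zero]
  have i3 : Integrable (fun ω => ‖X ω‖ ^ 2 * ‖Y ω‖ ^ 2) P := hind2.integrable_mul hX2 hY2
  have e3 : ∫ ω, ‖X ω‖ ^ 2 * ‖Y ω‖ ^ 2 ∂P = _ :=
    hind2.integral_mul_eq_mul_integral hX2.1 hY2.1
  -- Square ‖X‖² + 2⟨X, Y⟩ + ‖Y‖², then use 4⟨X, Y⟩‖Y‖² ≤ 2⟨X, Y⟩² + 2‖Y‖⁴ and Cauchy–Schwarz for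
  -- the resulting 6⟨X, Y⟩².
  have hpt : ∀ ω, ‖X ω + Y ω‖ ^ 4 ≤ ‖X ω‖ ^ 4 + 4 * inner ℝ (‖X ω‖ ^ 2 • X ω) (Y ω)
      + 8 * (‖X ω‖ ^ 2 * ‖Y ω‖ ^ 2) + 3 * ‖Y ω‖ ^ 4 := fun ω => by
    have h1 := norm_add_sq_real (X ω) (Y ω)
    have h2 : inner ℝ (X ω) (Y ω) ^ 2 ≤ ‖X ω‖ ^ 2 * ‖Y ω‖ ^ 2 := by
      rw [← mul_pow, ← sq_abs]
      exact pow_le_pow_left₀ (abs_nonneg _) (abs_real_inner_le_norm _ _) 2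
    have h3 : ‖X ω + Y ω‖ ^ 4 = (‖X ω + Y ω‖ ^ 2) ^ 2 := by ring
    rw [h3, h1, real_inner_smul_left]
    nlinarith [sq_nonneg (inner ℝ (X ω) (Y ω) - ‖Y ω‖ ^ 2)]
  have d1 : Integrable (fun ω => ‖X ω‖ ^ 4 + 4 * inner ℝ (‖X ω‖ ^ 2 • X ω) (Y ω)) P :=
    hX.add (i2.const_mul 4)
  have d2 : Integrable (fun ω => ‖X ω‖ ^ 4 + 4 * inner ℝ (‖X ω‖ ^ 2 • X ω) (Y ω)
      + 8 * (‖X ω‖ ^ 2 * ‖Y ω‖ ^ 2)) P := d1.add (i3.const_mul 8)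
  have hdom : Integrable (fun ω => ‖X ω‖ ^ 4 + 4 * inner ℝ (‖X ω‖ ^ 2 • X ω) (Y ω)
      + 8 * (‖X ω‖ ^ 2 * ‖Y ω‖ ^ 2) + 3 * ‖Y ω‖ ^ 4) P := d2.add (hY.const_mul 3)
  have hint : Integrable (fun ω => ‖X ω + Y ω‖ ^ 4) P := by
    refine hdom.mono' ?_ (.of_forall fun ω => ?_)
    · exact ((hXm.add hYm).norm.pow_const 4).aestronglyMeasurable
    · rw [Real.norm_of_nonneg (by positivity)]
      exact hpt ω
  refine ⟨hint, ?_, ?_⟩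
  · simp_rw [norm_add_sq_real]
    have d3 : Integrable (fun ω => ‖X ω‖ ^ 2 + 2 * inner ℝ (X ω) (Y ω)) P :=
      hX2.add (i1.const_mul 2)
    rw [integral_add d3 hY2, integral_add hX2 (i1.const_mul 2),
      integral_const_mul, e1]
    ring
  · refine (integral_mono hint hdom hpt).trans_eq ?_
    rw [integral_add d2 (hY.const_mul 3), integral_add d1 (i3.const_mul 8),
      integral_add hX (i2.const_mul 4), integral_const_mul, integral_const_mul,
      integral_const_mul, e2, e3]
    ring

/-- The fourth moment of a sum of independent centered vectors is of the order of the square of the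
number of terms, with a constant that does not depend on the dimension. -/
theorem moments_sum_le {ι : Type*} {n : ℕ} {Z : ι → Ω → Vec n} {κ : ℝ} (hκ : 0 ≤ κ)
    (hm : ∀ i, Measurable (Z i)) (hind : iIndepFun Z P)
    (h4 : ∀ i, Integrable (fun ω => ‖Z i ω‖ ^ 4) P) (h0 : ∀ i, ∫ ω, Z i ω ∂P = 0)
    (hle : ∀ i, ∫ ω, ‖Z i ω‖ ^ 4 ∂P ≤ κ) (s : Finset ι) :
    Integrable (fun ω => ‖∑ i ∈ s, Z i ω‖ ^ 4) P
      ∧ ∫ ω, ‖∑ i ∈ s, Z i ω‖ ^ 2 ∂P ≤ s.card * Real.sqrt κ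
      ∧ ∫ ω, ‖∑ i ∈ s, Z i ω‖ ^ 4 ∂P ≤ 4 * (s.card : ℝ) ^ 2 * κ := by
  classical
  induction s using Finset.induction_on with
  | empty => simp
  | insert i s hi ih =>
    obtain ⟨ih1, ih2, ih3⟩ := ih
    have hS : Measurable (fun ω => ∑ j ∈ s, Z j ω) := Finset.measurable_fun_sum _ fun j _ => hm j
    have hI : IndepFun (fun ω => ∑ j ∈ s, Z j ω) (Z i) P := by
      have := hind.indepFun_finsetSum_of_notMem hm hi
      rwa [show (∑ j ∈ s, Z j) = fun ω => ∑ j ∈ s, Z j ω by ext ω; simp] at this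
    have hv : ∫ ω, ‖Z i ω‖ ^ 2 ∂P ≤ Real.sqrt κ := by
      refine Real.le_sqrt_of_sq_le ((sq_integral_le ?_ ?_).trans ?_)
      · exact integrable_norm_pow_of_le_four (hm i).aestronglyMeasurable (h4 i) (by norm_num)
      · simp_rw [← pow_mul]; exact h4 i
      · simp_rw [← pow_mul]; exact hle i
    obtain ⟨k1, k2, k3⟩ := moments_add_le hS (hm i) hI ih1 (h4 i) (h0 i)
    have hswap : ∀ ω, ∑ j ∈ insert i s, Z j ω = ∑ j ∈ s, Z j ω + Z i ω := fun ω => by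
      rw [Finset.sum_insert hi, add_comm]
    simp_rw [hswap, Finset.card_insert_of_notMem hi]
    push_cast
    refine ⟨k1, ?_, ?_⟩
    · rw [k2]; linarith
    -- The increment is at most (8m + 3)κ with m = `s.card`, and 4(m + 1)² - 4m² = 8m + 4.
    · have hprod : (∫ ω, ‖∑ j ∈ s, Z j ω‖ ^ 2 ∂P) * ∫ ω, ‖Z i ω‖ ^ 2 ∂P ≤ s.card * κ := by
        have := mul_le_mul ih2 hv (integral_nonneg fun ω => by positivity) (by positivity)
        rwa [mul_assoc, Real.mul_self_sqrt hκ] at this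
      have := hle i
      nlinarith

end FourthMoment

/-! ### The stochastic oracle and its mean operator -/

/-- Fourth moment bounds of a random operator `T` with Lipschitz modulus `L`, relative to a
reference point `xs`, with a single constant `K`. -/
structure OracleMoments {n : ℕ} {Ξ : Type*} [MeasurableSpace Ξ] (π : Measure Ξ)
    (T : Ξ → Vec n → Vec n) (L : Ξ → ℝ) (xs : Vec n) (K : ℝ) : Prop where
  one_le : 1 ≤ K
  measurable_T : Measurable (fun z : Ξ × Vec n => T z.1 z.2)
  measurable_L : Measurable L
  one_le_L : ∀ᵐ s ∂π, 1 ≤ L s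
  lipschitz : ∀ᵐ s ∂π, ∀ x y, ‖T s x - T s y‖ ≤ L s * ‖x - y‖
  integrable_L : Integrable (fun s => ‖L s‖ ^ 4) π
  moment_L : ∫ s, ‖L s‖ ^ 4 ∂π ≤ K
  integrable_T : ∀ x, Integrable (fun s => ‖T s x‖ ^ 4) π
  moment_T : ∀ x, ∫ s, ‖T s x‖ ^ 4 ∂π ≤ K * (1 + ‖x - xs‖ ^ 2) ^ 2

namespace OracleMoments

variable {n : ℕ} {Ξ : Type*} [MeasurableSpace Ξ] {π : Measure Ξ} [IsProbabilityMeasure π]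
  {T : Ξ → Vec n → Vec n} {L : Ξ → ℝ} {xs : Vec n} {K : ℝ}

omit [IsProbabilityMeasure π] in
theorem measurable_apply (h : OracleMoments π T L xs K) (x : Vec n) : Measurable (T · x) :=
  h.measurable_T.comp (measurable_id.prodMk measurable_const)

theorem integrable_apply (h : OracleMoments π T L xs K) (x : Vec n) : Integrable (T · x) π :=
  integrable_of_norm_pow_four (h.measurable_apply x).aestronglyMeasurable (h.integrable_T x)

theorem integrable_modulus (h : OracleMoments π T L xs K) : Integrable L π :=
  integrable_of_norm_pow_four h.measurable_L.aestronglyMeasurable h.integrable_L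

theorem integral_modulus_le (h : OracleMoments π T L xs K) : ∫ s, L s ∂π ≤ K := by
  refine le_trans (integral_mono_ae h.integrable_modulus h.integrable_L ?_) h.moment_L
  filter_upwards [h.one_le_L] with s hs
  rw [Real.norm_of_nonneg (by linarith)]
  exact le_self_pow₀ hs (by norm_num)

/-- The mean operator. -/
def mean (π : Measure Ξ) (T : Ξ → Vec n → Vec n) (x : Vec n) : Vec n := ∫ s, T s x ∂π

theorem norm_mean_sub_le (h : OracleMoments π T L xs K) (x y : Vec n) :
    ‖mean π T x - mean π T y‖ ≤ K * ‖x - y‖ := by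
  unfold mean
  rw [← integral_sub (h.integrable_apply x) (h.integrable_apply y)]
  refine (norm_integral_le_of_norm_le (h.integrable_modulus.mul_const ‖x - y‖) ?_).trans ?_
  · filter_upwards [h.lipschitz] with s hs using hs x y
  · rw [integral_mul_const]
    exact mul_le_mul_of_nonneg_right h.integral_modulus_le (norm_nonneg _)

theorem continuous_mean (h : OracleMoments π T L xs K) : Continuous (mean π T) := by
  refine (LipschitzWith.of_dist_le_mul (K := K.toNNReal) fun x y => ?_).continuous
  rw [dist_eq_norm, dist_eq_norm, Real.coe_toNNReal _ (zero_le_one.trans h.one_le)]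
  exact h.norm_mean_sub_le x y

/-- Jensen's inequality for the square, applied twice. -/
theorem norm_mean_pow_four_le (h : OracleMoments π T L xs K) (x : Vec n) :
    ‖mean π T x‖ ^ 4 ≤ K * (1 + ‖x - xs‖ ^ 2) ^ 2 := by
  refine le_trans ?_ (h.moment_T x)
  have hm := (h.measurable_apply x).aestronglyMeasurable (μ := π)
  have h2 := integrable_norm_pow_of_le_four hm (h.integrable_T x) (k := 2) (by norm_num)
  have k1 : ‖mean π T x‖ ≤ ∫ s, ‖T s x‖ ∂π := norm_integral_le_integral_norm _
  have k2 := sq_integral_le (h.integrable_apply x).norm h2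
  have k3 := sq_integral_le h2 (by simp_rw [← pow_mul]; exact h.integrable_T x)
  simp_rw [← pow_mul] at k3
  calc ‖mean π T x‖ ^ 4 = (‖mean π T x‖ ^ 2) ^ 2 := by ring
    _ ≤ (∫ s, ‖T s x‖ ^ 2 ∂π) ^ 2 :=
        pow_le_pow_left₀ (by positivity)
          ((pow_le_pow_left₀ (norm_nonneg _) k1 2).trans k2) 2
    _ ≤ _ := k3

theorem norm_mean_sq_le (h : OracleMoments π T L xs K) (x : Vec n) :
    ‖mean π T x‖ ^ 2 ≤ K * (1 + ‖x - xs‖ ^ 2) := by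
  have hK := h.one_le
  refine le_of_sq_le_sq ?_ (by positivity)
  have := h.norm_mean_pow_four_le x
  have hKK : K ≤ K ^ 2 := le_self_pow₀ hK (by norm_num)
  nlinarith [mul_le_mul_of_nonneg_right hKK (sq_nonneg (1 + ‖x - xs‖ ^ 2))]

/-! ### Sampling errors at a fixed point -/

section Samples

variable {S : ℕ}

theorem ae_pi (p : Ξ → Prop) (h : ∀ᵐ s ∂π, p s) :
    ∀ᵐ s ∂(Measure.pi fun _ : Fin S => π), ∀ j, p (s j) :=
  ae_all_iff.2 fun j => (measurePreserving_eval (fun _ : Fin S => π) j).quasiMeasurePreserving.ae h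

omit [MeasurableSpace Ξ] in
theorem empMean_ge_one (hS : S ≠ 0) {s : Fin S → Ξ} (h : ∀ j, 1 ≤ L (s j)) : 1 ≤ empMean L s := by
  have hS' : (0 : ℝ) < S := by positivity
  rw [empMean, le_inv_mul_iff₀ hS', mul_one]
  calc (S : ℝ) = ∑ _j : Fin S, (1 : ℝ) := by simp
    _ ≤ _ := Finset.sum_le_sum fun j _ => h j

omit [MeasurableSpace Ξ] in
theorem norm_empOp_sub_le {s : Fin S → Ξ} (h : ∀ j x y, ‖T (s j) x - T (s j) y‖ ≤ L (s j) * ‖x - y‖)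
    (x y : Vec n) : ‖empOp T s x - empOp T s y‖ ≤ empMean L s * ‖x - y‖ := by
  rw [empOp, empOp, ← smul_sub, ← Finset.sum_sub_distrib, norm_smul, empMean, mul_assoc,
    Finset.sum_mul, Real.norm_of_nonneg (by positivity)]
  exact mul_le_mul_of_nonneg_left (norm_sum_le_of_le _ fun j _ => h j x y) (by positivity)

omit [IsProbabilityMeasure π] in
theorem measurable_empMean (h : OracleMoments π T L xs K) :
    Measurable (fun s : Fin S → Ξ => empMean L s) := by
  have := h.measurable_L
  unfold empMean
  fun_prop

theorem measurable_empOp (hT : Measurable (fun z : Ξ × Vec n => T z.1 z.2)) :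
    Measurable (fun z : (Fin S → Ξ) × Vec n => empOp T z.1 z.2) := by
  unfold empOp
  have h : ∀ j : Fin S, Measurable fun z : (Fin S → Ξ) × Vec n => T (z.1 j) z.2 := fun j =>
    Measurable.comp (g := fun z : Ξ × Vec n => T z.1 z.2)
      (f := fun z : (Fin S → Ξ) × Vec n => (z.1 j, z.2)) hT (by fun_prop)
  exact (Finset.measurable_fun_sum Finset.univ fun j _ => h j).const_smul (S : ℝ)⁻¹

theorem integral_empMean_le (h : OracleMoments π T L xs K) (hS : S ≠ 0) :
    Integrable (fun s => empMean L s) (Measure.pi fun _ : Fin S => π)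
      ∧ ∫ s, empMean L s ∂(Measure.pi fun _ : Fin S => π) ≤ K := by
  have hS' : (0 : ℝ) < S := by positivity
  have hi : ∀ j : Fin S, Integrable (fun s : Fin S → Ξ => L (s j)) (Measure.pi fun _ => π) :=
    fun j => (measurePreserving_eval (fun _ : Fin S => π) j).integrable_comp_of_integrable
      h.integrable_modulus
  have he : ∀ j : Fin S, ∫ s : Fin S → Ξ, L (s j) ∂(Measure.pi fun _ => π) = ∫ s, L s ∂π :=
    fun j => integral_comp_eval (μ := fun _ : Fin S => π) (i := j) (f := L) h.integrable_modulus.1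
  refine ⟨(integrable_finsetSum _ fun j _ => hi j).const_mul _, ?_⟩
  unfold empMean
  rw [integral_const_mul, integral_finsetSum _ fun j _ => hi j]
  simp_rw [he]
  rw [Finset.sum_const, Finset.card_univ, Fintype.card_fin, nsmul_eq_mul,
    inv_mul_cancel_left₀ hS'.ne']
  exact h.integral_modulus_le

/-- Convexity of the fourth power suffices: only boundedness of this moment is needed, not
concentration of the empirical mean. -/
theorem integral_empMean_pow_four_le (h : OracleMoments π T L xs K) (hS : S ≠ 0) :
    Integrable (fun s => empMean L s ^ 4) (Measure.pi fun _ : Fin S => π)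
      ∧ ∫ s, empMean L s ^ 4 ∂(Measure.pi fun _ : Fin S => π) ≤ K := by
  have hS' : (0 : ℝ) < S := by positivity
  have hi : ∀ j : Fin S, Integrable (fun s : Fin S → Ξ => ‖L (s j)‖ ^ 4) (Measure.pi fun _ => π) :=
    fun j => (measurePreserving_eval (fun _ : Fin S => π) j).integrable_comp_of_integrable
      h.integrable_L
  have he : ∀ j : Fin S, ∫ s : Fin S → Ξ, ‖L (s j)‖ ^ 4 ∂(Measure.pi fun _ => π)
      = ∫ s, ‖L s‖ ^ 4 ∂π :=
    fun j => integral_comp_eval (μ := fun _ : Fin S => π) (i := j) (f := fun s => ‖L s‖ ^ 4)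
      h.integrable_L.1
  have hdom : Integrable (fun s : Fin S → Ξ => (S : ℝ)⁻¹ * ∑ j, ‖L (s j)‖ ^ 4)
      (Measure.pi fun _ => π) := (integrable_finsetSum _ fun j _ => hi j).const_mul _
  have hpt : ∀ s : Fin S → Ξ, empMean L s ^ 4 ≤ (S : ℝ)⁻¹ * ∑ j, ‖L (s j)‖ ^ 4 := fun s => by
    have hw : ∑ _j : Fin S, (S : ℝ)⁻¹ = 1 := by simp [hS'.ne']
    have h1 := Real.pow_arith_mean_le_arith_mean_pow Finset.univ (fun _ : Fin S => (S : ℝ)⁻¹)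
      (fun j => ‖L (s j)‖) (fun _ _ => by positivity) hw (fun _ _ => norm_nonneg _) 4
    rw [← Finset.mul_sum, ← Finset.mul_sum] at h1
    refine le_trans ?_ h1
    have h2 : ‖empMean L s‖ ≤ (S : ℝ)⁻¹ * ∑ j, ‖L (s j)‖ := by
      rw [empMean, norm_mul, Real.norm_of_nonneg (by positivity : (0 : ℝ) ≤ (S : ℝ)⁻¹)]
      exact mul_le_mul_of_nonneg_left (norm_sum_le _ _) (by positivity)
    calc empMean L s ^ 4 = ‖empMean L s‖ ^ 4 := by
          rw [Real.norm_eq_abs, Even.pow_abs (by decide)]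
      _ ≤ _ := pow_le_pow_left₀ (norm_nonneg _) h2 4
  have hint : Integrable (fun s => empMean L s ^ 4) (Measure.pi fun _ : Fin S => π) := by
    refine hdom.mono' (h.measurable_empMean.pow_const 4).aestronglyMeasurable
      (.of_forall fun s => ?_)
    rw [Real.norm_of_nonneg (Even.pow_nonneg (by decide) _)]
    exact hpt s
  refine ⟨hint, (integral_mono hint hdom hpt).trans ?_⟩
  rw [integral_const_mul, integral_finsetSum _ fun j _ => hi j]
  simp_rw [he]
  rw [Finset.sum_const, Finset.card_univ, Fintype.card_fin, nsmul_eq_mul,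
    inv_mul_cancel_left₀ hS'.ne']
  exact h.moment_L

theorem norm_sub_pow_four_le {E : Type*} [SeminormedAddCommGroup E] (u v : E) :
    ‖u - v‖ ^ 4 ≤ 8 * (‖u‖ ^ 4 + ‖v‖ ^ 4) := by
  refine (pow_le_pow_left₀ (norm_nonneg _) (norm_sub_le u v) 4).trans ?_
  have := add_pow_le (norm_nonneg u) (norm_nonneg v) 4
  norm_num at this
  linarith

/-- The sampling error of the empirical operator at a fixed point, fourth moment. -/
theorem integral_empOp_sub_pow_four_le (h : OracleMoments π T L xs K) (hS : S ≠ 0) (x : Vec n) :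
    Integrable (fun s => ‖empOp T s x - mean π T x‖ ^ 4) (Measure.pi fun _ : Fin S => π)
      ∧ ∫ s, ‖empOp T s x - mean π T x‖ ^ 4 ∂(Measure.pi fun _ : Fin S => π)
        ≤ 64 * K * (1 + ‖x - xs‖ ^ 2) ^ 2 / (S : ℝ) ^ 2 := by
  have hS' : (0 : ℝ) < S := by positivity
  have hK := h.one_le
  set D : Ξ → Vec n := fun s => T s x - mean π T x with hD
  have hDm : Measurable D := (h.measurable_apply x).sub_const _
  have hdom : Integrable (fun s => 8 * (‖T s x‖ ^ 4 + ‖mean π T x‖ ^ 4)) π :=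
    ((h.integrable_T x).add (integrable_const _)).const_mul 8
  have hD4 : Integrable (fun s => ‖D s‖ ^ 4) π := by
    refine hdom.mono' (hDm.norm.pow_const 4).aestronglyMeasurable (.of_forall fun s => ?_)
    rw [Real.norm_of_nonneg (by positivity)]
    exact norm_sub_pow_four_le _ _
  -- The factor 8 of the splitting acts on `T` and on its mean, giving 16. The factor 4 of
  -- `moments_sum_le` then gives 64.
  have hDle : ∫ s, ‖D s‖ ^ 4 ∂π ≤ 16 * K * (1 + ‖x - xs‖ ^ 2) ^ 2 := by
    refine (integral_mono hD4 hdom fun s => norm_sub_pow_four_le _ _).trans ?_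
    rw [integral_const_mul, integral_add (h.integrable_T x) (integrable_const _)]
    simp only [integral_const, probReal_univ, one_smul]
    have := h.norm_mean_pow_four_le x
    have := h.moment_T x
    linarith
  have hD0 : ∫ s, D s ∂π = 0 := by
    rw [hD, integral_sub (h.integrable_apply x) (integrable_const _)]
    simp [mean]
  have hev := fun j => measurePreserving_eval (fun _ : Fin S => π) j
  obtain ⟨k1, -, k3⟩ := moments_sum_le (P := Measure.pi fun _ : Fin S => π)
    (Z := fun (j : Fin S) s => D (s j)) (κ := 16 * K * (1 + ‖x - xs‖ ^ 2) ^ 2) (by positivity)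
    (fun j => hDm.comp (measurable_pi_apply j))
    (iIndepFun_pi (X := fun _ => D) fun j => hDm.aemeasurable)
    (fun j => (hev j).integrable_comp_of_integrable hD4)
    (fun j => (integral_comp_eval (μ := fun _ : Fin S => π) (i := j) (f := D)
      hDm.aestronglyMeasurable).trans hD0)
    (fun j => (integral_comp_eval (μ := fun _ : Fin S => π) (i := j) (f := fun s => ‖D s‖ ^ 4)
      hD4.1).trans_le hDle) Finset.univ
  have he : ∀ s : Fin S → Ξ, ‖empOp T s x - mean π T x‖ ^ 4
      = ((S : ℝ) ^ 4)⁻¹ * ‖∑ j, D (s j)‖ ^ 4 := fun s => by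
    have : empOp T s x - mean π T x = (S : ℝ)⁻¹ • ∑ j, D (s j) := by
      simp only [hD, empOp, Finset.sum_sub_distrib, smul_sub, Finset.sum_const, Finset.card_univ,
        Fintype.card_fin]
      rw [← Nat.cast_smul_eq_nsmul ℝ, inv_smul_smul₀ hS'.ne']
    rw [this, norm_smul, mul_pow, Real.norm_of_nonneg (by positivity), inv_pow]
  simp_rw [he]
  refine ⟨k1.const_mul _, ?_⟩
  rw [integral_const_mul, inv_mul_le_iff₀ (by positivity)]
  refine k3.trans_eq ?_
  rw [Finset.card_univ, Fintype.card_fin]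
  field_simp
  ring

/-- The sampling error of the empirical operator at a fixed point, second moment. -/
theorem integral_empOp_sub_sq_le (h : OracleMoments π T L xs K) (hS : S ≠ 0) (x : Vec n) :
    Integrable (fun s => ‖empOp T s x - mean π T x‖ ^ 2) (Measure.pi fun _ : Fin S => π)
      ∧ ∫ s, ‖empOp T s x - mean π T x‖ ^ 2 ∂(Measure.pi fun _ : Fin S => π)
        ≤ 33 * K * (1 + ‖x - xs‖ ^ 2) / S := by
  have hS' : (0 : ℝ) < S := by positivity
  have hK := h.one_le
  obtain ⟨h4, h4le⟩ := h.integral_empOp_sub_pow_four_le hS x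
  have hm : AEStronglyMeasurable (fun s => empOp T s x - mean π T x)
      (Measure.pi fun _ : Fin S => π) :=
    (((measurable_empOp h.measurable_T).comp
      (measurable_id.prodMk measurable_const)).sub_const _).aestronglyMeasurable
  have h2 := integrable_norm_pow_of_le_four hm h4 (k := 2) (by norm_num)
  refine ⟨h2, ?_⟩
  have hsq := sq_integral_le h2 (by simp_rw [← pow_mul]; exact h4)
  simp_rw [← pow_mul] at hsq
  refine le_of_sq_le_sq (hsq.trans (h4le.trans ?_)) (by positivity)
  rw [div_pow]
  gcongr
  have := sq_nonneg (1 + ‖x - xs‖ ^ 2)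
  nlinarith

end Samples

end OracleMoments

/-! ### Measurability of the line search and of one iteration -/

section Measurability

variable {n : ℕ} {Γ : Type*} [MeasurableSpace Γ] {a : Params} {X : Set (Vec n)}
  {A B : Γ → Vec n → Vec n} {x : Γ → Vec n}

theorem measurable_apply_comp (hA : Measurable fun z : Γ × Vec n => A z.1 z.2)
    (hx : Measurable x) : Measurable fun γ => A γ (x γ) :=
  Measurable.comp (g := fun z : Γ × Vec n => A z.1 z.2) hA (measurable_id.prodMk hx)

theorem measurable_lineSearchCount (hP : Measurable (proj X))
    (hA : Measurable fun z : Γ × Vec n => A z.1 z.2) (hx : Measurable x) :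
    Measurable fun γ => lineSearchCount a X (A γ) (x γ) := by
  have hAx := measurable_apply_comp hA hx
  have hset : ∀ m, MeasurableSet {γ | LineSearchTest a X (A γ) (x γ) m} := fun m => by
    have hy : Measurable fun γ => proj X (x γ - (a.γ * a.ρ ^ m) • A γ (x γ)) :=
      hP.comp (hx.sub (hAx.const_smul (a.γ * a.ρ ^ m)))
    exact measurableSet_le ((hAx.sub (measurable_apply_comp hA hy)).norm.const_mul _)
      ((hx.sub hy).norm.const_mul _)
  refine measurable_to_countable' fun k => ?_
  -- The second piece is due to `sInf ∅ = 0`: the fibre over 0 also contains the points where no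
  -- trial step passes.
  have : (fun γ => lineSearchCount a X (A γ) (x γ)) ⁻¹' {k}
      = ({γ | LineSearchTest a X (A γ) (x γ) k} ∩ ⋂ m ∈ Set.Iio k,
          {γ | LineSearchTest a X (A γ) (x γ) m}ᶜ)
        ∪ ({_γ | k = 0} ∩ ⋂ m, {γ | LineSearchTest a X (A γ) (x γ) m}ᶜ) := by
    ext γ
    simp only [Set.mem_preimage, Set.mem_singleton_iff, Set.mem_union, Set.mem_inter_iff,
      Set.mem_ofPred_eq, Set.mem_iInter, Set.mem_compl_iff, Set.mem_Iio]
    constructor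
    · intro h
      by_cases hex : ∃ m, LineSearchTest a X (A γ) (x γ) m
      · left
        subst h
        exact ⟨Nat.sInf_mem hex, fun m hm => Nat.notMem_of_lt_sInf hm⟩
      · right
        push Not at hex
        refine ⟨?_, hex⟩
        rw [← h]
        exact Nat.sInf_eq_zero.2 (Or.inr (Set.eq_empty_of_forall_notMem hex))
    · rintro (⟨h1, h2⟩ | ⟨h1, h2⟩)
      · refine le_antisymm (Nat.sInf_le h1) ?_
        by_contra! hlt
        exact h2 _ hlt (Nat.sInf_mem (s := {m | LineSearchTest a X (A γ) (x γ) m}) ⟨k, h1⟩)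
      · rw [h1]
        exact Nat.sInf_eq_zero.2 (Or.inr (Set.eq_empty_of_forall_notMem h2))
  rw [this]
  exact ((hset k).inter (.biInter (Set.to_countable _) fun m _ => (hset m).compl)).union
    ((MeasurableSet.const _).inter (.iInter fun m => (hset m).compl))

theorem measurable_stepSize (hP : Measurable (proj X))
    (hA : Measurable fun z : Γ × Vec n => A z.1 z.2) (hx : Measurable x) :
    Measurable fun γ => stepSize a X (A γ) (x γ) :=
  (measurable_of_countable fun m : ℕ => a.γ * a.ρ ^ m).comp (measurable_lineSearchCount hP hA hx)

theorem measurable_midPoint (hP : Measurable (proj X))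
    (hA : Measurable fun z : Γ × Vec n => A z.1 z.2) (hx : Measurable x) :
    Measurable fun γ => midPoint a X (A γ) (x γ) :=
  hP.comp (hx.sub ((measurable_stepSize hP hA hx).smul (measurable_apply_comp hA hx)))

theorem measurable_andersonCoeff {F G : Γ → Vec n} {c : Γ → ℝ} (hF : Measurable F)
    (hG : Measurable G) (hc : Measurable c) (M : ℝ) :
    Measurable fun γ => if ‖G γ‖ < min ‖F γ‖ (c γ) then
      inner ℝ (G γ) (G γ - F γ) / ‖G γ - F γ‖ ^ 2 else M + 1 :=
  Measurable.ite (measurableSet_lt hG.norm (hF.norm.min hc))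
    ((hG.inner (hG.sub hF)).div ((hG.sub hF).norm.pow_const 2)) measurable_const

theorem measurable_step (hP : Measurable (proj X))
    (hA : Measurable fun z : Γ × Vec n => A z.1 z.2)
    (hB : Measurable fun z : Γ × Vec n => B z.1 z.2) {s : Γ → Vec n × ℕ} (hs : Measurable s) :
    Measurable fun γ => step a X (A γ) (B γ) (s γ) := by
  have hx : Measurable fun γ => (s γ).1 := measurable_fst.comp hs
  have hθ : Measurable fun γ => (s γ).2 := measurable_snd.comp hs
  have hθr : Measurable fun γ => ((s γ).2 : ℝ) ^ (-a.τ) :=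
    (measurable_of_countable fun m : ℕ => (m : ℝ) ^ (-a.τ)).comp hθ
  have ht := measurable_stepSize (a := a) hP hA hx
  have hy := measurable_midPoint (a := a) hP hA hx
  have hF : Measurable fun γ => midPoint a X (A γ) (s γ).1 - (s γ).1 := hy.sub hx
  have hz : Measurable fun γ => proj X ((s γ).1
      - stepSize a X (A γ) (s γ).1 • B γ (midPoint a X (A γ) (s γ).1)) :=
    hP.comp (hx.sub (ht.smul (measurable_apply_comp hB hy)))
  have hG : Measurable fun γ => proj X ((s γ).1
      - stepSize a X (A γ) (s γ).1 • B γ (midPoint a X (A γ) (s γ).1)) - (s γ).1 := hz.sub hx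
  have hα := measurable_andersonCoeff hF hG (hθr.const_mul a.ν) a.M
  unfold step
  refine Measurable.ite ?_ hs (Measurable.ite ?_ ?_ ?_)
  · exact measurableSet_eq_fun ((hP.comp (hx.sub ((measurable_apply_comp hA hx).const_smul a.γ))).sub
      hx) measurable_const
  · exact measurableSet_le hα.abs measurable_const
  · exact ((hα.smul hx).add ((hα.const_sub 1).smul hz)).prodMk (hθ.add_const 1)
  · exact hz.prodMk hθ

end Measurability

/-! ### Expected decrease of the Lyapunov function in one iteration -/

/-- The one-iteration estimates use integrals in [0, ∞], so that finiteness of the moments of the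
iterates need not be known in advance. -/
theorem lintegral_ofReal_le {Γ : Type*} [MeasurableSpace Γ] {P : Measure Γ} {f : Γ → ℝ} {c : ℝ}
    (hf : Integrable f P) (h0 : ∀ γ, 0 ≤ f γ) (hc : ∫ γ, f γ ∂P ≤ c) :
    ∫⁻ γ, ENNReal.ofReal (f γ) ∂P ≤ ENNReal.ofReal c := by
  rw [← ofReal_integral_eq_lintegral_ofReal hf (.of_forall h0)]
  exact ENNReal.ofReal_le_ofReal hc

/-- The samples at which the Lipschitz condition holds. -/
def GoodSample {n : ℕ} {Ξ : Type*} (T : Ξ → Vec n → Vec n) (L : Ξ → ℝ) (s : Ξ) : Prop :=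
  1 ≤ L s ∧ ∀ x y, ‖T s x - T s y‖ ≤ L s * ‖x - y‖

/-- The weight of the squared residual in the decrease of the Lyapunov function. -/
def residualWeight (a : Params) (K : ℝ) : ℝ :=
  (1 - 3 * a.μ ^ 2) / (8 * (1 + 2 * K / (a.ρ * a.μ)) ^ 2)

/-- The constant in the expected error of an iteration. -/
def errorConst (a : Params) (K : ℝ) : ℝ :=
  (1 + a.M) * (15000 * K ^ 4 / (1 - a.ρ)) + residualWeight a K * (132 * K)

namespace OracleMoments

variable {n : ℕ} {Ξ : Type*} [MeasurableSpace Ξ] {π : Measure Ξ} [IsProbabilityMeasure π]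
  {T : Ξ → Vec n → Vec n} {L : Ξ → ℝ} {xs : Vec n} {K : ℝ} {S : ℕ} {a : Params}
  {X : Set (Vec n)}

theorem ae_good (h : OracleMoments π T L xs K) :
    ∀ᵐ s ∂(Measure.pi fun _ : Fin S => π), ∀ j, GoodSample T L (s j) := by
  refine ae_pi _ ?_
  filter_upwards [h.one_le_L, h.lipschitz] with s h1 h2 using ⟨h1, h2⟩

omit [IsProbabilityMeasure π] in
theorem measurable_empOp_apply (h : OracleMoments π T L xs K) (x : Vec n) :
    Measurable fun s : Fin S → Ξ => empOp T s x :=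
  measurable_apply_comp (measurable_empOp h.measurable_T) measurable_const

/-- The error at the mid point, in terms of errors at points that do not depend on the sample. -/
theorem stepSize_mul_error_sq_le (h : OracleMoments π T L xs K) (ha : a.Admissible)
    (hne : X.Nonempty) (hc : IsClosed X) (hX : Convex ℝ X) (hS : S ≠ 0) (x : Vec n)
    {s : Fin S → Ξ} (hs : ∀ j, GoodSample T L (s j)) {w : ℝ} (hw : 0 < w) :
    stepSize a X (empOp T s) x ^ 2 * ‖empOp T s (midPoint a X (empOp T s) x)
        - mean π T (midPoint a X (empOp T s) x)‖ ^ 2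
      ≤ ((empMean L s + K) ^ 4 / w + w * ‖empOp T s x - mean π T x‖ ^ 4)
        + 2 * a.ρ ^ lineSearchCount a X (empOp T s) x
          * ‖empOp T s (proj X (x - (a.γ * a.ρ ^ lineSearchCount a X (empOp T s) x) • mean π T x))
            - mean π T (proj X (x - (a.γ * a.ρ ^ lineSearchCount a X (empOp T s) x)
              • mean π T x))‖ ^ 2 := by
  set A := empOp T s
  set H := mean π T
  set m := lineSearchCount a X A x
  set y := midPoint a X A x
  set t := stepSize a X A x with htdef
  have ht : a.γ * a.ρ ^ m = t := rfl
  rw [ht]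
  set v := proj X (x - t • H x)
  have hl := empMean_ge_one hS fun j => (hs j).1
  have hK := h.one_le
  have hA := norm_empOp_sub_le fun j => (hs j).2
  have ht0 : 0 < t := stepSize_pos ha
  have ht1 : t ≤ 1 := stepSize_le_one ha
  have hp1 : a.ρ ^ m ≤ 1 := pow_le_one₀ ha.ρ_pos.le ha.ρ_lt_one.le
  have hp0 : 0 < a.ρ ^ m := pow_pos ha.ρ_pos _
  -- This keeps a geometric weight in front of the error at v, for the later sum over m.
  have htp : t ^ 2 ≤ a.ρ ^ m := by
    have : t ≤ a.ρ ^ m := by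
      rw [← ht]; exact mul_le_of_le_one_left hp0.le ha.γ_le_one
    nlinarith
  -- Both points use the same step t, and differ only in the operator value at x.
  have hyv : ‖y - v‖ ≤ ‖A x - H x‖ := by
    refine (norm_proj_sub_proj_le hne hc hX _ _).trans ?_
    rw [show x - t • A x - (x - t • H x) = t • (H x - A x) by module, norm_smul,
      Real.norm_of_nonneg ht0.le, norm_sub_rev]
    exact mul_le_of_le_one_left (norm_nonneg _) ht1
  have h1 : ‖A y - H y‖ ≤ (empMean L s + K) * ‖A x - H x‖ + ‖A v - H v‖ := by
    have e : A y - H y = (A y - A v) - (H y - H v) + (A v - H v) := by abel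
    rw [e]
    refine (norm_add_le _ _).trans (add_le_add_left ?_ _)
    refine (norm_sub_le _ _).trans ?_
    rw [add_mul]
    exact add_le_add ((hA y v).trans (mul_le_mul_of_nonneg_left hyv (by linarith)))
      ((h.norm_mean_sub_le y v).trans (mul_le_mul_of_nonneg_left hyv (by linarith)))
  set e := ‖A x - H x‖
  set f := ‖A v - H v‖
  set l := empMean L s + K
  have h2 : ‖A y - H y‖ ^ 2 ≤ 2 * (l * e) ^ 2 + 2 * f ^ 2 := by
    refine (pow_le_pow_left₀ (norm_nonneg _) h1 2).trans ?_
    nlinarith [sq_nonneg (l * e - f)]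
  -- Young's inequality with a free weight: it separates two dependent factors, each of which has a
  -- fourth moment.
  have h3 : 2 * (l * e) ^ 2 ≤ l ^ 4 / w + w * e ^ 4 := by
    rw [div_add' _ _ _ hw.ne', le_div_iff₀ hw]
    nlinarith [sq_nonneg (l ^ 2 - w * e ^ 2)]
  calc t ^ 2 * ‖A y - H y‖ ^ 2 ≤ t ^ 2 * (2 * (l * e) ^ 2 + 2 * f ^ 2) :=
        mul_le_mul_of_nonneg_left h2 (by positivity)
    _ = t ^ 2 * (2 * (l * e) ^ 2) + 2 * t ^ 2 * f ^ 2 := by ring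
    _ ≤ _ := by
        refine add_le_add (le_trans ?_ h3) (by gcongr)
        exact mul_le_of_le_one_left (by positivity) (pow_le_one₀ ht0.le ht1)

/-- Since xs is its own projection, the distance to it grows by at most ‖H(x)‖, which has linear
growth. The bound is uniform in t, so it serves all trial steps. -/
theorem gauge_proj_le (h : OracleMoments π T L xs K) (hxs : xs ∈ X) (hc : IsClosed X)
    (hX : Convex ℝ X) {t : ℝ} (ht0 : 0 ≤ t) (ht1 : t ≤ 1) (x : Vec n) :
    1 + ‖proj X (x - t • mean π T x) - xs‖ ^ 2 ≤ 4 * K * (1 + ‖x - xs‖ ^ 2) := by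
  have hK := h.one_le
  have h1 : ‖proj X (x - t • mean π T x) - xs‖ ≤ ‖x - xs‖ + ‖mean π T x‖ := by
    have := norm_proj_sub_proj_le ⟨xs, hxs⟩ hc hX (x - t • mean π T x) xs
    rw [proj_of_mem hc hX hxs] at this
    refine this.trans ?_
    rw [show x - t • mean π T x - xs = (x - xs) - t • mean π T x by abel]
    refine (norm_sub_le _ _).trans (add_le_add_right ?_ _)
    rw [norm_smul, Real.norm_of_nonneg ht0]
    exact mul_le_of_le_one_left (norm_nonneg _) ht1
  have h2 := pow_le_pow_left₀ (norm_nonneg _) h1 2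
  have h3 := h.norm_mean_sq_le x
  nlinarith [sq_nonneg (‖x - xs‖ - ‖mean π T x‖), sq_nonneg ‖x - xs‖]

/-- The expected error of the first empirical operator at the mid point. -/
theorem lintegral_stepSize_mul_error_le (h : OracleMoments π T L xs K) (ha : a.Admissible)
    (hxs : xs ∈ X) (hc : IsClosed X) (hX : Convex ℝ X) (hS : S ≠ 0) (x : Vec n) :
    ∫⁻ s, ENNReal.ofReal (stepSize a X (empOp T s) x ^ 2
        * ‖empOp T s (midPoint a X (empOp T s) x)
          - mean π T (midPoint a X (empOp T s) x)‖ ^ 2) ∂(Measure.pi fun _ : Fin S => π)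
      ≤ ENNReal.ofReal (344 * K ^ 4 / (1 - a.ρ) * (1 + ‖x - xs‖ ^ 2) / Real.sqrt S) := by
  have hne : X.Nonempty := ⟨xs, hxs⟩
  have hK := h.one_le
  have hS1 : (1 : ℝ) ≤ S := by exact_mod_cast Nat.one_le_iff_ne_zero.2 hS
  have hρ : 0 < 1 - a.ρ := by linarith [ha.ρ_lt_one]
  set R := Real.sqrt S with hR
  have hR1 : 1 ≤ R := Real.one_le_sqrt.2 hS1
  have hRS : R ^ 2 = S := Real.sq_sqrt (by linarith)
  set g := 1 + ‖x - xs‖ ^ 2 with hg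
  have hg1 : 1 ≤ g := by have := sq_nonneg ‖x - xs‖; linarith
  -- With this weight the term l⁴/w is of order g/√S, and w e⁴, of order g/S^(3/2), is no larger.
  set w := R / g
  have hw : 0 < w := by positivity
  set v : ℕ → Vec n := fun m => proj X (x - (a.γ * a.ρ ^ m) • mean π T x)
  set f : (Fin S → Ξ) → ℝ := fun s =>
    (empMean L s + K) ^ 4 / w + w * ‖empOp T s x - mean π T x‖ ^ 4 with hf
  set q : ℕ → (Fin S → Ξ) → ℝ := fun m s =>
    2 * a.ρ ^ m * ‖empOp T s (v m) - mean π T (v m)‖ ^ 2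
  have hρm : ∀ m, 0 < a.ρ ^ m := fun m => pow_pos ha.ρ_pos m
  have hq0 : ∀ m s, 0 ≤ q m s := fun m s => by have := hρm m; positivity
  obtain ⟨i4, l4⟩ := h.integral_empMean_pow_four_le hS
  obtain ⟨ie, le⟩ := h.integral_empOp_sub_pow_four_le hS x
  have hsum : ∀ r : ℝ, (r + K) ^ 4 ≤ 8 * (r ^ 4 + K ^ 4) := fun r => by
    have := norm_sub_pow_four_le r (-K)
    rw [sub_neg_eq_add, norm_neg, Real.norm_eq_abs, Real.norm_eq_abs, Real.norm_eq_abs,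
      Even.pow_abs (by decide), Even.pow_abs (by decide), Even.pow_abs (by decide)] at this
    exact this
  have h84 : Integrable (fun s : Fin S → Ξ => 8 * (empMean L s ^ 4 + K ^ 4))
      (Measure.pi fun _ => π) := (i4.add (integrable_const _)).const_mul 8
  have hlK : Integrable (fun s : Fin S → Ξ => (empMean L s + K) ^ 4) (Measure.pi fun _ => π) := by
    refine h84.mono' ((h.measurable_empMean.add_const K).pow_const 4).aestronglyMeasurable
      (.of_forall fun s => ?_)
    rw [Real.norm_of_nonneg (Even.pow_nonneg (by decide) _)]
    exact hsum _
  have hlKle : ∫ s : Fin S → Ξ, (empMean L s + K) ^ 4 ∂(Measure.pi fun _ => π) ≤ 16 * K ^ 4 := by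
    refine (integral_mono hlK h84 fun s => hsum _).trans ?_
    rw [integral_const_mul, integral_add i4 (integrable_const _)]
    simp only [integral_const, probReal_univ, one_smul]
    have : K ≤ K ^ 4 := le_self_pow₀ hK (by norm_num)
    linarith
  have hfi : Integrable f (Measure.pi fun _ => π) := (hlK.div_const w).add (ie.const_mul w)
  have hf0 : ∀ s, 0 ≤ f s := fun s => by
    have : 0 ≤ (empMean L s + K) ^ 4 := Even.pow_nonneg (by decide) _
    positivity
  have hK4 : K ≤ K ^ 4 := le_self_pow₀ hK (by norm_num)
  have hfle : ∫ s, f s ∂(Measure.pi fun _ => π) ≤ 80 * K ^ 4 * g / R := by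
    have hsplit : ∫ s, f s ∂(Measure.pi fun _ => π) = _ :=
      integral_add (hlK.div_const w) (ie.const_mul w)
    rw [hsplit, integral_div, integral_const_mul]
    have k1 : (∫ s : Fin S → Ξ, (empMean L s + K) ^ 4 ∂(Measure.pi fun _ => π)) / w
        ≤ 16 * K ^ 4 * g / R := by
      rw [div_div_eq_mul_div]
      gcongr
    have k2 : w * ∫ s : Fin S → Ξ, ‖empOp T s x - mean π T x‖ ^ 4 ∂(Measure.pi fun _ => π)
        ≤ 64 * K ^ 4 * g / R := by
      refine (mul_le_mul_of_nonneg_left le hw.le).trans ?_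
      have : w * (64 * K * g ^ 2 / (S : ℝ) ^ 2) = 64 * K * g / R ^ 3 := by
        rw [← hRS]; simp only [w]; field_simp
      rw [this]
      gcongr
      exact le_self_pow₀ hR1 (by norm_num)
    calc _ ≤ 16 * K ^ 4 * g / R + 64 * K ^ 4 * g / R := add_le_add k1 k2
      _ = _ := by ring
  have hqle : ∀ m, ∫⁻ s, ENNReal.ofReal (q m s) ∂(Measure.pi fun _ : Fin S => π)
      ≤ ENNReal.ofReal (264 * K ^ 2 * g / R * a.ρ ^ m) := fun m => by
    obtain ⟨j1, j2⟩ := h.integral_empOp_sub_sq_le hS (v m)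
    refine lintegral_ofReal_le (j1.const_mul _) (hq0 m) ?_
    rw [integral_const_mul]
    have hm := hρm m
    have hv := h.gauge_proj_le hxs hc hX (t := a.γ * a.ρ ^ m) (mul_nonneg ha.γ_pos.le hm.le)
      (mul_le_one₀ ha.γ_le_one hm.le (pow_le_one₀ ha.ρ_pos.le ha.ρ_lt_one.le)) x
    calc _ ≤ 2 * a.ρ ^ m * (33 * K * (4 * K * g) / R) := by
          refine mul_le_mul_of_nonneg_left (j2.trans ?_) (by positivity)
          gcongr
          rw [← hRS]
          exact le_self_pow₀ hR1 (by norm_num)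
      _ = _ := by ring
  have hqm : ∀ m, AEMeasurable (fun s => ENNReal.ofReal (q m s)) (Measure.pi fun _ : Fin S => π) :=
    fun m => ((((h.measurable_empOp_apply (v m)).sub_const _).norm.pow_const 2).const_mul
      _).ennreal_ofReal.aemeasurable
  calc _ ≤ ∫⁻ s, (ENNReal.ofReal (f s) + ∑' m, ENNReal.ofReal (q m s))
        ∂(Measure.pi fun _ : Fin S => π) := by
        refine lintegral_mono_ae ?_
        filter_upwards [h.ae_good] with s hs
        refine (ENNReal.ofReal_le_ofReal
          (h.stepSize_mul_error_sq_le ha hne hc hX hS x hs hw)).trans ?_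
        -- The realized m is random and correlated with the error. It is removed by bounding its
        -- term by the sum over all m, whose points v m are deterministic.
        rw [ENNReal.ofReal_add (hf0 s) (hq0 (lineSearchCount a X (empOp T s) x) s)]
        exact add_le_add_right (ENNReal.le_tsum (f := fun m => ENNReal.ofReal (q m s))
          (lineSearchCount a X (empOp T s) x)) _
    _ = ∫⁻ s, ENNReal.ofReal (f s) ∂(Measure.pi fun _ : Fin S => π)
        + ∑' m, ∫⁻ s, ENNReal.ofReal (q m s) ∂(Measure.pi fun _ : Fin S => π) := by
        rw [lintegral_add_left' hfi.1.aemeasurable.ennreal_ofReal, lintegral_tsum hqm]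
    _ ≤ ENNReal.ofReal (80 * K ^ 4 * g / R)
        + ∑' m, ENNReal.ofReal (264 * K ^ 2 * g / R * a.ρ ^ m) :=
        add_le_add (lintegral_ofReal_le hfi hf0 hfle) (ENNReal.tsum_le_tsum hqle)
    _ = ENNReal.ofReal (80 * K ^ 4 * g / R + 264 * K ^ 2 * g / R * (1 - a.ρ)⁻¹) := by
        rw [← ENNReal.ofReal_tsum_of_nonneg (fun m => by have := hρm m; positivity)
          ((summable_geometric_of_lt_one ha.ρ_pos.le ha.ρ_lt_one).mul_left _), tsum_mul_left,
          tsum_geometric_of_lt_one ha.ρ_pos.le ha.ρ_lt_one,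
          ENNReal.ofReal_add (by positivity) (by positivity)]
    _ ≤ _ := by
        refine ENNReal.ofReal_le_ofReal ?_
        have hK2 : K ^ 2 ≤ K ^ 4 := pow_le_pow_right₀ hK (by norm_num)
        have h80 : 80 * K ^ 4 ≤ 80 * K ^ 4 / (1 - a.ρ) :=
          le_div_self (by positivity) hρ (by linarith [ha.ρ_pos])
        have h264 : 264 * K ^ 2 / (1 - a.ρ) ≤ 264 * K ^ 4 / (1 - a.ρ) := by gcongr
        calc _ = (80 * K ^ 4 + 264 * K ^ 2 / (1 - a.ρ)) * (g / R) := by field_simp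
          _ ≤ (80 * K ^ 4 / (1 - a.ρ) + 264 * K ^ 4 / (1 - a.ρ)) * (g / R) := by gcongr
          _ = _ := by ring

/-- The expected squared distance of the mid point to the reference point. -/
theorem lintegral_gauge_midPoint_le (h : OracleMoments π T L xs K) (ha : a.Admissible)
    (hxs : xs ∈ X) (hc : IsClosed X) (hX : Convex ℝ X) (hS : S ≠ 0) (x : Vec n) :
    ∫⁻ s, ENNReal.ofReal (1 + ‖midPoint a X (empOp T s) x - xs‖ ^ 2)
        ∂(Measure.pi fun _ : Fin S => π)
      ≤ ENNReal.ofReal (105 * K * (1 + ‖x - xs‖ ^ 2)) := by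
  have hK := h.one_le
  have hS1 : (1 : ℝ) ≤ S := by exact_mod_cast Nat.one_le_iff_ne_zero.2 hS
  obtain ⟨j1, j2⟩ := h.integral_empOp_sub_sq_le hS x
  set g := 1 + ‖x - xs‖ ^ 2 with hg
  have hg1 : 1 ≤ g := by have := sq_nonneg ‖x - xs‖; linarith
  have hpt : ∀ s : Fin S → Ξ, 1 + ‖midPoint a X (empOp T s) x - xs‖ ^ 2
      ≤ 3 * g + 3 * K * g + 3 * ‖empOp T s x - mean π T x‖ ^ 2 := fun s => by
    have ht0 := stepSize_pos (X := X) (A := empOp T s) (x := x) ha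
    have ht1 := stepSize_le_one (X := X) (A := empOp T s) (x := x) ha
    have h1 : ‖midPoint a X (empOp T s) x - xs‖
        ≤ ‖x - xs‖ + ‖mean π T x‖ + ‖empOp T s x - mean π T x‖ := by
      have := norm_proj_sub_proj_le ⟨xs, hxs⟩ hc hX (x - stepSize a X (empOp T s) x • empOp T s x) xs
      rw [proj_of_mem hc hX hxs] at this
      refine this.trans ?_
      rw [show x - stepSize a X (empOp T s) x • empOp T s x - xs
        = (x - xs) - stepSize a X (empOp T s) x • empOp T s x by abel, add_assoc]
      refine (norm_sub_le _ _).trans (add_le_add_right ?_ _)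
      rw [norm_smul, Real.norm_of_nonneg ht0.le]
      refine (mul_le_of_le_one_left (norm_nonneg _) ht1).trans ?_
      calc ‖empOp T s x‖ = ‖mean π T x + (empOp T s x - mean π T x)‖ := by congr 1; abel
        _ ≤ _ := norm_add_le _ _
    have h2 := pow_le_pow_left₀ (norm_nonneg _) h1 2
    have h3 := h.norm_mean_sq_le x
    set e := ‖empOp T s x - mean π T x‖
    set H := ‖mean π T x‖
    set d := ‖x - xs‖
    nlinarith [sq_nonneg (d - H), sq_nonneg (d - e), sq_nonneg (H - e)]
  have hdom : Integrable (fun s : Fin S → Ξ => 3 * g + 3 * K * g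
      + 3 * ‖empOp T s x - mean π T x‖ ^ 2) (Measure.pi fun _ => π) :=
    (integrable_const _).add (j1.const_mul 3)
  refine (lintegral_mono fun s => ENNReal.ofReal_le_ofReal (hpt s)).trans
    (lintegral_ofReal_le hdom (fun s => by positivity) ?_)
  rw [integral_add (integrable_const _) (j1.const_mul 3), integral_const_mul]
  simp only [integral_const, probReal_univ, one_smul]
  have h33 : 33 * K * g / S ≤ 33 * K * g := div_le_self (by positivity) hS1
  nlinarith

/-- The expected error of one iteration is of the order of `S ^ (-1/2)`, with a constant that does
not depend on the dimension. -/
theorem lintegral_stepError_le (h : OracleMoments π T L xs K) (ha : a.Admissible)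
    (hxs : xs ∈ X) (hc : IsClosed X) (hX : Convex ℝ X) (hS : S ≠ 0) (x : Vec n) :
    ∫⁻ s, ∫⁻ s', ENNReal.ofReal (stepError (stepSize a X (empOp T s) x)
        ‖empOp T s (midPoint a X (empOp T s) x) - mean π T (midPoint a X (empOp T s) x)‖
        ‖empOp T s' (midPoint a X (empOp T s) x) - mean π T (midPoint a X (empOp T s) x)‖
        ‖midPoint a X (empOp T s) x - xs‖)
        ∂(Measure.pi fun _ : Fin S => π) ∂(Measure.pi fun _ : Fin S => π)
      ≤ ENNReal.ofReal (15000 * K ^ 4 / (1 - a.ρ) * (1 + ‖x - xs‖ ^ 2) / Real.sqrt S) := by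
  have hne : X.Nonempty := ⟨xs, hxs⟩
  have hK := h.one_le
  have hS1 : (1 : ℝ) ≤ S := by exact_mod_cast Nat.one_le_iff_ne_zero.2 hS
  have hρ : 0 < 1 - a.ρ := by linarith [ha.ρ_lt_one]
  have hP : Measurable (proj X) := (continuous_proj hne hc hX).measurable
  set R := Real.sqrt S with hR
  have hR1 : 1 ≤ R := Real.one_le_sqrt.2 hS1
  have hRS : R ^ 2 = S := Real.sq_sqrt (by linarith)
  set g := 1 + ‖x - xs‖ ^ 2 with hg
  have hg1 : 1 ≤ g := by have := sq_nonneg ‖x - xs‖; linarith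
  set Q := Measure.pi fun _ : Fin S => π with hQ
  -- The second sample is integrated with the first one frozen, so the mid point is a fixed point
  -- for it.
  have hB : ∀ y : Vec n, ∫⁻ s', ENNReal.ofReal (4 * R * ‖empOp T s' y - mean π T y‖ ^ 2) ∂Q
      ≤ ENNReal.ofReal (132 * K / R * (1 + ‖y - xs‖ ^ 2)) := fun y => by
    obtain ⟨j1, j2⟩ := h.integral_empOp_sub_sq_le hS y
    refine lintegral_ofReal_le (j1.const_mul _) (fun _ => by positivity) ?_
    rw [integral_const_mul]
    refine (mul_le_mul_of_nonneg_left j2 (by positivity)).trans_eq ?_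
    rw [← hRS]
    field_simp
    ring
  have hpt : ∀ s s' : Fin S → Ξ, ENNReal.ofReal (stepError (stepSize a X (empOp T s) x)
        ‖empOp T s (midPoint a X (empOp T s) x) - mean π T (midPoint a X (empOp T s) x)‖
        ‖empOp T s' (midPoint a X (empOp T s) x) - mean π T (midPoint a X (empOp T s) x)‖
        ‖midPoint a X (empOp T s) x - xs‖)
      ≤ (ENNReal.ofReal 3 * ENNReal.ofReal (stepSize a X (empOp T s) x ^ 2
            * ‖empOp T s (midPoint a X (empOp T s) x)
              - mean π T (midPoint a X (empOp T s) x)‖ ^ 2)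
          + ENNReal.ofReal (1 / R * (1 + ‖midPoint a X (empOp T s) x - xs‖ ^ 2)))
        + ENNReal.ofReal (4 * R * ‖empOp T s' (midPoint a X (empOp T s) x)
          - mean π T (midPoint a X (empOp T s) x)‖ ^ 2) := fun s s' => by
    have ht0 := stepSize_pos (X := X) (A := empOp T s) (x := x) ha
    have ht1 := stepSize_le_one (X := X) (A := empOp T s) (x := x) ha
    rw [← ENNReal.ofReal_mul (by norm_num), ← ENNReal.ofReal_add (by positivity) (by positivity),
      ← ENNReal.ofReal_add (by positivity) (by positivity)]
    refine ENNReal.ofReal_le_ofReal ?_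
    set t := stepSize a X (empOp T s) x
    set u := ‖empOp T s (midPoint a X (empOp T s) x) - mean π T (midPoint a X (empOp T s) x)‖
    set v := ‖empOp T s' (midPoint a X (empOp T s) x) - mean π T (midPoint a X (empOp T s) x)‖
    set d := ‖midPoint a X (empOp T s) x - xs‖
    have hv0 : 0 ≤ v := norm_nonneg _
    have hd0 : 0 ≤ d := norm_nonneg _
    -- Weighted Young: v² has mean of order 1/S, so the weights √S and 1/√S make both terms of order
    -- 1/√S.
    have k1 : 2 * t * (v * d) ≤ R * v ^ 2 + 1 / R * d ^ 2 := by
      have : 2 * t * (v * d) ≤ 2 * (v * d) := by nlinarith [mul_nonneg hv0 hd0]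
      refine this.trans ?_
      rw [← sub_nonneg]
      have : R * v ^ 2 + 1 / R * d ^ 2 - 2 * (v * d) = (R * v - d) ^ 2 / R := by
        field_simp; ring
      rw [this]
      positivity
    have k2 : 3 * t ^ 2 * v ^ 2 ≤ 3 * R * v ^ 2 := by
      have : t ^ 2 ≤ R := (pow_le_one₀ ht0.le ht1).trans hR1
      gcongr
    have k3 : 0 ≤ 1 / R := by positivity
    unfold stepError
    linarith
  have hm1 : Measurable fun s : Fin S → Ξ => midPoint a X (empOp T s) x :=
    measurable_midPoint hP (measurable_empOp h.measurable_T) measurable_const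
  have hgm : Measurable fun s : Fin S → Ξ => 1 + ‖midPoint a X (empOp T s) x - xs‖ ^ 2 :=
    ((hm1.sub_const _).norm.pow_const 2).const_add 1
  have hum : Measurable fun s : Fin S → Ξ => stepSize a X (empOp T s) x ^ 2
      * ‖empOp T s (midPoint a X (empOp T s) x)
        - mean π T (midPoint a X (empOp T s) x)‖ ^ 2 := by
    refine ((measurable_stepSize hP (measurable_empOp h.measurable_T)
      measurable_const).pow_const 2).mul (Measurable.pow_const (Measurable.norm ?_) 2)
    exact (measurable_apply_comp (measurable_empOp h.measurable_T) hm1).sub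
      (h.continuous_mean.measurable.comp hm1)
  calc _ ≤ ∫⁻ s, ((ENNReal.ofReal 3 * ENNReal.ofReal (stepSize a X (empOp T s) x ^ 2
            * ‖empOp T s (midPoint a X (empOp T s) x)
              - mean π T (midPoint a X (empOp T s) x)‖ ^ 2)
          + ENNReal.ofReal (1 / R) * ENNReal.ofReal (1 + ‖midPoint a X (empOp T s) x - xs‖ ^ 2))
        + ENNReal.ofReal (132 * K / R)
          * ENNReal.ofReal (1 + ‖midPoint a X (empOp T s) x - xs‖ ^ 2)) ∂Q := by
        refine lintegral_mono fun s => ?_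
        refine (lintegral_mono (hpt s)).trans ?_
        rw [lintegral_add_left measurable_const, lintegral_const, measure_univ, mul_one,
          ← ENNReal.ofReal_mul (p := 1 / R) (by positivity),
          ← ENNReal.ofReal_mul (p := 132 * K / R) (by positivity)]
        exact add_le_add_right (hB _) _
    _ = ENNReal.ofReal 3 * ∫⁻ s, ENNReal.ofReal (stepSize a X (empOp T s) x ^ 2
            * ‖empOp T s (midPoint a X (empOp T s) x)
              - mean π T (midPoint a X (empOp T s) x)‖ ^ 2) ∂Q
          + ENNReal.ofReal (1 / R)
            * ∫⁻ s, ENNReal.ofReal (1 + ‖midPoint a X (empOp T s) x - xs‖ ^ 2) ∂Q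
          + ENNReal.ofReal (132 * K / R)
            * ∫⁻ s, ENNReal.ofReal (1 + ‖midPoint a X (empOp T s) x - xs‖ ^ 2) ∂Q := by
        rw [lintegral_add_right _ (hgm.ennreal_ofReal.const_mul _),
          lintegral_add_right _ (hgm.ennreal_ofReal.const_mul _),
          lintegral_const_mul _ hum.ennreal_ofReal, lintegral_const_mul _ hgm.ennreal_ofReal,
          lintegral_const_mul _ hgm.ennreal_ofReal]
    _ ≤ ENNReal.ofReal 3 * ENNReal.ofReal (344 * K ^ 4 / (1 - a.ρ) * g / R)
          + ENNReal.ofReal (1 / R) * ENNReal.ofReal (105 * K * g)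
          + ENNReal.ofReal (132 * K / R) * ENNReal.ofReal (105 * K * g) := by
        have k1 := h.lintegral_stepSize_mul_error_le ha hxs hc hX hS x
        have k2 := h.lintegral_gauge_midPoint_le ha hxs hc hX hS x
        gcongr
    _ = ENNReal.ofReal (3 * (344 * K ^ 4 / (1 - a.ρ) * g / R) + 1 / R * (105 * K * g)
          + 132 * K / R * (105 * K * g)) := by
        rw [← ENNReal.ofReal_mul (by positivity), ← ENNReal.ofReal_mul (by positivity),
          ← ENNReal.ofReal_mul (by positivity), ← ENNReal.ofReal_add (by positivity) (by positivity),
          ← ENNReal.ofReal_add (by positivity) (by positivity)]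
    _ ≤ _ := by
        refine ENNReal.ofReal_le_ofReal ?_
        have hKK : K ≤ K ^ 4 := le_self_pow₀ hK (by norm_num)
        have hK2 : K ^ 2 ≤ K ^ 4 := pow_le_pow_right₀ hK (by norm_num)
        have hdiv : K ^ 4 ≤ K ^ 4 / (1 - a.ρ) :=
          le_div_self (by positivity) hρ (by linarith [ha.ρ_pos])
        -- The sum 1032 + 105 + 13860 = 14997 explains the constant 15000.
        calc _ = (1032 * (K ^ 4 / (1 - a.ρ)) + 105 * K + 13860 * K ^ 2) * (g / R) := by ring
          _ ≤ (15000 * (K ^ 4 / (1 - a.ρ))) * (g / R) := by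
              refine mul_le_mul_of_nonneg_right ?_ (by positivity)
              linarith
          _ = _ := by ring

/-- The squared residual is controlled by the expected square of the first half step. -/
theorem residual_sq_le (h : OracleMoments π T L xs K) (ha : a.Admissible)
    (hxs : xs ∈ X) (hc : IsClosed X) (hX : Convex ℝ X) (hS : S ≠ 0) (x : Vec n) :
    ENNReal.ofReal (residual X (mean π T) a.γ x ^ 2)
      ≤ ENNReal.ofReal (4 * (1 + 2 * K / (a.ρ * a.μ)) ^ 2)
          * ∫⁻ s, ENNReal.ofReal (‖midPoint a X (empOp T s) x - x‖ ^ 2)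
            ∂(Measure.pi fun _ : Fin S => π)
        + ENNReal.ofReal (132 * K * (1 + ‖x - xs‖ ^ 2) / Real.sqrt S) := by
  have hne : X.Nonempty := ⟨xs, hxs⟩
  have hK := h.one_le
  have hS1 : (1 : ℝ) ≤ S := by exact_mod_cast Nat.one_le_iff_ne_zero.2 hS
  have hP : Measurable (proj X) := (continuous_proj hne hc hX).measurable
  have hρμ := mul_pos ha.ρ_pos ha.μ_pos
  set R := Real.sqrt S with hR
  have hR1 : 1 ≤ R := Real.one_le_sqrt.2 hS1
  have hRS : R ^ 2 = S := Real.sq_sqrt (by linarith)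
  set g := 1 + ‖x - xs‖ ^ 2 with hg
  set C := 1 + 2 * K / (a.ρ * a.μ) with hC
  have hC1 : 1 ≤ C := by have : 0 ≤ 2 * K / (a.ρ * a.μ) := by positivity
                         linarith
  set r := residual X (mean π T) a.γ x
  set Q := Measure.pi fun _ : Fin S => π with hQ
  obtain ⟨j1, j2⟩ := h.integral_empOp_sub_sq_le hS x
  obtain ⟨i1, i2⟩ := h.integral_empMean_le hS
  -- If the empirical modulus is at most 2K, the line search bound applies with the deterministic C.
  -- Otherwise the last term alone exceeds r², as in Markov's inequality.
  have hpt : ∀ s : Fin S → Ξ, (∀ j, GoodSample T L (s j)) →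
      r ^ 2 ≤ 2 * C ^ 2 * ‖midPoint a X (empOp T s) x - x‖ ^ 2
        + 2 * ‖empOp T s x - mean π T x‖ ^ 2 + r ^ 2 / (2 * K) * empMean L s := fun s hs => by
    have hl := empMean_ge_one hS fun j => (hs j).1
    have hA := norm_empOp_sub_le fun j => (hs j).2
    rcases le_total (empMean L s) (2 * K) with hle | hle
    · have hlC : empMean L s ≤ C * (a.ρ * a.μ) := by
        rw [hC, add_mul, div_mul_cancel₀ _ hρμ.ne']
        linarith
      have k1 := norm_proj_sub_le_of_lineSearch (x := x) hne hc hX hA ha hC1 hlC (mean π T x)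
      change r ≤ _ at k1
      have k2 := pow_le_pow_left₀ (norm_nonneg _) k1 2
      have k3 : 0 ≤ r ^ 2 / (2 * K) * empMean L s := by positivity
      change r ^ 2 ≤ _ at k2
      nlinarith [sq_nonneg (C * ‖midPoint a X (empOp T s) x - x‖ - ‖empOp T s x - mean π T x‖)]
    · have k3 : r ^ 2 ≤ r ^ 2 / (2 * K) * empMean L s := by
        rw [div_mul_eq_mul_div, le_div_iff₀ (by positivity)]
        exact mul_le_mul_of_nonneg_left hle (sq_nonneg r)
      have : 0 ≤ 2 * C ^ 2 * ‖midPoint a X (empOp T s) x - x‖ ^ 2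
        + 2 * ‖empOp T s x - mean π T x‖ ^ 2 := by positivity
      linarith
  set I := ∫⁻ s, ENNReal.ofReal (‖midPoint a X (empOp T s) x - x‖ ^ 2) ∂Q
  have hm1 : Measurable fun s : Fin S → Ξ => ENNReal.ofReal (‖midPoint a X (empOp T s) x - x‖ ^ 2) :=
    (((measurable_midPoint hP (measurable_empOp h.measurable_T) measurable_const).sub_const
      x).norm.pow_const 2).ennreal_ofReal
  have hm2 : Measurable fun s : Fin S → Ξ => ENNReal.ofReal (‖empOp T s x - mean π T x‖ ^ 2) :=
    (((h.measurable_empOp_apply x).sub_const _).norm.pow_const 2).ennreal_ofReal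
  have hm3 : Measurable fun s : Fin S → Ξ => ENNReal.ofReal (empMean L s) :=
    h.measurable_empMean.ennreal_ofReal
  have key : ENNReal.ofReal (r ^ 2) ≤ ENNReal.ofReal (2 * C ^ 2) * I
      + ENNReal.ofReal (66 * K * g / R) + ENNReal.ofReal (r ^ 2 / 2) := by
    calc ENNReal.ofReal (r ^ 2) = ∫⁻ _s : Fin S → Ξ, ENNReal.ofReal (r ^ 2) ∂Q := by
          rw [lintegral_const, measure_univ, mul_one]
      _ ≤ ∫⁻ s, (ENNReal.ofReal (2 * C ^ 2)
            * ENNReal.ofReal (‖midPoint a X (empOp T s) x - x‖ ^ 2)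
          + ENNReal.ofReal 2 * ENNReal.ofReal (‖empOp T s x - mean π T x‖ ^ 2)
          + ENNReal.ofReal (r ^ 2 / (2 * K)) * ENNReal.ofReal (empMean L s)) ∂Q := by
          refine lintegral_mono_ae ?_
          filter_upwards [h.ae_good] with s hs
          have hl := empMean_ge_one hS fun j => (hs j).1
          rw [← ENNReal.ofReal_mul (by positivity), ← ENNReal.ofReal_mul (by positivity),
            ← ENNReal.ofReal_mul (by positivity),
            ← ENNReal.ofReal_add (by positivity) (by positivity),
            ← ENNReal.ofReal_add (by positivity) (by positivity)]
          exact ENNReal.ofReal_le_ofReal (hpt s hs)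
      _ = ENNReal.ofReal (2 * C ^ 2) * I
          + ENNReal.ofReal 2 * ∫⁻ s, ENNReal.ofReal (‖empOp T s x - mean π T x‖ ^ 2) ∂Q
          + ENNReal.ofReal (r ^ 2 / (2 * K)) * ∫⁻ s, ENNReal.ofReal (empMean L s) ∂Q := by
          rw [lintegral_add_right _ (hm3.const_mul _), lintegral_add_right _ (hm2.const_mul _),
            lintegral_const_mul _ hm1, lintegral_const_mul _ hm2, lintegral_const_mul _ hm3]
      _ ≤ ENNReal.ofReal (2 * C ^ 2) * I + ENNReal.ofReal 2 * ENNReal.ofReal (33 * K * g / R)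
          + ENNReal.ofReal (r ^ 2 / (2 * K)) * ENNReal.ofReal K := by
          have k1 : ∫⁻ s, ENNReal.ofReal (‖empOp T s x - mean π T x‖ ^ 2) ∂Q
              ≤ ENNReal.ofReal (33 * K * g / R) := by
            refine lintegral_ofReal_le j1 (fun _ => by positivity) (j2.trans ?_)
            gcongr
            rw [← hRS]
            exact le_self_pow₀ hR1 (by norm_num)
          have k2 : ∫⁻ s, ENNReal.ofReal (empMean L s) ∂Q ≤ ENNReal.ofReal K := by
            rw [← ofReal_integral_eq_lintegral_ofReal i1]
            · exact ENNReal.ofReal_le_ofReal i2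
            · filter_upwards [h.ae_good] with s hs
              have hl := empMean_ge_one hS fun j => (hs j).1
              simp only [Pi.zero_apply]
              linarith
          gcongr
      _ = _ := by
          rw [← ENNReal.ofReal_mul (by positivity), ← ENNReal.ofReal_mul (by positivity)]
          congr 2
          · congr 1; ring
          · field_simp
  -- The mean of the empirical modulus is at most K, so the Markov term costs r²/2. Being finite, it
  -- can be cancelled.
  have hhalf : ENNReal.ofReal (r ^ 2) = ENNReal.ofReal (r ^ 2 / 2) + ENNReal.ofReal (r ^ 2 / 2) := by
    rw [← ENNReal.ofReal_add (by positivity) (by positivity)]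
    congr 1; ring
  rw [hhalf] at key
  have key2 := (ENNReal.add_le_add_iff_right ENNReal.ofReal_ne_top).1 key
  calc ENNReal.ofReal (r ^ 2) = ENNReal.ofReal 2 * ENNReal.ofReal (r ^ 2 / 2) := by
        rw [← ENNReal.ofReal_mul (by norm_num)]; congr 1; ring
    _ ≤ ENNReal.ofReal 2 * (ENNReal.ofReal (2 * C ^ 2) * I + ENNReal.ofReal (66 * K * g / R)) := by
        gcongr
    _ = _ := by
        rw [mul_add, ← mul_assoc, ← ENNReal.ofReal_mul (by norm_num),
          ← ENNReal.ofReal_mul (by norm_num)]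
        congr 2
        · congr 1; ring
        · ring

omit [IsProbabilityMeasure π] in
theorem residualWeight_pos (h : OracleMoments π T L xs K) (ha : a.Admissible) :
    0 < residualWeight a K := by
  have := ha.one_sub_pos
  have := h.one_le
  have := mul_pos ha.ρ_pos ha.μ_pos
  unfold residualWeight
  positivity

/-- In expectation, one iteration decreases the Lyapunov function by a multiple of the squared length
of the first half step, up to an error of the order of `S ^ (-1/2)`. -/
theorem lintegral_lyapunov_step_add_half_step_le (h : OracleMoments π T L xs K) (ha : a.Admissible)
    (hc : IsClosed X) (hX : Convex ℝ X) (hH : Pseudomonotone X (mean π T))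
    (hxs : xs ∈ SOL X (mean π T)) (hS : S ≠ 0) (z : Vec n × ℕ) :
    ∫⁻ s, ∫⁻ s', ENNReal.ofReal (lyapunov a xs (step a X (empOp T s) (empOp T s') z))
        ∂(Measure.pi fun _ : Fin S => π) ∂(Measure.pi fun _ : Fin S => π)
      + ENNReal.ofReal ((1 - 3 * a.μ ^ 2) / 2)
        * ∫⁻ s, ENNReal.ofReal (‖midPoint a X (empOp T s) z.1 - z.1‖ ^ 2)
          ∂(Measure.pi fun _ : Fin S => π)
      ≤ ENNReal.ofReal (lyapunov a xs z) + ENNReal.ofReal (1 + a.M)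
        * ENNReal.ofReal (15000 * K ^ 4 / (1 - a.ρ) * (1 + ‖z.1 - xs‖ ^ 2) / Real.sqrt S) := by
  have hne : X.Nonempty := ⟨xs, hxs.1⟩
  have hK := h.one_le
  have hM := ha.M_pos
  have hμ := ha.one_sub_pos
  have hP : Measurable (proj X) := (continuous_proj hne hc hX).measurable
  set Q := Measure.pi fun _ : Fin S => π with hQ
  have hlyap : ∀ z' : Vec n × ℕ, 0 ≤ lyapunov a xs z' := fun z' => by
    have := andersonTail_nonneg ha.τ_gt z'.2
    unfold lyapunov; positivity
  set c := (1 - 3 * a.μ ^ 2) / 2 with hcdef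
  have hc0 : 0 < c := by positivity
  set err : (Fin S → Ξ) → (Fin S → Ξ) → ℝ := fun s s' =>
    stepError (stepSize a X (empOp T s) z.1)
      ‖empOp T s (midPoint a X (empOp T s) z.1) - mean π T (midPoint a X (empOp T s) z.1)‖
      ‖empOp T s' (midPoint a X (empOp T s) z.1) - mean π T (midPoint a X (empOp T s) z.1)‖
      ‖midPoint a X (empOp T s) z.1 - xs‖
  have herr : ∀ s s', 0 ≤ err s s' := fun s s' => by
    have := stepSize_pos (X := X) (A := empOp T s) (x := z.1) ha
    simp only [err, stepError]; positivity
  have hmF : Measurable fun s : Fin S → Ξ =>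
      ENNReal.ofReal (‖midPoint a X (empOp T s) z.1 - z.1‖ ^ 2) :=
    (((measurable_midPoint hP (measurable_empOp h.measurable_T) measurable_const).sub_const
      z.1).norm.pow_const 2).ennreal_ofReal
  have hmA : Measurable fun q : ((Fin S → Ξ) × (Fin S → Ξ)) × Vec n => empOp T q.1.1 q.2 :=
    Measurable.comp (g := fun q : (Fin S → Ξ) × Vec n => empOp T q.1 q.2)
      (f := fun q : ((Fin S → Ξ) × (Fin S → Ξ)) × Vec n => (q.1.1, q.2))
      (measurable_empOp h.measurable_T) (by fun_prop)
  have hmB : Measurable fun q : ((Fin S → Ξ) × (Fin S → Ξ)) × Vec n => empOp T q.1.2 q.2 :=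
    Measurable.comp (g := fun q : (Fin S → Ξ) × Vec n => empOp T q.1 q.2)
      (f := fun q : ((Fin S → Ξ) × (Fin S → Ξ)) × Vec n => (q.1.2, q.2))
      (measurable_empOp h.measurable_T) (by fun_prop)
  have hmy : Measurable fun q : (Fin S → Ξ) × (Fin S → Ξ) =>
      midPoint a X (empOp T q.1) z.1 :=
    measurable_midPoint (A := fun q : (Fin S → Ξ) × (Fin S → Ξ) => empOp T q.1) hP hmA
      measurable_const
  have hmt : Measurable fun q : (Fin S → Ξ) × (Fin S → Ξ) =>
      stepSize a X (empOp T q.1) z.1 :=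
    measurable_stepSize (A := fun q : (Fin S → Ξ) × (Fin S → Ξ) => empOp T q.1) hP hmA
      measurable_const
  have hmerr : Measurable fun q : (Fin S → Ξ) × (Fin S → Ξ) => ENNReal.ofReal (err q.1 q.2) := by
    have hH := h.continuous_mean.measurable.comp hmy
    have hu := ((measurable_apply_comp (A := fun q : (Fin S → Ξ) × (Fin S → Ξ) => empOp T q.1)
      hmA hmy).sub hH).norm
    have hv := ((measurable_apply_comp (A := fun q : (Fin S → Ξ) × (Fin S → Ξ) => empOp T q.2)
      hmB hmy).sub hH).norm
    have hd := (hmy.sub_const xs).norm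
    exact ((((hmt.pow_const 2).const_mul 3).mul ((hu.pow_const 2).add (hv.pow_const 2))).add
      ((hmt.const_mul 2).mul (hv.mul hd))).ennreal_ofReal
  have hEle : ∫⁻ s, ∫⁻ s', ENNReal.ofReal (err s s') ∂Q ∂Q ≤ ENNReal.ofReal
      (15000 * K ^ 4 / (1 - a.ρ) * (1 + ‖z.1 - xs‖ ^ 2) / Real.sqrt S) :=
    h.lintegral_stepError_le ha hxs.1 hc hX hS z.1
  have hpt : ∀ s : Fin S → Ξ, (∀ j, GoodSample T L (s j)) → ∀ s',
      ENNReal.ofReal (lyapunov a xs (step a X (empOp T s) (empOp T s') z))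
        + ENNReal.ofReal c * ENNReal.ofReal (‖midPoint a X (empOp T s) z.1 - z.1‖ ^ 2)
      ≤ ENNReal.ofReal (lyapunov a xs z) + ENNReal.ofReal (1 + a.M) * ENNReal.ofReal (err s s') :=
    fun s hs s' => by
      -- On good samples the empirical operator is Lipschitz, so the line search terminates and its
      -- test holds at the accepted step.
      have hl := empMean_ge_one hS fun j => (hs j).1
      have := lyapunov_step_le ha hc hX hH hxs z (A := empOp T s) (B := empOp T s')
        (lineSearchTest_count (by linarith) (norm_empOp_sub_le fun j => (hs j).2) ha)
      rw [← ENNReal.ofReal_mul hc0.le, ← ENNReal.ofReal_mul (by positivity),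
        ← ENNReal.ofReal_add (hlyap _) (by positivity),
        ← ENNReal.ofReal_add (hlyap _) (mul_nonneg (by positivity) (herr s s'))]
      exact ENNReal.ofReal_le_ofReal this
  set I := ∫⁻ s, ENNReal.ofReal (‖midPoint a X (empOp T s) z.1 - z.1‖ ^ 2) ∂Q
  clear_value err
  calc _ = ∫⁻ s, ∫⁻ s', (ENNReal.ofReal (lyapunov a xs (step a X (empOp T s) (empOp T s') z))
        + ENNReal.ofReal c * ENNReal.ofReal (‖midPoint a X (empOp T s) z.1 - z.1‖ ^ 2))
        ∂Q ∂Q := by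
        rw [← lintegral_const_mul _ hmF, ← lintegral_add_right _ (hmF.const_mul _)]
        refine lintegral_congr fun s => ?_
        rw [lintegral_add_right _ measurable_const, lintegral_const, measure_univ, mul_one]
    _ ≤ ∫⁻ s, ∫⁻ s', (ENNReal.ofReal (lyapunov a xs z)
        + ENNReal.ofReal (1 + a.M) * ENNReal.ofReal (err s s')) ∂Q ∂Q := by
        refine lintegral_mono_ae ?_
        filter_upwards [h.ae_good] with s hs
        exact lintegral_mono (hpt s hs)
    _ = ENNReal.ofReal (lyapunov a xs z) + ENNReal.ofReal (1 + a.M)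
        * ∫⁻ s, ∫⁻ s', ENNReal.ofReal (err s s') ∂Q ∂Q := by
        have hsec : ∀ s, Measurable fun s' => ENNReal.ofReal (err s s') := fun s =>
          hmerr.comp measurable_prodMk_left
        have : ∀ s, ∫⁻ s', (ENNReal.ofReal (lyapunov a xs z)
            + ENNReal.ofReal (1 + a.M) * ENNReal.ofReal (err s s')) ∂Q
            = ENNReal.ofReal (lyapunov a xs z)
              + ENNReal.ofReal (1 + a.M) * ∫⁻ s', ENNReal.ofReal (err s s') ∂Q := fun s => by
          rw [lintegral_add_left measurable_const, lintegral_const, measure_univ, mul_one,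
            lintegral_const_mul _ (hsec s)]
        simp_rw [this]
        rw [lintegral_add_left measurable_const, lintegral_const, measure_univ, mul_one,
          lintegral_const_mul _ hmerr.lintegral_prod_right']
    _ ≤ _ := by
        gcongr


/-- In expectation, one iteration decreases the Lyapunov function by a multiple of the squared
residual, up to an error of the order of `S ^ (-1/2)`. -/
theorem lintegral_lyapunov_step_le (h : OracleMoments π T L xs K) (ha : a.Admissible)
    (hc : IsClosed X) (hX : Convex ℝ X) (hH : Pseudomonotone X (mean π T))
    (hxs : xs ∈ SOL X (mean π T)) (hS : S ≠ 0) (z : Vec n × ℕ) :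
    ∫⁻ s, ∫⁻ s', ENNReal.ofReal (lyapunov a xs (step a X (empOp T s) (empOp T s') z))
        ∂(Measure.pi fun _ : Fin S => π) ∂(Measure.pi fun _ : Fin S => π)
      + ENNReal.ofReal (residualWeight a K) * ENNReal.ofReal (residual X (mean π T) a.γ z.1 ^ 2)
      ≤ ENNReal.ofReal (lyapunov a xs z)
        + ENNReal.ofReal (errorConst a K / Real.sqrt S) * ENNReal.ofReal (1 + ‖z.1 - xs‖ ^ 2) := by
  have hK := h.one_le
  have hM := ha.M_pos
  have hρ : 0 < 1 - a.ρ := by linarith [ha.ρ_lt_one]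
  have hw := h.residualWeight_pos ha
  have hC : 0 < 1 + 2 * K / (a.ρ * a.μ) := by
    have := mul_pos ha.ρ_pos ha.μ_pos
    positivity
  have hstep := h.lintegral_lyapunov_step_add_half_step_le ha hc hX hH hxs hS z
  have hres := h.residual_sq_le ha hxs.1 hc hX hS z.1
  revert hstep hres
  generalize ∫⁻ s, ∫⁻ s', ENNReal.ofReal (lyapunov a xs (step a X (empOp T s) (empOp T s') z))
    ∂(Measure.pi fun _ : Fin S => π) ∂(Measure.pi fun _ : Fin S => π) = J
  generalize ∫⁻ s, ENNReal.ofReal (‖midPoint a X (empOp T s) z.1 - z.1‖ ^ 2)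
    ∂(Measure.pi fun _ : Fin S => π) = I
  generalize ENNReal.ofReal (residual X (mean π T) a.γ z.1 ^ 2) = r
  intro hstep hres
  -- The weight is chosen so that the residual bound uses up exactly the available multiple of the
  -- squared half step.
  have hwc : residualWeight a K * (4 * (1 + 2 * K / (a.ρ * a.μ)) ^ 2)
      = (1 - 3 * a.μ ^ 2) / 2 := by
    unfold residualWeight
    generalize 1 + 2 * K / (a.ρ * a.μ) = C at hC
    field_simp
    ring
  calc J + ENNReal.ofReal (residualWeight a K) * r
      ≤ J + ENNReal.ofReal (residualWeight a K)
        * (ENNReal.ofReal (4 * (1 + 2 * K / (a.ρ * a.μ)) ^ 2) * I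
          + ENNReal.ofReal (132 * K * (1 + ‖z.1 - xs‖ ^ 2) / Real.sqrt S)) := by gcongr
    _ = (J + ENNReal.ofReal ((1 - 3 * a.μ ^ 2) / 2) * I) + ENNReal.ofReal (residualWeight a K)
          * ENNReal.ofReal (132 * K * (1 + ‖z.1 - xs‖ ^ 2) / Real.sqrt S) := by
        rw [mul_add, ← mul_assoc, ← ENNReal.ofReal_mul hw.le, ← add_assoc, hwc]
    _ ≤ _ := add_le_add_left hstep _
    _ = _ := by
        rw [add_assoc]
        congr 1
        rw [← ENNReal.ofReal_mul (by positivity), ← ENNReal.ofReal_mul hw.le,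
          ← ENNReal.ofReal_mul (by unfold errorConst; positivity),
          ← ENNReal.ofReal_add (by positivity) (by positivity)]
        congr 1
        unfold errorConst
        ring

end OracleMoments

/-! ### From the assumptions to the oracle bounds -/

/-- The fourth moment bound of the oracle, in terms of the data of the problem. -/
def momentConst (Λ σ R : ℝ) : ℝ := 8 * ((1 + |σ|) + 4 * (1 + |Λ|) * (1 + R ^ 2) ^ 2)

/-- As 2p, 2q ≥ 4, one has L⁴ ≤ L^(2p) from L ≥ 1, and ‖T‖⁴ ≤ 1 + ‖T‖^(2q). The Lipschitz condition
carries the bound from xc to every x, and ‖xc - xs‖ ≤ R recentres it at xs. -/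
theorem LipschitzMoments.oracleMoments {n : ℕ} {Ω Ξ : Type*} [MeasurableSpace Ω]
    [MeasurableSpace Ξ] {P : Measure Ω} [IsProbabilityMeasure P] {T : Ξ → Vec n → Vec n} {ξ : Ω → Ξ}
    {L : Ξ → ℝ} {xc xs : Vec n} {p q Λ σ R : ℝ} (h : LipschitzMoments P T ξ L xc p q Λ σ)
    (hp : 2 ≤ p) (hq : 2 ≤ q) (hT : Measurable fun z : Ξ × Vec n => T z.1 z.2) (hξ : Measurable ξ)
    (hR : ‖xc - xs‖ ≤ R) : OracleMoments (P.map ξ) T L xs (momentConst Λ σ R) := by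
  have : IsProbabilityMeasure (P.map ξ) := Measure.isProbabilityMeasure_map hξ.aemeasurable
  set π := P.map ξ
  have hL := h.measurable_L
  have hTx : ∀ x, Measurable (T · x) := fun x => measurable_apply_comp hT measurable_const
  have iL : Integrable (fun s => L s ^ (2 * p)) π :=
    (integrable_map_measure (hL.pow_const _).aestronglyMeasurable hξ.aemeasurable).2 h.integrable_L
  have mL : ∫ s, L s ^ (2 * p) ∂π ≤ Λ := by
    rw [integral_map hξ.aemeasurable (hL.pow_const _).aestronglyMeasurable]
    exact h.moment_L
  have iT : Integrable (fun s => ‖T s xc‖ ^ (2 * q)) π :=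
    (integrable_map_measure ((hTx xc).norm.pow_const _).aestronglyMeasurable
      hξ.aemeasurable).2 h.integrable_T
  have mT : ∫ s, ‖T s xc‖ ^ (2 * q) ∂π ≤ σ := by
    rw [integral_map hξ.aemeasurable ((hTx xc).norm.pow_const _).aestronglyMeasurable]
    exact h.moment_T
  have bL : ∀ᵐ s ∂π, ‖L s‖ ^ 4 ≤ L s ^ (2 * p) := by
    filter_upwards [h.one_le_L] with s hs
    rw [Real.norm_of_nonneg (by linarith), ← Real.rpow_natCast]
    exact Real.rpow_le_rpow_of_exponent_le hs (by push_cast; linarith)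
  have bT : ∀ s, ‖T s xc‖ ^ 4 ≤ 1 + ‖T s xc‖ ^ (2 * q) := fun s => by
    have h0 := norm_nonneg (T s xc)
    rcases le_total ‖T s xc‖ 1 with h1 | h1
    · have := pow_le_one₀ h0 h1 (n := 4)
      have := Real.rpow_nonneg h0 (2 * q)
      linarith
    · rw [← Real.rpow_natCast]
      refine (Real.rpow_le_rpow_of_exponent_le h1 ?_).trans (le_add_of_nonneg_left zero_le_one)
      push_cast; linarith
  have iL4 : Integrable (fun s => ‖L s‖ ^ 4) π := by
    refine iL.mono' (hL.norm.pow_const 4).aestronglyMeasurable ?_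
    filter_upwards [bL] with s hs
    rwa [Real.norm_of_nonneg (by positivity)]
  have mL4 : ∫ s, ‖L s‖ ^ 4 ∂π ≤ 1 + |Λ| := by
    have := (integral_mono_ae iL4 iL bL).trans mL
    have := le_abs_self Λ
    linarith
  have iT4 : Integrable (fun s => ‖T s xc‖ ^ 4) π := by
    refine ((integrable_const (1 : ℝ)).add iT).mono'
      ((hTx xc).norm.pow_const 4).aestronglyMeasurable (.of_forall fun s => ?_)
    rw [Real.norm_of_nonneg (by positivity)]
    exact bT s
  have mT4 : ∫ s, ‖T s xc‖ ^ 4 ∂π ≤ 1 + |σ| := by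
    refine (integral_mono (g := fun s => 1 + ‖T s xc‖ ^ (2 * q)) iT4
      ((integrable_const (1 : ℝ)).add iT) bT).trans ?_
    rw [integral_add (integrable_const (1 : ℝ)) iT]
    simp only [integral_const, probReal_univ, one_smul]
    have := le_abs_self σ
    linarith
  have bx : ∀ x, ∀ᵐ s ∂π, ‖T s x‖ ^ 4 ≤ 8 * (‖T s xc‖ ^ 4 + ‖L s‖ ^ 4 * ‖x - xc‖ ^ 4) := fun x => by
    filter_upwards [h.one_le_L, h.lipschitz] with s h1 h2
    have h3 := h2 xc x
    have h4 := OracleMoments.norm_sub_pow_four_le (T s xc) (T s xc - T s x)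
    rw [sub_sub_cancel] at h4
    refine h4.trans ?_
    rw [← mul_pow, Real.norm_of_nonneg (by linarith), norm_sub_rev x xc]
    gcongr
  have ix : ∀ x, Integrable (fun s => 8 * (‖T s xc‖ ^ 4 + ‖L s‖ ^ 4 * ‖x - xc‖ ^ 4)) π := fun x =>
    (iT4.add (iL4.mul_const _)).const_mul 8
  have iT4x : ∀ x, Integrable (fun s => ‖T s x‖ ^ 4) π := fun x => by
    refine (ix x).mono' ((hTx x).norm.pow_const 4).aestronglyMeasurable ?_
    filter_upwards [bx x] with s hs
    rwa [Real.norm_of_nonneg (by positivity)]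
  have hΛ := abs_nonneg Λ
  have hσ := abs_nonneg σ
  have hR2 : 1 ≤ (1 + R ^ 2) ^ 2 := one_le_pow₀ (by have := sq_nonneg R; linarith)
  have hΛR : 1 + |Λ| ≤ (1 + |Λ|) * (1 + R ^ 2) ^ 2 := le_mul_of_one_le_right (by positivity) hR2
  refine ⟨?_, hT, hL, h.one_le_L, h.lipschitz, iL4, mL4.trans ?_, iT4x, fun x => ?_⟩
  · unfold momentConst; linarith
  · unfold momentConst; linarith
  · refine (integral_mono_ae (iT4x x) (ix x) (bx x)).trans ?_
    rw [integral_const_mul, integral_add iT4 (iL4.mul_const _), integral_mul_const]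
    set g := 1 + ‖x - xs‖ ^ 2
    have hg1 : 1 ≤ g := by have := sq_nonneg ‖x - xs‖; simp only [g]; linarith
    have hd : ‖x - xc‖ ^ 4 ≤ 4 * (1 + R ^ 2) ^ 2 * g ^ 2 := by
      have h1 : ‖x - xc‖ ≤ ‖x - xs‖ + R := by
        have e : x - xc = (x - xs) - (xc - xs) := by abel
        rw [e]
        exact (norm_sub_le _ _).trans (by gcongr)
      have h2 : ‖x - xc‖ ^ 2 ≤ 2 * ((1 + R ^ 2) * g) := by
        refine (pow_le_pow_left₀ (norm_nonneg _) h1 2).trans ?_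
        simp only [g]
        nlinarith [sq_nonneg (‖x - xs‖ - R), mul_nonneg (sq_nonneg R) (sq_nonneg ‖x - xs‖)]
      calc ‖x - xc‖ ^ 4 = (‖x - xc‖ ^ 2) ^ 2 := by ring
        _ ≤ (2 * ((1 + R ^ 2) * g)) ^ 2 := pow_le_pow_left₀ (by positivity) h2 2
        _ = _ := by ring
    calc _ ≤ 8 * ((1 + |σ|) * g ^ 2 + (1 + |Λ|) * (4 * (1 + R ^ 2) ^ 2 * g ^ 2)) := by
          gcongr
          exact mT4.trans (le_mul_of_one_le_right (by positivity) (one_le_pow₀ hg1))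
      _ = _ := by unfold momentConst; ring

theorem meanOp_eq_mean {n : ℕ} {Ω Ξ : Type*} [MeasurableSpace Ω]
    [MeasurableSpace Ξ] {P : Measure Ω} {T : Ξ → Vec n → Vec n} {ξ : Ω → Ξ}
    (hT : Measurable fun z : Ξ × Vec n => T z.1 z.2) (hξ : Measurable ξ) :
    meanOp P T ξ = OracleMoments.mean (P.map ξ) T := by
  funext x
  exact (integral_map hξ.aemeasurable
    (measurable_apply_comp hT measurable_const).aestronglyMeasurable).symm

/-! ### Independence of the state and the fresh samples -/

section Sampling

variable {n : ℕ} {Ω Ξ : Type*} [MeasurableSpace Ω] [MeasurableSpace Ξ] {P : Measure Ω}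
  [IsProbabilityMeasure P] {ξ : Ω → Ξ} {S : ℕ → ℕ} {ξs ηs : (k : ℕ) → Fin (S k) → Ω → Ξ}
  {a : Params} {X : Set (Vec n)} {T : Ξ → Vec n → Vec n} {x₀ : Vec n}

/-- The family of all samples. -/
def allSamples (ξs ηs : (k : ℕ) → Fin (S k) → Ω → Ξ) :
    ((k : ℕ) × Fin (S k)) ⊕ ((k : ℕ) × Fin (S k)) → Ω → Ξ :=
  Sum.elim (fun i => ξs i.1 i.2) (fun i => ηs i.1 i.2)

/-- The σ-algebra generated by the samples in a set of indices. -/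
abbrev samplesUpTo (ξs ηs : (k : ℕ) → Fin (S k) → Ω → Ξ)
    (s : Set (((k : ℕ) × Fin (S k)) ⊕ ((k : ℕ) × Fin (S k)))) : MeasurableSpace Ω :=
  ⨆ i ∈ s, MeasurableSpace.comap (allSamples ξs ηs i) inferInstance

omit [MeasurableSpace Ω] in
theorem measurable_samples {m : MeasurableSpace Ω} {N : ℕ} {Y : Fin N → Ω → Ξ}
    (hY : ∀ j, Measurable (Y j)) : Measurable fun ω j => Y j ω :=
  measurable_pi_lambda _ hY

omit [MeasurableSpace Ω] in
theorem measurable_allSamples (s : Set (((k : ℕ) × Fin (S k)) ⊕ ((k : ℕ) × Fin (S k))))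
    {i : ((k : ℕ) × Fin (S k)) ⊕ ((k : ℕ) × Fin (S k))} (hi : i ∈ s) :
    Measurable[samplesUpTo ξs ηs s] (allSamples ξs ηs i) :=
  (comap_measurable _).mono (le_biSup (fun i => MeasurableSpace.comap (allSamples ξs ηs i) _) hi)
    le_rfl

omit [IsProbabilityMeasure P] in
theorem IsSampling.indep_samplesUpTo (h : IsSampling P ξ ξs ηs)
    {s t : Set (((k : ℕ) × Fin (S k)) ⊕ ((k : ℕ) × Fin (S k)))} (hst : Disjoint s t) :
    Indep (samplesUpTo ξs ηs s) (samplesUpTo ξs ηs t) P := by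
  refine indep_iSup_of_disjoint (fun i => ?_) h.indep hst
  rcases i with i | i
  · exact (h.measurable_ξs i.1 i.2).comap_le
  · exact (h.measurable_ηs i.1 i.2).comap_le

theorem IsSampling.map_ξs (h : IsSampling P ξ ξs ηs) (k : ℕ) :
    P.map (fun ω j => ξs k j ω) = Measure.pi fun _ : Fin (S k) => P.map ξ := by
  have hi : iIndepFun (fun j => ξs k j) P :=
    iIndepFun.precomp (g := fun j : Fin (S k) =>
      (Sum.inl ⟨k, j⟩ : ((k : ℕ) × Fin (S k)) ⊕ ((k : ℕ) × Fin (S k))))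
      (Sum.inl_injective.comp sigma_mk_injective) h.indep
  rw [(iIndepFun_iff_map_fun_eq_pi_map fun j => (h.measurable_ξs k j).aemeasurable).1 hi]
  congr 1
  funext j
  exact (h.law_ξs k j).map_eq

theorem IsSampling.map_ηs (h : IsSampling P ξ ξs ηs) (k : ℕ) :
    P.map (fun ω j => ηs k j ω) = Measure.pi fun _ : Fin (S k) => P.map ξ := by
  have hi : iIndepFun (fun j => ηs k j) P :=
    iIndepFun.precomp (g := fun j : Fin (S k) =>
      (Sum.inr ⟨k, j⟩ : ((k : ℕ) × Fin (S k)) ⊕ ((k : ℕ) × Fin (S k))))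
      (Sum.inr_injective.comp sigma_mk_injective) h.indep
  rw [(iIndepFun_iff_map_fun_eq_pi_map fun j => (h.measurable_ηs k j).aemeasurable).1 hi]
  congr 1
  funext j
  exact (h.law_ηs k j).map_eq

theorem measurable_step_samples (hP : Measurable (proj X))
    (hT : Measurable fun z : Ξ × Vec n => T z.1 z.2) (N : ℕ) :
    Measurable fun q : (Vec n × ℕ) × ((Fin N → Ξ) × (Fin N → Ξ)) =>
      step a X (empOp T q.2.1) (empOp T q.2.2) q.1 := by
  have hE := OracleMoments.measurable_empOp (S := N) hT
  refine measurable_step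
    (A := fun q : (Vec n × ℕ) × ((Fin N → Ξ) × (Fin N → Ξ)) => empOp T q.2.1)
    (B := fun q : (Vec n × ℕ) × ((Fin N → Ξ) × (Fin N → Ξ)) => empOp T q.2.2) hP ?_ ?_
    measurable_fst
  · exact Measurable.comp (g := fun q : (Fin N → Ξ) × Vec n => empOp T q.1 q.2)
      (f := fun q : ((Vec n × ℕ) × ((Fin N → Ξ) × (Fin N → Ξ))) × Vec n => (q.1.2.1, q.2))
      hE (by fun_prop)
  · exact Measurable.comp (g := fun q : (Fin N → Ξ) × Vec n => empOp T q.1 q.2)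
      (f := fun q : ((Vec n × ℕ) × ((Fin N → Ξ) × (Fin N → Ξ))) × Vec n => (q.1.2.2, q.2))
      hE (by fun_prop)

omit [MeasurableSpace Ω] in
/-- The state after `k` iterations depends only on the samples of these iterations. -/
theorem measurable_run_samplesUpTo (hP : Measurable (proj X))
    (hT : Measurable fun z : Ξ × Vec n => T z.1 z.2) (k : ℕ) :
    Measurable[samplesUpTo ξs ηs {i | Sum.elim Sigma.fst Sigma.fst i < k}]
      fun ω => run a X T ξs ηs x₀ ω k := by
  induction k with
  | zero => exact measurable_const
  | succ k ih =>
    have hmono : samplesUpTo ξs ηs {i | Sum.elim Sigma.fst Sigma.fst i < k}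
        ≤ samplesUpTo ξs ηs {i | Sum.elim Sigma.fst Sigma.fst i < k + 1} :=
      biSup_mono fun i (hi : _ < k) => Nat.lt_succ_of_lt hi
    have h1 : Measurable[samplesUpTo ξs ηs {i | Sum.elim Sigma.fst Sigma.fst i < k + 1}]
        fun ω j => ξs k j ω :=
      measurable_samples fun j => measurable_allSamples _ (i := Sum.inl ⟨k, j⟩)
        (Nat.lt_succ_self k)
    have h2 : Measurable[samplesUpTo ξs ηs {i | Sum.elim Sigma.fst Sigma.fst i < k + 1}]
        fun ω j => ηs k j ω :=
      measurable_samples fun j => measurable_allSamples _ (i := Sum.inr ⟨k, j⟩)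
        (Nat.lt_succ_self k)
    exact Measurable.comp (f := fun ω => (run a X T ξs ηs x₀ ω k,
      ((fun j => ξs k j ω), (fun j => ηs k j ω)))) (measurable_step_samples hP hT (S k))
      ((ih.mono hmono le_rfl).prodMk (h1.prodMk h2))

omit [IsProbabilityMeasure P] in
theorem IsSampling.measurable_run (h : IsSampling P ξ ξs ηs) (hP : Measurable (proj X))
    (hT : Measurable fun z : Ξ × Vec n => T z.1 z.2) (k : ℕ) :
    Measurable fun ω => run a X T ξs ηs x₀ ω k := by
  refine (measurable_run_samplesUpTo hP hT k).mono (iSup₂_le fun i _ => ?_) le_rfl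
  rcases i with i | i
  · exact (h.measurable_ξs i.1 i.2).comap_le
  · exact (h.measurable_ηs i.1 i.2).comap_le

/-- The state and the samples of the next iteration are independent. -/
theorem IsSampling.map_run_samples (h : IsSampling P ξ ξs ηs) (hP : Measurable (proj X))
    (hT : Measurable fun z : Ξ × Vec n => T z.1 z.2) (k : ℕ) :
    P.map (fun ω => (run a X T ξs ηs x₀ ω k, ((fun j => ξs k j ω), (fun j => ηs k j ω))))
      = (P.map fun ω => run a X T ξs ηs x₀ ω k).prod
        ((Measure.pi fun _ : Fin (S k) => P.map ξ).prod
          (Measure.pi fun _ : Fin (S k) => P.map ξ)) := by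
  have m1 : Measurable fun ω j => ξs k j ω := measurable_samples fun j => h.measurable_ξs k j
  have m2 : Measurable fun ω j => ηs k j ω := measurable_samples fun j => h.measurable_ηs k j
  have i1 : IndepFun (fun ω j => ξs k j ω) (fun ω j => ηs k j ω) P := by
    refine indep_of_indep_of_le_left (indep_of_indep_of_le_right (h.indep_samplesUpTo
      (s := Set.range Sum.inl) (t := Set.range Sum.inr) ?_) ?_) ?_
    · exact Set.isCompl_range_inl_range_inr.disjoint
    · exact Measurable.comap_le (measurable_samples fun j =>
        measurable_allSamples _ (i := Sum.inr ⟨k, j⟩) ⟨_, rfl⟩)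
    · exact Measurable.comap_le (measurable_samples fun j =>
        measurable_allSamples _ (i := Sum.inl ⟨k, j⟩) ⟨_, rfl⟩)
  have i2 : IndepFun (fun ω => run a X T ξs ηs x₀ ω k)
      (fun ω => ((fun j => ξs k j ω), (fun j => ηs k j ω))) P := by
    -- The state uses samples with first index below k, the next iteration those with first index k.
    refine indep_of_indep_of_le_left (indep_of_indep_of_le_right (h.indep_samplesUpTo
      (s := {i | Sum.elim Sigma.fst Sigma.fst i < k})
      (t := {i | Sum.elim Sigma.fst Sigma.fst i = k}) ?_) ?_)
      (measurable_run_samplesUpTo hP hT k).comap_le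
    · exact Set.disjoint_left.2 fun i (hi : _ < k) (hi' : _ = k) => hi.ne hi'
    · refine Measurable.comap_le (Measurable.prodMk ?_ ?_)
      · exact measurable_samples fun j =>
          measurable_allSamples _ (i := Sum.inl ⟨k, j⟩) (Eq.refl k)
      · exact measurable_samples fun j =>
          measurable_allSamples _ (i := Sum.inr ⟨k, j⟩) (Eq.refl k)
  rw [(indepFun_iff_map_prod_eq_prod_map_map (h.measurable_run hP hT k).aemeasurable
    (m1.prodMk m2).aemeasurable).1 i2, (indepFun_iff_map_prod_eq_prod_map_map m1.aemeasurable
    m2.aemeasurable).1 i1, h.map_ξs, h.map_ηs]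

/-- Fubini for the joint product law; it replaces conditioning on the past, since the state is
frozen while the fresh samples are integrated. -/
theorem IsSampling.lintegral_run_succ (h : IsSampling P ξ ξs ηs) (hξ : Measurable ξ)
    (hP : Measurable (proj X))
    (hT : Measurable fun z : Ξ × Vec n => T z.1 z.2) (k : ℕ) {f : Vec n × ℕ → ENNReal}
    (hf : Measurable f) :
    ∫⁻ ω, f (run a X T ξs ηs x₀ ω (k + 1)) ∂P
      = ∫⁻ ω, ∫⁻ s, ∫⁻ s', f (step a X (empOp T s) (empOp T s') (run a X T ξs ηs x₀ ω k))
        ∂(Measure.pi fun _ : Fin (S k) => P.map ξ)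
        ∂(Measure.pi fun _ : Fin (S k) => P.map ξ) ∂P := by
  have : IsProbabilityMeasure (P.map ξ) := Measure.isProbabilityMeasure_map hξ.aemeasurable
  have m1 : Measurable fun ω j => ξs k j ω := measurable_pi_lambda _ fun j => h.measurable_ξs k j
  have m2 : Measurable fun ω j => ηs k j ω := measurable_pi_lambda _ fun j => h.measurable_ηs k j
  have hr := h.measurable_run (a := a) (x₀ := x₀) hP hT k
  set Q := Measure.pi fun _ : Fin (S k) => P.map ξ
  have hg : Measurable fun q : (Vec n × ℕ) × ((Fin (S k) → Ξ) × (Fin (S k) → Ξ)) =>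
      f (step a X (empOp T q.2.1) (empOp T q.2.2) q.1) :=
    hf.comp (measurable_step_samples hP hT (S k))
  calc _ = ∫⁻ q, f (step a X (empOp T q.2.1) (empOp T q.2.2) q.1)
        ∂(P.map fun ω => (run a X T ξs ηs x₀ ω k,
          ((fun j => ξs k j ω), (fun j => ηs k j ω)))) := by
        rw [lintegral_map hg (hr.prodMk (m1.prodMk m2))]
        rfl
    _ = ∫⁻ z, ∫⁻ q, f (step a X (empOp T q.1) (empOp T q.2) z) ∂(Q.prod Q)
        ∂(P.map fun ω => run a X T ξs ηs x₀ ω k) := by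
        rw [h.map_run_samples hP hT k, lintegral_prod _ hg.aemeasurable]
    _ = ∫⁻ ω, ∫⁻ q, f (step a X (empOp T q.1) (empOp T q.2) (run a X T ξs ηs x₀ ω k)) ∂(Q.prod Q)
        ∂P := by
        rw [lintegral_map hg.lintegral_prod_right' hr]
    _ = _ := by
        refine lintegral_congr fun ω => ?_
        exact lintegral_prod _ (hg.comp (measurable_prodMk_left
          (x := run a X T ξs ηs x₀ ω k))).aemeasurable

end Sampling

/-! ### Recursion for the expectations: moment bounds and summed residuals -/

section Recursion

variable {n : ℕ} {Ω Ξ : Type*} [MeasurableSpace Ω] [MeasurableSpace Ξ] {P : Measure Ω}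
  [IsProbabilityMeasure P] {ξ : Ω → Ξ} {S : ℕ → ℕ} {ξs ηs : (k : ℕ) → Fin (S k) → Ω → Ξ}
  {a : Params} {X : Set (Vec n)} {T : Ξ → Vec n → Vec n} {x₀ xs : Vec n} {L : Ξ → ℝ} {K : ℝ}

theorem measurable_lyapunov : Measurable (lyapunov a xs) := by
  have : Measurable fun s : Vec n × ℕ => andersonTail a.τ s.2 :=
    (measurable_of_countable (andersonTail a.τ)).comp measurable_snd
  exact ((measurable_fst.sub_const xs).norm.pow_const 2).add (this.const_mul _)

theorem lyapunov_ge (ha : a.Admissible) (z : Vec n × ℕ) : ‖z.1 - xs‖ ^ 2 ≤ lyapunov a xs z := by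
  have := andersonTail_nonneg ha.τ_gt z.2
  have := ha.M_pos
  exact le_add_of_nonneg_right (by positivity)

/-- The expected decrease of the Lyapunov function along the iteration. -/
theorem IsSampling.lintegral_lyapunov_run_succ_le (h : IsSampling P ξ ξs ηs)
    (hO : OracleMoments (P.map ξ) T L xs K) (hξ : Measurable ξ) (ha : a.Admissible)
    (hc : IsClosed X) (hX : Convex ℝ X) (hH : Pseudomonotone X (OracleMoments.mean (P.map ξ) T))
    (hxs : xs ∈ SOL X (OracleMoments.mean (P.map ξ) T)) (hS : ∀ k, S k ≠ 0) (k : ℕ) :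
    ∫⁻ ω, ENNReal.ofReal (lyapunov a xs (run a X T ξs ηs x₀ ω (k + 1))) ∂P
      + ENNReal.ofReal (residualWeight a K) * ∫⁻ ω, ENNReal.ofReal
        (residual X (OracleMoments.mean (P.map ξ) T) a.γ (iterate a X T ξs ηs x₀ k ω) ^ 2) ∂P
      ≤ ∫⁻ ω, ENNReal.ofReal (lyapunov a xs (run a X T ξs ηs x₀ ω k)) ∂P
        + ENNReal.ofReal (errorConst a K / Real.sqrt (S k))
          * ∫⁻ ω, ENNReal.ofReal (1 + ‖iterate a X T ξs ηs x₀ k ω - xs‖ ^ 2) ∂P := by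
  have : IsProbabilityMeasure (P.map ξ) := Measure.isProbabilityMeasure_map hξ.aemeasurable
  have hP : Measurable (proj X) := (continuous_proj ⟨xs, hxs.1⟩ hc hX).measurable
  have hr := h.measurable_run (a := a) (x₀ := x₀) hP hO.measurable_T k
  have hx : Measurable fun ω => iterate a X T ξs ηs x₀ k ω := measurable_fst.comp hr
  have hm := hO.continuous_mean.measurable
  have hres : Measurable fun ω => ENNReal.ofReal
      (residual X (OracleMoments.mean (P.map ξ) T) a.γ (iterate a X T ξs ηs x₀ k ω) ^ 2) :=
    (((hP.comp (hx.sub ((hm.comp hx).const_smul a.γ))).sub hx).norm.pow_const 2).ennreal_ofReal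
  have hd : Measurable fun ω => ENNReal.ofReal (1 + ‖iterate a X T ξs ηs x₀ k ω - xs‖ ^ 2) :=
    (((hx.sub_const xs).norm.pow_const 2).const_add 1).ennreal_ofReal
  rw [h.lintegral_run_succ hξ hP hO.measurable_T k
    (f := fun z => ENNReal.ofReal (lyapunov a xs z)) measurable_lyapunov.ennreal_ofReal,
    ← lintegral_const_mul _ hres, ← lintegral_const_mul _ hd,
    ← lintegral_add_right _ (hres.const_mul _), ← lintegral_add_right _ (hd.const_mul _)]
  exact lintegral_mono fun ω =>
    hO.lintegral_lyapunov_step_le ha hc hX hH hxs (hS k) (run a X T ξs ηs x₀ ω k)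

omit [MeasurableSpace Ξ] in
theorem OracleMoments.errorConst_nonneg [MeasurableSpace Ξ] {π : Measure Ξ}
    (h : OracleMoments π T L xs K) (ha : a.Admissible) : 0 ≤ errorConst a K := by
  have := h.residualWeight_pos ha
  have := h.one_le
  have : 0 < 1 - a.ρ := by linarith [ha.ρ_lt_one]
  have := ha.M_pos
  unfold errorConst
  positivity

/-- Moment bounds for the iterates, and the summed squared residuals. -/
theorem IsSampling.iterate_bounds (h : IsSampling P ξ ξs ηs)
    (hO : OracleMoments (P.map ξ) T L xs K) (hξ : Measurable ξ) (ha : a.Admissible)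
    (hc : IsClosed X) (hX : Convex ℝ X) (hH : Pseudomonotone X (OracleMoments.mean (P.map ξ) T))
    (hxs : xs ∈ SOL X (OracleMoments.mean (P.map ξ) T)) (hS : ∀ k, S k ≠ 0) :
    (∀ k, Integrable (fun ω => ‖iterate a X T ξs ηs x₀ k ω - xs‖ ^ 2) P
      ∧ 1 + ∫ ω, ‖iterate a X T ξs ηs x₀ k ω - xs‖ ^ 2 ∂P ≤ (1 + lyapunov a xs (x₀, 1))
        * Real.exp (errorConst a K * ∑ j ∈ Finset.range k, 1 / Real.sqrt (S j)))
    ∧ (∀ k, Integrable (fun ω => residual X (OracleMoments.mean (P.map ξ) T) a.γ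
        (iterate a X T ξs ηs x₀ k ω) ^ 2) P)
    ∧ ∀ m, residualWeight a K * ∑ k ∈ Finset.range m, ∫ ω, residual X
        (OracleMoments.mean (P.map ξ) T) a.γ (iterate a X T ξs ηs x₀ k ω) ^ 2 ∂P
      ≤ lyapunov a xs (x₀, 1) + errorConst a K * ∑ k ∈ Finset.range m, 1 / Real.sqrt (S k)
        * (1 + ∫ ω, ‖iterate a X T ξs ηs x₀ k ω - xs‖ ^ 2 ∂P) := by
  have : IsProbabilityMeasure (P.map ξ) := Measure.isProbabilityMeasure_map hξ.aemeasurable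
  have hP : Measurable (proj X) := (continuous_proj ⟨xs, hxs.1⟩ hc hX).measurable
  have hr := fun k => h.measurable_run (a := a) (x₀ := x₀) hP hO.measurable_T k
  have hx : ∀ k, Measurable fun ω => iterate a X T ξs ηs x₀ k ω := fun k =>
    measurable_fst.comp (hr k)
  have hm := hO.continuous_mean.measurable
  have hc0 := hO.errorConst_nonneg ha
  have hw0 := hO.residualWeight_pos ha
  have hl0 : ∀ z : Vec n × ℕ, 0 ≤ lyapunov a xs z := fun z => (sq_nonneg _).trans (lyapunov_ge ha z)
  set c := errorConst a K
  set w := residualWeight a K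
  set u : ℕ → ENNReal := fun k =>
    ∫⁻ ω, ENNReal.ofReal (lyapunov a xs (run a X T ξs ηs x₀ ω k)) ∂P with hu
  set f : ℕ → Ω → ℝ := fun k ω =>
    residual X (OracleMoments.mean (P.map ξ) T) a.γ (iterate a X T ξs ηs x₀ k ω) ^ 2 with hfdef
  set d : ℕ → Ω → ℝ := fun k ω => ‖iterate a X T ξs ηs x₀ k ω - xs‖ ^ 2 with hddef
  have hfm : ∀ k, Measurable (f k) := fun k =>
    ((hP.comp ((hx k).sub ((hm.comp (hx k)).const_smul a.γ))).sub (hx k)).norm.pow_const 2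
  have hdm : ∀ k, Measurable (d k) := fun k => ((hx k).sub_const xs).norm.pow_const 2
  have hf0 : ∀ k ω, 0 ≤ f k ω := fun k ω => sq_nonneg _
  have hd0 : ∀ k ω, 0 ≤ d k ω := fun k ω => sq_nonneg _
  have hrec : ∀ k, u (k + 1) + ENNReal.ofReal w * ∫⁻ ω, ENNReal.ofReal (f k ω) ∂P
      ≤ u k + ENNReal.ofReal (c / Real.sqrt (S k)) * ∫⁻ ω, ENNReal.ofReal (1 + d k ω) ∂P :=
    h.lintegral_lyapunov_run_succ_le hO hξ ha hc hX hH hxs hS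
  have hu0 : u 0 = ENNReal.ofReal (lyapunov a xs (x₀, 1)) := by
    simp only [hu, run, lintegral_const, measure_univ, mul_one]
  have hdu : ∀ k, ∫⁻ ω, ENNReal.ofReal (1 + d k ω) ∂P ≤ 1 + u k := fun k => by
    calc _ ≤ ∫⁻ ω, (1 + ENNReal.ofReal (lyapunov a xs (run a X T ξs ηs x₀ ω k))) ∂P := by
          refine lintegral_mono fun ω => ?_
          rw [ENNReal.ofReal_add zero_le_one (hd0 k ω), ENNReal.ofReal_one]
          exact add_le_add_right (ENNReal.ofReal_le_ofReal (lyapunov_ge ha _)) _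
      _ = 1 + u k := by
          rw [lintegral_add_left measurable_const, lintegral_const, measure_univ, mul_one]
  -- The recursion propagates finiteness, because the error is itself bounded by the Lyapunov
  -- function. From here on real integrals can be used.
  have hfin : ∀ k, u k ≠ ⊤ := fun k => by
    induction k with
    | zero => rw [hu0]; exact ENNReal.ofReal_ne_top
    | succ k ih =>
      refine ne_top_of_le_ne_top ?_ (le_self_add.trans (hrec k))
      exact ENNReal.add_ne_top.2 ⟨ih, ENNReal.mul_ne_top ENNReal.ofReal_ne_top
        (ne_top_of_le_ne_top (ENNReal.add_ne_top.2 ⟨ENNReal.one_ne_top, ih⟩) (hdu k))⟩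
  have hdfin : ∀ k, ∫⁻ ω, ENNReal.ofReal (1 + d k ω) ∂P ≠ ⊤ := fun k =>
    ne_top_of_le_ne_top (ENNReal.add_ne_top.2 ⟨ENNReal.one_ne_top, hfin k⟩) (hdu k)
  have hd1 : ∀ k, Integrable (fun ω => 1 + d k ω) P := fun k =>
    (lintegral_ofReal_ne_top_iff_integrable ((hdm k).const_add 1).aestronglyMeasurable
      (.of_forall fun ω => by have := hd0 k ω; simp only [Pi.zero_apply]; linarith)).1 (hdfin k)
  have hdi : ∀ k, Integrable (d k) P := fun k => by
    have := (hd1 k).sub (integrable_const (1 : ℝ))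
    refine this.congr (.of_forall fun ω => ?_)
    simp
  have hffin : ∀ k, ∫⁻ ω, ENNReal.ofReal (f k ω) ∂P ≠ ⊤ := fun k hk => by
    have h1 : ENNReal.ofReal w * ∫⁻ ω, ENNReal.ofReal (f k ω) ∂P ≠ ⊤ :=
      ne_top_of_le_ne_top (ENNReal.add_ne_top.2 ⟨hfin k, ENNReal.mul_ne_top ENNReal.ofReal_ne_top
        (hdfin k)⟩) (le_add_self.trans (hrec k))
    rw [hk] at h1
    exact h1 (ENNReal.mul_top (ENNReal.ofReal_pos.2 hw0).ne')
  have hfi : ∀ k, Integrable (f k) P := fun k =>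
    (lintegral_ofReal_ne_top_iff_integrable (hfm k).aestronglyMeasurable
      (.of_forall (hf0 k))).1 (hffin k)
  set U : ℕ → ℝ := fun k => (u k).toReal with hU
  have hU0 : ∀ k, 0 ≤ U k := fun k => ENNReal.toReal_nonneg
  have hUu : ∀ k, u k = ENNReal.ofReal (U k) := fun k => (ENNReal.ofReal_toReal (hfin k)).symm
  have hde : ∀ k, ∫⁻ ω, ENNReal.ofReal (1 + d k ω) ∂P = ENNReal.ofReal (1 + ∫ ω, d k ω ∂P) :=
    fun k => by
      rw [← ofReal_integral_eq_lintegral_ofReal (hd1 k)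
        (.of_forall fun ω => by have := hd0 k ω; simp only [Pi.zero_apply]; linarith),
        integral_add (integrable_const _) (hdi k)]
      simp
  have hfe : ∀ k, ∫⁻ ω, ENNReal.ofReal (f k ω) ∂P = ENNReal.ofReal (∫ ω, f k ω ∂P) := fun k =>
    (ofReal_integral_eq_lintegral_ofReal (hfi k) (.of_forall (hf0 k))).symm
  have hD0 : ∀ k, 0 ≤ ∫ ω, d k ω ∂P := fun k => integral_nonneg (hd0 k)
  have hF0 : ∀ k, 0 ≤ ∫ ω, f k ω ∂P := fun k => integral_nonneg (hf0 k)
  have hDU : ∀ k, 1 + ∫ ω, d k ω ∂P ≤ 1 + U k := fun k => by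
    have := hdu k
    rw [hde, hUu, ← ENNReal.ofReal_one, ← ENNReal.ofReal_add zero_le_one (hU0 k)] at this
    exact (ENNReal.ofReal_le_ofReal_iff (by have := hU0 k; linarith)).1 this
  have hREC : ∀ k, U (k + 1) + w * ∫ ω, f k ω ∂P
      ≤ U k + c / Real.sqrt (S k) * (1 + ∫ ω, d k ω ∂P) := fun k => by
    have h1 := hrec k
    have h2 := hU0 k
    have h3 := hD0 k
    have h4 : 0 ≤ c / Real.sqrt (S k) := by positivity
    rw [hde, hfe, hUu, hUu, ← ENNReal.ofReal_mul hw0.le, ← ENNReal.ofReal_mul h4,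
      ← ENNReal.ofReal_add (hU0 _) (mul_nonneg hw0.le (hF0 k)),
      ← ENNReal.ofReal_add h2 (by positivity)] at h1
    exact (ENNReal.ofReal_le_ofReal_iff (by positivity)).1 h1
  have hUz : U 0 = lyapunov a xs (x₀, 1) := by
    simp only [hU]
    rw [hu0, ENNReal.toReal_ofReal (hl0 _)]
  refine ⟨fun k => ⟨hdi k, (hDU k).trans ?_⟩, hfi, fun m => ?_⟩
  -- Discrete Gronwall: 1 + U (k + 1) ≤ (1 + U k)(1 + c/√S_k), and 1 + s ≤ exp s.
  · rw [← hUz]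
    induction k with
    | zero => simp
    | succ k ih =>
      have h1 := hREC k
      have h2 := mul_nonneg hw0.le (hF0 k)
      have h4 : 0 ≤ c / Real.sqrt (S k) := by positivity
      have h3 := mul_le_mul_of_nonneg_left (hDU k) h4
      rw [Finset.sum_range_succ, mul_add, Real.exp_add, ← mul_assoc]
      have h5 : 1 + U (k + 1) ≤ (1 + U k) * (1 + c / Real.sqrt (S k)) := by linarith
      refine h5.trans (mul_le_mul ih ?_ (by positivity)
        (mul_nonneg (by have := hU0 0; linarith) (Real.exp_pos _).le))
      rw [mul_one_div, add_comm]
      exact Real.add_one_le_exp _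
  · rw [← hUz]
    -- The nonnegative term U m is kept so that the sum telescopes by induction.
    suffices hs : U m + w * ∑ k ∈ Finset.range m, ∫ ω, f k ω ∂P
        ≤ U 0 + c * ∑ k ∈ Finset.range m, 1 / Real.sqrt (S k) * (1 + ∫ ω, d k ω ∂P) by
      have := hU0 m
      linarith
    induction m with
    | zero => simp
    | succ k ih =>
      have h1 := hREC k
      rw [Finset.sum_range_succ, Finset.sum_range_succ, mul_add, mul_add]
      have e : c * (1 / Real.sqrt (S k) * (1 + ∫ ω, d k ω ∂P))
        = c / Real.sqrt (S k) * (1 + ∫ ω, d k ω ∂P) := by ring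
      rw [e]
      linarith

end Recursion

/-! ### Sums of the sample rates and of their inverse square roots -/

section SampleRate

theorem half_le_log {x : ℝ} (hx : 2 ≤ x) : 1 / 2 ≤ Real.log x := by
  have h1 := Real.log_le_log (by norm_num) hx
  have h2 := Real.log_two_gt_d9
  linarith

/-- A telescoping form of the integral test for 1/(x ln^(1+b) x), whose antiderivative is
-ln^(-b)(x)/b. It rests on ln(x+1) - ln x ≥ 1/(x+1) and the convexity bound (u/v)^(-b) ≥ 1 + b(1 -
u/v). -/
theorem div_mul_log_rpow_le {b x : ℝ} (hb : 0 < b) (hx : 1 < x) :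
    b * (1 / ((x + 1) * Real.log (x + 1) ^ (1 + b)))
      ≤ Real.log x ^ (-b) - Real.log (x + 1) ^ (-b) := by
  have hu : 0 < Real.log x := Real.log_pos hx
  have hv : 0 < Real.log (x + 1) := Real.log_pos (by linarith)
  set u := Real.log x with hudef
  set v := Real.log (x + 1) with hvdef
  have hvu : 1 / (x + 1) ≤ v - u := by
    have h1 := Real.log_le_sub_one_of_pos (x := x / (x + 1)) (by positivity)
    rw [Real.log_div (by positivity) (by positivity)] at h1
    have h2 : x / (x + 1) - 1 = -(1 / (x + 1)) := by field_simp; ring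
    rw [h2] at h1
    linarith
  have ht : 1 + b * (1 - u / v) ≤ (u / v) ^ (-b) := by
    have h1 := Real.log_le_sub_one_of_pos (x := u / v) (by positivity)
    rw [Real.rpow_def_of_pos (by positivity)]
    have h2 := Real.add_one_le_exp (Real.log (u / v) * -b)
    nlinarith
  rw [Real.div_rpow hu.le hv.le, le_div_iff₀ (by positivity)] at ht
  have hvb : 0 < v ^ (-b) := by positivity
  have e1 : v ^ (1 + b) = v * (v ^ (-b))⁻¹ := by
    rw [Real.rpow_add hv, Real.rpow_one, Real.rpow_neg hv.le, inv_inv]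
  calc b * (1 / ((x + 1) * v ^ (1 + b))) = b * v ^ (-b) / v * (1 / (x + 1)) := by
        rw [e1]; field_simp
    _ ≤ b * v ^ (-b) / v * (v - u) := by gcongr
    _ = (1 + b * (1 - u / v)) * v ^ (-b) - v ^ (-b) := by field_simp; ring
    _ ≤ _ := by linarith

variable {𝒩 : ℕ} {lam b : ℝ}

theorem log_add_pos (hlam : 2 < lam) (k : ℕ) : 1 / 2 ≤ Real.log ((k : ℝ) + lam) :=
  half_le_log (by have : (0 : ℝ) ≤ k := k.cast_nonneg
                  linarith)

theorem sampleRate_ne_zero (h𝒩 : 0 < 𝒩) (hlam : 2 < lam) (k : ℕ) :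
    sampleRate 𝒩 lam b k ≠ 0 := by
  have h1 := log_add_pos hlam k
  have h2 : 0 < (k : ℝ) + lam := by have : (0 : ℝ) ≤ k := k.cast_nonneg
                                    linarith
  have h3 : 0 < ((k : ℝ) + lam) ^ 2 * Real.log ((k : ℝ) + lam) ^ (2 + 2 * b) :=
    mul_pos (by positivity) (Real.rpow_pos_of_pos (by linarith) _)
  exact Nat.mul_ne_zero h𝒩.ne' (Nat.ceil_pos.2 h3).ne'

theorem one_div_sqrt_sampleRate_le (h𝒩 : 0 < 𝒩) (hlam : 2 < lam) (k : ℕ) :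
    1 / Real.sqrt (sampleRate 𝒩 lam b k)
      ≤ 1 / (((k : ℝ) + lam) * Real.log ((k : ℝ) + lam) ^ (1 + b)) := by
  have h1 := log_add_pos hlam k
  have h2 : 0 < (k : ℝ) + lam := by have : (0 : ℝ) ≤ k := k.cast_nonneg
                                    linarith
  have hl : 0 < Real.log ((k : ℝ) + lam) := by linarith
  refine one_div_le_one_div_of_le (by positivity) (Real.le_sqrt_of_sq_le ?_)
  have e : (((k : ℝ) + lam) * Real.log ((k : ℝ) + lam) ^ (1 + b)) ^ 2
      = ((k : ℝ) + lam) ^ 2 * Real.log ((k : ℝ) + lam) ^ (2 + 2 * b) := by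
    rw [mul_pow, ← Real.rpow_natCast (Real.log _ ^ (1 + b)), ← Real.rpow_mul hl.le]
    congr 2
    push_cast; ring
  rw [e, sampleRate]
  push_cast
  refine (Nat.le_ceil _).trans ?_
  exact le_mul_of_one_le_left (Nat.cast_nonneg _) (by exact_mod_cast h𝒩)

/-- The constant in the bound for the sum of the inverse square roots of the sample rates. -/
def rateConst (bmax : ℝ) : ℝ := 2 ^ |bmax| * (1 + |bmax|)

theorem sum_one_div_sqrt_sampleRate_le {bmax : ℝ} (h𝒩 : 0 < 𝒩) (hlam : 2 < lam) (hb : 0 < b)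
    (hbm : b ≤ bmax) (m : ℕ) :
    ∑ k ∈ Finset.range m, 1 / Real.sqrt (sampleRate 𝒩 lam b k) ≤ rateConst bmax * b⁻¹ := by
  have hB : |bmax| = bmax := abs_of_pos (by linarith)
  have hl0 := log_add_pos hlam 0
  rw [Nat.cast_zero, zero_add] at hl0
  have hlb : Real.log lam ^ (-b) ≤ 2 ^ bmax := by
    calc Real.log lam ^ (-b) ≤ (1 / 2 : ℝ) ^ (-b) :=
          Real.rpow_le_rpow_of_nonpos (by norm_num) hl0 (by linarith)
      _ = 2 ^ b := by rw [one_div, Real.inv_rpow (by norm_num), Real.rpow_neg (by norm_num), inv_inv]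
      _ ≤ 2 ^ bmax := Real.rpow_le_rpow_of_exponent_le (by norm_num) hbm
  have hfirst : 1 / (lam * Real.log lam ^ (1 + b)) ≤ 2 ^ bmax := by
    have hl : 0 < Real.log lam := by linarith
    have e : 1 / (lam * Real.log lam ^ (1 + b))
        = (lam * Real.log lam)⁻¹ * Real.log lam ^ (-b) := by
      rw [Real.rpow_add hl, Real.rpow_one, Real.rpow_neg hl.le]
      field_simp
    rw [e]
    have h1 : (lam * Real.log lam)⁻¹ ≤ 1 := inv_le_one_of_one_le₀ (by nlinarith)
    exact (mul_le_of_le_one_left (by positivity) h1).trans hlb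
  have hb' : 0 < b⁻¹ := by positivity
  -- The term k = 0 has no predecessor to telescope with and is bounded separately. It is later
  -- absorbed into b⁻¹ through b ≤ bmax.
  have hsum : ∀ m : ℕ, ∑ k ∈ Finset.range (m + 1),
      1 / (((k : ℝ) + lam) * Real.log ((k : ℝ) + lam) ^ (1 + b))
      ≤ 2 ^ bmax + b⁻¹ * (Real.log lam ^ (-b) - Real.log ((m : ℝ) + lam) ^ (-b)) := fun m => by
    induction m with
    | zero => simpa using hfirst
    | succ m ih =>
      rw [Finset.sum_range_succ]
      have hm : (0 : ℝ) ≤ m := m.cast_nonneg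
      have h1 := div_mul_log_rpow_le (b := b) (x := (m : ℝ) + lam) hb (by linarith)
      have h2 := mul_le_mul_of_nonneg_left h1 hb'.le
      rw [inv_mul_cancel_left₀ hb.ne'] at h2
      have e : ((m + 1 : ℕ) : ℝ) + lam = (m : ℝ) + lam + 1 := by push_cast; ring
      rw [e]
      linarith
  have hpos : ∀ k : ℕ, 0 ≤ 1 / Real.sqrt (sampleRate 𝒩 lam b k) := fun k => by positivity
  calc _ ≤ ∑ k ∈ Finset.range (m + 1), 1 / Real.sqrt (sampleRate 𝒩 lam b k) :=
        Finset.sum_le_sum_of_subset_of_nonneg (Finset.range_mono (Nat.le_succ m))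
          fun k _ _ => hpos k
    _ ≤ _ := Finset.sum_le_sum fun k _ => one_div_sqrt_sampleRate_le h𝒩 hlam k
    _ ≤ _ := hsum m
    _ ≤ 2 ^ bmax + b⁻¹ * 2 ^ bmax := by
        have hl : 0 < Real.log ((m : ℝ) + lam) := by linarith [log_add_pos hlam m]
        have : 0 < Real.log ((m : ℝ) + lam) ^ (-b) := by positivity
        gcongr
        linarith
    _ ≤ rateConst bmax * b⁻¹ := by
        rw [rateConst, hB]
        have h1 : 1 ≤ bmax * b⁻¹ := by
          rw [← div_eq_mul_inv, le_div_iff₀ hb]; linarith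
        have h2 : (0 : ℝ) < 2 ^ bmax := by positivity
        nlinarith

/-- The constants in the bound for the sum of the sample rates. -/
def sizeConst (C lam : ℝ) : ℝ := C + 1 + lam

/-- The constant that absorbs the logarithm of the moment bound. -/
def logConst (C lam bmax : ℝ) : ℝ :=
  (1 + 2 * Real.log (sizeConst C lam) + 2 * (2 + 2 * |bmax|)) ^ (2 + 2 * |bmax|)

/-- The constant in the oracle complexity. -/
def complexityConst (C lam bmax c : ℝ) : ℝ :=
  |c| * (sizeConst C lam * (sizeConst C lam ^ 2 * logConst C lam bmax + 2 ^ (2 + 2 * |bmax|)))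

/-- Since ln v ≤ e v^(1/e), the power e of the logarithm costs a single factor v. This is what turns
(1 + V)³ into (1 + V)⁴. -/
theorem add_log_rpow_le {e q v : ℝ} (he : 1 ≤ e) (hq : 0 ≤ q) (hv : 1 ≤ v) :
    (q + 2 * Real.log v) ^ e ≤ (q + 2 * e) ^ e * v := by
  have he0 : 0 < e := by linarith
  have hlog : 0 ≤ Real.log v := Real.log_nonneg hv
  have h1 := Real.log_le_rpow_div (x := v) (ε := 1 / e) (by linarith) (by positivity)
  rw [div_div_eq_mul_div, div_one] at h1
  have h2 : 1 ≤ v ^ (1 / e) := Real.one_le_rpow hv (by positivity)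
  have h3 : q + 2 * Real.log v ≤ (q + 2 * e) * v ^ (1 / e) := by nlinarith
  refine (Real.rpow_le_rpow (by positivity) h3 he0.le).trans_eq ?_
  rw [Real.mul_rpow (by positivity) (by positivity), ← Real.rpow_mul (by linarith),
    one_div_mul_cancel he0.ne', Real.rpow_one]

/-- The number of oracle calls without line search reductions, in terms of `Z = (b ς)⁻¹` and
`v = 1 + V`. -/
theorem sum_sampleRate_le {bmax c C v Z : ℝ} {n N : ℕ} (h𝒩c : (𝒩 : ℝ) ≤ c * (n : ℝ) ^ 2)
    (hlam : 2 < lam) (hb : 0 < b) (hbm : b ≤ bmax) (hC : 0 < C) (hv : 1 ≤ v) (hZ : 2 ≤ Z)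
    (hN : (N : ℝ) ≤ C * v * Z + 1) :
    ∑ k ∈ Finset.range (N + 1), (sampleRate 𝒩 lam b k : ℝ)
      ≤ complexityConst C lam bmax c * v ^ 4 * Real.log Z ^ (2 + 2 * b) * ((n : ℝ) ^ 2 * Z ^ 3) := by
  have hB : |bmax| = bmax := abs_of_pos (by linarith)
  set D := sizeConst C lam with hD
  have hD3 : 3 ≤ D := by rw [hD, sizeConst]; linarith
  set e := 2 + 2 * |bmax| with he
  have heb : 2 + 2 * b ≤ e := by rw [he, hB]; linarith
  set Y := (N : ℝ) + lam with hY
  have hN0 : (0 : ℝ) ≤ N := N.cast_nonneg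
  have hvZ : 1 ≤ v * Z := by nlinarith
  have hYD : Y ≤ D * (v * Z) := by
    rw [hY, hD, sizeConst]
    nlinarith
  have hlZ := half_le_log hZ
  set z := Real.log Z
  have hlD : 0 ≤ Real.log D := Real.log_nonneg (by linarith)
  have hlv : 0 ≤ Real.log v := Real.log_nonneg hv
  have hlY0 : 1 / 2 ≤ Real.log Y := half_le_log (by linarith)
  -- As z ≥ 1/2, the summands ln D and ln v are at most 2z times themselves, so a factor z can be
  -- taken out.
  have hlY : Real.log Y ≤ z * (1 + 2 * Real.log D + 2 * Real.log v) := by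
    have h1 := Real.log_le_log (by linarith) hYD
    rw [Real.log_mul (by linarith) (by positivity), Real.log_mul (by linarith) (by linarith)] at h1
    change _ ≤ _ + (_ + z) at h1
    nlinarith
  have hpow : Real.log Y ^ (2 + 2 * b) ≤ z ^ (2 + 2 * b) * (logConst C lam bmax * v) := by
    calc Real.log Y ^ (2 + 2 * b)
        ≤ (z * (1 + 2 * Real.log D + 2 * Real.log v)) ^ (2 + 2 * b) :=
          Real.rpow_le_rpow (by linarith) hlY (by positivity)
      _ = z ^ (2 + 2 * b) * (1 + 2 * Real.log D + 2 * Real.log v) ^ (2 + 2 * b) :=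
          Real.mul_rpow (by linarith) (by positivity)
      _ ≤ z ^ (2 + 2 * b) * (1 + 2 * Real.log D + 2 * Real.log v) ^ e := by
          gcongr
          linarith
      _ ≤ _ := by
          gcongr
          exact add_log_rpow_le (by linarith) (by positivity) hv
  -- Absorbs the 1 lost in the ceiling of the sample rate, again because z ≥ 1/2.
  have hone : 1 ≤ 2 ^ e * z ^ (2 + 2 * b) := by
    calc (1 : ℝ) = 2 ^ (2 + 2 * b) * (1 / 2) ^ (2 + 2 * b) := by
          rw [← Real.mul_rpow (by norm_num) (by norm_num)]; norm_num
      _ ≤ _ := by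
          gcongr
          norm_num
  have hG : 0 < logConst C lam bmax := by
    unfold logConst
    rw [← hD]
    positivity
  set G := logConst C lam bmax
  set ζ := z ^ (2 + 2 * b)
  have hζ : 0 < ζ := Real.rpow_pos_of_pos (by linarith) _
  have hterm : ∀ k ∈ Finset.range (N + 1), (sampleRate 𝒩 lam b k : ℝ)
      ≤ |c| * (n : ℝ) ^ 2 * ((D ^ 2 * G + 2 ^ e) * (v ^ 3 * Z ^ 2 * ζ)) := fun k hk => by
    have hkN : (k : ℝ) ≤ N := by exact_mod_cast Nat.lt_succ_iff.1 (Finset.mem_range.1 hk)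
    have hk0 : (0 : ℝ) ≤ k := k.cast_nonneg
    have hlk := log_add_pos hlam k
    have h0 : 0 < Real.log ((k : ℝ) + lam) := by linarith
    have hkY : (k : ℝ) + lam ≤ Y := by rw [hY]; linarith
    have hlkY : Real.log ((k : ℝ) + lam) ≤ Real.log Y := Real.log_le_log (by linarith) hkY
    rw [sampleRate]
    push_cast
    have h𝒩' : (𝒩 : ℝ) ≤ |c| * (n : ℝ) ^ 2 :=
      h𝒩c.trans (mul_le_mul_of_nonneg_right (le_abs_self c) (by positivity))
    refine mul_le_mul h𝒩' ?_ (by positivity) (by positivity)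
    refine (Nat.ceil_lt_add_one (by positivity)).le.trans ?_
    calc ((k : ℝ) + lam) ^ 2 * Real.log ((k : ℝ) + lam) ^ (2 + 2 * b) + 1
        ≤ (D * (v * Z)) ^ 2 * (ζ * (G * v)) + 2 ^ e * ζ := by
          refine add_le_add (mul_le_mul ?_ ?_ (by positivity) (by positivity)) hone
          · exact pow_le_pow_left₀ (by linarith) (hkY.trans hYD) 2
          · exact (Real.rpow_le_rpow h0.le hlkY (by positivity)).trans hpow
      _ = D ^ 2 * G * (v ^ 3 * Z ^ 2 * ζ) + 2 ^ e * ζ := by ring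
      _ ≤ D ^ 2 * G * (v ^ 3 * Z ^ 2 * ζ) + 2 ^ e * (v ^ 3 * Z ^ 2 * ζ) := by
          gcongr
          refine le_mul_of_one_le_left hζ.le ?_
          exact one_le_mul_of_one_le_of_one_le (one_le_pow₀ hv) (one_le_pow₀ (by linarith))
      _ = _ := by ring
  refine (Finset.sum_le_sum hterm).trans ?_
  rw [Finset.sum_const, Finset.card_range, nsmul_eq_mul]
  have hNY : ((N + 1 : ℕ) : ℝ) ≤ D * (v * Z) := by
    push_cast
    linarith
  refine (mul_le_mul_of_nonneg_right hNY (by positivity)).trans_eq ?_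
  unfold complexityConst
  rw [← hD, ← he]
  ring

end SampleRate

end AndersonSEG

end

/-! ### The main theorem -/

open AndersonSEG in
theorem mainTheorem3
    -- what the constants may depend on
    (a : Params) (ha : a.Admissible) (p q : ℝ) (hp : 2 ≤ p) (hq : 2 ≤ q)
    (Λ σ R c bmax lam : ℝ) (hlam : 2 < lam) :
    ∃ (C₁ C₂ : ℝ) (W : ℝ → ℝ), 0 < C₁ ∧ 0 < C₂ ∧
      ∀ (b : ℝ), 0 < b → b ≤ bmax →
      ∀ (n 𝒩 : ℕ), 0 < 𝒩 → (𝒩 : ℝ) ≤ c * (n : ℝ) ^ 2 →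
      -- the stochastic variational inequality
      ∀ (Ω Ξ : Type*) [MeasurableSpace Ω] [MeasurableSpace Ξ] (P : Measure Ω)
        [IsProbabilityMeasure P] (X : Set (Vec n)) (T : Ξ → Vec n → Vec n) (ξ : Ω → Ξ)
        (L : Ξ → ℝ) (xc x₀ xs : Vec n),
      IsClosed X → Convex ℝ X →
      Measurable (fun z : Ξ × Vec n => T z.1 z.2) → Measurable ξ →
      Pseudomonotone X (meanOp P T ξ) →
      LipschitzMoments P T ξ L xc p q Λ σ →
      x₀ ∈ X → xs ∈ SOL X (meanOp P T ξ) → ‖x₀ - xs‖ ≤ R → ‖xc - xs‖ ≤ R →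
      -- the samples
      ∀ (ξs ηs : (k : ℕ) → Fin (sampleRate 𝒩 lam b k) → Ω → Ξ),
      IsSampling P ξ ξs ηs →
      let x : ℕ → Ω → Vec n := iterate a X T ξs ηs x₀
      let r : ℕ → Ω → ℝ := fun k ω => residual X (meanOp P T ξ) a.γ (x k ω)
      let V : ℝ := ⨆ k, ∫ ω, ‖x k ω - xs‖ ^ 2 ∂P
      let N : ℝ → ℕ := fun ς => ⌈C₁ * (1 + V) * b⁻¹ * ς⁻¹⌉₊
      -- the second moments are finite and bounded in terms of `b`
      (∀ k, Integrable (fun ω => ‖x k ω - xs‖ ^ 2) P ∧ ∫ ω, ‖x k ω - xs‖ ^ 2 ∂P ≤ W b) ∧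
      -- the tolerance is reached after `N ς` iterations
      (∀ k, Integrable (fun ω => r k ω ^ 2) P) ∧
      (∀ ς : ℝ, 0 < ς → ∃ k ≤ N ς, ∫ ω, r k ω ^ 2 ∂P ≤ ς) ∧
      -- the oracle complexity of these iterations
      (∀ᵐ ω ∂P, ∀ ς : ℝ, 0 < ς → b * ς ≤ 1 / 2 →
        ∑ k ∈ Finset.range (N ς + 1),
            (1 + (searchCount a X T ξs ηs x₀ k ω : ℝ)) * (sampleRate 𝒩 lam b k : ℝ)
          ≤ C₂ * (1 + V) ^ 4 * (b⁻¹) ^ 3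
            * (1 + (Finset.range (N ς + 1)).sup' Finset.nonempty_range_add_one (fun k =>
                Real.logb (1 / a.ρ)
                  (a.γ * empMean L (fun j => ξs k j ω) / min (a.ρ * a.μ) a.γ)))
            * Real.log (b⁻¹ * ς⁻¹) ^ (2 + 2 * b) * ((n : ℝ) ^ 2 * (ς⁻¹) ^ 3)) := by
  set K := momentConst Λ σ R with hK
  set U := R ^ 2 + a.M * (1 + a.M) * a.ν ^ 2 * andersonTail a.τ 1 with hU
  -- U bounds the initial Lyapunov value; the factor bmax comes from U ≤ U * bmax * b⁻¹. The summand
  -- 1 makes the bound on the summed residuals strict.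
  set C₁ := |(U * bmax + errorConst a K * rateConst bmax) / residualWeight a K| + 1 with hC₁
  have hC₁0 : 0 < C₁ := by positivity
  refine ⟨C₁, |complexityConst C₁ lam bmax c| + 1,
    fun b => (1 + U) * Real.exp (errorConst a K * (rateConst bmax * b⁻¹)), hC₁0, by positivity, ?_⟩
  intro b hb hbm n 𝒩 h𝒩 h𝒩c Ω Ξ _ _ P _ X T ξ L xc x₀ xs hc hX hT hξ hH hLM hx₀ hxs hx₀R hxcR
    ξs ηs hsamp x r V N
  have hO : OracleMoments (P.map ξ) T L xs K := hLM.oracleMoments hp hq hT hξ hxcR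
  have hmean := meanOp_eq_mean (P := P) hT hξ
  have hS := sampleRate_ne_zero (b := b) h𝒩 hlam
  have hc0 := hO.errorConst_nonneg ha
  have hw0 := hO.residualWeight_pos ha
  have htail := andersonTail_nonneg ha.τ_gt 1
  have hM := ha.M_pos
  have hU0 : 0 ≤ U := by positivity
  have hly : lyapunov a xs (x₀, 1) ≤ U := by
    have := pow_le_pow_left₀ (norm_nonneg _) hx₀R 2
    simp only [lyapunov]
    linarith
  obtain ⟨hd, hf, hsum⟩ := hsamp.iterate_bounds (a := a) (x₀ := x₀) hO hξ ha hc hX (hmean ▸ hH)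
    (hmean ▸ hxs) hS
  rw [← hmean] at hf hsum
  change ∀ k, Integrable (fun ω => r k ω ^ 2) P at hf
  have he := sum_one_div_sqrt_sampleRate_le h𝒩 hlam hb hbm
  have hbound : ∀ k, 1 + ∫ ω, ‖x k ω - xs‖ ^ 2 ∂P
      ≤ (1 + U) * Real.exp (errorConst a K * (rateConst bmax * b⁻¹)) := fun k => by
    refine (hd k).2.trans ?_
    gcongr
    exact he k
  -- A real supremum is only meaningful once boundedness is known. The Gronwall bound supplies it,
  -- and also `W`.
  have hbdd : BddAbove (Set.range fun k => ∫ ω, ‖x k ω - xs‖ ^ 2 ∂P) :=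
    ⟨_, by rintro _ ⟨k, rfl⟩; exact (le_add_of_nonneg_left zero_le_one).trans (hbound k)⟩
  have hV : ∀ k, ∫ ω, ‖x k ω - xs‖ ^ 2 ∂P ≤ V := fun k => le_ciSup hbdd k
  have hV0 : 0 ≤ V := (integral_nonneg fun ω => sq_nonneg _).trans (hV 0)
  have hres : ∀ m, ∑ k ∈ Finset.range m, ∫ ω, r k ω ^ 2 ∂P < C₁ * (1 + V) * b⁻¹ := fun m => by
    have hb' : 0 < b⁻¹ := by positivity
    have h1 : ∑ k ∈ Finset.range m, 1 / Real.sqrt (sampleRate 𝒩 lam b k)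
        * (1 + ∫ ω, ‖x k ω - xs‖ ^ 2 ∂P) ≤ rateConst bmax * b⁻¹ * (1 + V) := by
      refine le_trans ?_ (mul_le_mul_of_nonneg_right (he m) (by linarith))
      rw [Finset.sum_mul]
      refine Finset.sum_le_sum fun k _ => ?_
      have := hV k
      gcongr
    have h2 := (hsum m).trans (add_le_add hly (mul_le_mul_of_nonneg_left h1 hc0))
    have h3 : U ≤ U * bmax * b⁻¹ * (1 + V) := by
      have : 1 ≤ bmax * b⁻¹ := by rw [← div_eq_mul_inv, le_div_iff₀ hb]; linarith
      have : 1 ≤ bmax * b⁻¹ * (1 + V) := one_le_mul_of_one_le_of_one_le this (by linarith)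
      nlinarith
    have h4 : ∑ k ∈ Finset.range m, ∫ ω, r k ω ^ 2 ∂P
        ≤ (U * bmax + errorConst a K * rateConst bmax) / residualWeight a K * ((1 + V) * b⁻¹) := by
      rw [div_mul_eq_mul_div, le_div_iff₀ hw0]
      change residualWeight a K * ∑ k ∈ Finset.range m, ∫ ω, r k ω ^ 2 ∂P ≤ _ at h2
      linarith
    have h5 : 0 < (1 + V) * b⁻¹ := by positivity
    have h6 := le_abs_self ((U * bmax + errorConst a K * rateConst bmax) / residualWeight a K)
    rw [mul_assoc]
    refine h4.trans_lt (mul_lt_mul_of_pos_right ?_ h5)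
    linarith
  refine ⟨fun k => ⟨(hd k).1, (le_add_of_nonneg_left zero_le_one).trans (hbound k)⟩, hf, ?_, ?_⟩
  · intro ς hς
    -- Otherwise (N + 1)ς would be at most the residual sum, which is less than C₁(1 + V)/b ≤ Nς.
    by_contra! hcon
    have h1 : ((N ς + 1 : ℕ) : ℝ) * ς ≤ ∑ k ∈ Finset.range (N ς + 1), ∫ ω, r k ω ^ 2 ∂P := by
      have := Finset.card_nsmul_le_sum (Finset.range (N ς + 1)) (fun k => ∫ ω, r k ω ^ 2 ∂P) ς
        fun k hk => (hcon k (Nat.lt_succ_iff.1 (Finset.mem_range.1 hk))).le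
      rwa [Finset.card_range, nsmul_eq_mul] at this
    have h2 : C₁ * (1 + V) * b⁻¹ * ς⁻¹ ≤ N ς := Nat.le_ceil _
    rw [← div_eq_mul_inv, div_le_iff₀ hς] at h2
    have h3 := hres (N ς + 1)
    push_cast at h1
    linarith
  -- There are countably many samples, so one null set serves all iterations and all ς at once.
  · have hgood : ∀ᵐ ω ∂P, ∀ k j, GoodSample T L (ξs k j ω) := by
      refine ae_all_iff.2 fun k => ae_all_iff.2 fun j => ?_
      have : ∀ᵐ s ∂(P.map (ξs k j)), GoodSample T L s := by
        rw [(hsamp.law_ξs k j).map_eq]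
        filter_upwards [hLM.one_le_L, hLM.lipschitz] with s h1 h2 using ⟨h1, h2⟩
      exact ae_of_ae_map (hsamp.measurable_ξs k j).aemeasurable this
    filter_upwards [hgood] with ω hω ς hς hbς
    set M := (Finset.range (N ς + 1)).sup' Finset.nonempty_range_add_one (fun k =>
      Real.logb (1 / a.ρ) (a.γ * empMean L (fun j => ξs k j ω) / min (a.ρ * a.μ) a.γ))
    have hcount : ∀ k ∈ Finset.range (N ς + 1), (searchCount a X T ξs ηs x₀ k ω : ℝ) ≤ M :=
      fun k hk => by
        refine le_trans ?_ (Finset.le_sup' (fun k => Real.logb (1 / a.ρ)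
          (a.γ * empMean L (fun j => ξs k j ω) / min (a.ρ * a.μ) a.γ)) hk)
        exact lineSearchCount_le_logb (OracleMoments.empMean_ge_one (hS k) fun j => (hω k j).1)
          (OracleMoments.norm_empOp_sub_le fun j => (hω k j).2) ha
    have hM0 : 0 ≤ M := (Nat.cast_nonneg _).trans (hcount 0 (by simp))
    -- The restriction bς ≤ 1/2 keeps ln(b⁻¹ς⁻¹) at least 1/2, as the counting lemma needs.
    have hZ : 2 ≤ b⁻¹ * ς⁻¹ := by
      rw [← mul_inv, le_inv_comm₀ (by norm_num) (by positivity)]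
      linarith
    have hN : (N ς : ℝ) ≤ C₁ * (1 + V) * (b⁻¹ * ς⁻¹) + 1 := by
      have h0 : 0 ≤ C₁ * (1 + V) * b⁻¹ * ς⁻¹ := by positivity
      rw [← mul_assoc]
      exact (Nat.ceil_lt_add_one h0).le
    have hrate := sum_sampleRate_le h𝒩c hlam hb hbm hC₁0 (by linarith : 1 ≤ 1 + V) hZ hN
    have hlogZ := half_le_log hZ
    have hζ : 0 ≤ Real.log (b⁻¹ * ς⁻¹) ^ (2 + 2 * b) := Real.rpow_nonneg (by linarith) _
    calc _ ≤ ∑ k ∈ Finset.range (N ς + 1), (1 + M) * (sampleRate 𝒩 lam b k : ℝ) :=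
          Finset.sum_le_sum fun k hk => mul_le_mul_of_nonneg_right
            (by have := hcount k hk; linarith) (Nat.cast_nonneg _)
      _ = (1 + M) * ∑ k ∈ Finset.range (N ς + 1), (sampleRate 𝒩 lam b k : ℝ) := by
          rw [Finset.mul_sum]
      _ ≤ (1 + M) * ((|complexityConst C₁ lam bmax c| + 1) * (1 + V) ^ 4
          * Real.log (b⁻¹ * ς⁻¹) ^ (2 + 2 * b) * ((n : ℝ) ^ 2 * (b⁻¹ * ς⁻¹) ^ 3)) := by
          refine mul_le_mul_of_nonneg_left (hrate.trans ?_) (by linarith)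
          gcongr
          have := le_abs_self (complexityConst C₁ lam bmax c)
          linarith
      _ = _ := by ring
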